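/- Let $k$ be an algebraically closed field. **Matrix bimodule problems.** Let $\mathcal T$ be a finite set (of vertices) and $R=\prod_{X\in\mathcal T}R_X$ a minimal algebra: each $R_X$ is either $k$ (trivial vertex) or $k[x,\varphi_X(x)^{-1}]$ with $0\ne\varphi_X\in k[x]$; $1_X$ is the identity of $R_X$, and $R^{\otimes p}$ is the $p$-fold tensor power over $k$. Let $T=\{1,\dots,t\}$ be partitioned into non-empty classes indexed by $\mathcal T$. Matrices over $R\otimes_kR$ are multiplied by $(u_{ij})(v_{jl})=(\sum_j u_{ij}\otimes_Rv_{jl})$, with entries in $R^{\otimes3}$. A *quasi-basis* is a finite family of $t\times t$ matrices $U_j$ over $R\otimes_kR$, each with vertices $s(U_j)=X$, $t(U_j)=Y$ such that the entries of $U_j$ lie in $R_X\otimes_kR_Y$ and vanish outside the places $X\times Y$, and such that $\sum_jc_jU_j=0$ with $c_j\in R_{s(U_j)}\otimes_k R_{t(U_j)}$ implies $c_j=0$ for all $j$. A *matrix bimodule problem* $\mathfrak A=(R,\mathcal K,\mathcal M,H)$ is given by a quasi-basis $V_1,\dots,V_m$ (of $\mathcal K_1$) of strictly upper triangular matrices,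 a normalized quasi-basis $A_1,\dots,A_n$ (of $\mathcal M_1$), and a matrix $H=(h_{ij})$ over $R$ with $h_{ij}\in R_X$ for $i,j\in X$ and $h_{ij}=0$ if $i,j$ are in different classes, such that $$V_iV_j=\sum_l\gamma_{ijl}V_l,\quad V_iA_j=\sum_l\eta_{ijl}A_l,\quad A_iV_j=\sum_l\sigma_{ijl}A_l,\quad V_iH-HV_i=\sum_l\zeta_{il}A_l$$ with structure constants $\gamma_{ijl},\eta_{ijl},\sigma_{ijl}\in R^{\otimes3}$ (acting through the outer factors on the entries of $V_l$, $A_l$) and $\zeta_{il}\in R^{\otimes2}$, taken in the components belonging to the vertices of the matrices involved. *Normalized* means: the entries of $A_l$ are in $k\,(1_X\otimes1_Y)$ for $X=s(A_l)$, $Y=t(A_l)$; in the order $(i,j)\preceq(i',j')$ iff $i>i'$, or $i=i'$ and $j\le j'$, the first non-zero entry of $A_l$ is at its leading position $(p_l,q_l)$ and equals $1_X\otimes1_Y$; every $A_j$ with $j\ne l$ vanishes at $(p_l,q_l)$; and $A_1,\dots,A_n$ are numbered in the order of their leading positions. **The category $R(\mathfrak A)$.** An object $P$ consists of dimensions $m_X\ge0$,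 matrices $W_X\in\mathrm M_{m_X}(k)$ with $W_X=I$ at trivial vertices and $W_X$ a Weyr matrix without eigenvalue that is a root of $\varphi_X$ otherwise, and matrices $P(a_l)\in \mathrm M_{m_X\times m_Y}(k)$ for $X=s(A_l),Y=t(A_l)$. Put $m_i=m_X$ for $i\in X$. For an $m_X\times n_Y$ matrix $C$ and $u=\sum r\otimes s\in R_X\otimes_k R_Y$ put $C\otimes u=\sum r(W_X)\,C\,s(W'_Y)$, and let $C*U$ be the partitioned matrix with blocks $C\otimes u_{ij}$; $F_X*E_X$ has diagonal blocks $F_X$ at $i\in X$ and is $0$ elsewhere. Let $\bar P=\sum_XH_X(W_X)+\sum_lP(a_l)*A_l$, where $\sum_XH_X(W_X)$ has blocks $h_{ij}(W_X)$, $i,j\in X$. A morphism $f:P\to Q$ is a family $(f_X;f(v_j))$ of matrices $f_X\in\mathrm M_{m_X\times n_X}(k)$ with $W_Xf_X=f_XW'_X$ and $f(v_j)\in \mathrm M_{m_{s(V_j)}\times n_{t(V_j)}}(k)$ such that $\bar f=\sum_Xf_X*E_X+\sum_jf(v_j)*V_j$ satisfies $\bar P\bar f=\bar f\bar Q$. The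 composite $ff'$ has the components $f_Xf'_X$ and $f_{s(V_l)}f'(v_l)+f(v_l)f'_{t(V_l)}+\sum_{i,j}\gamma_{ijl}\otimes_{R^{\otimes3}}(f(v_i)\otimes_Rf'(v_j))$, so that $\overline{ff'}=\bar f\bar f'$. **The bocs $\mathfrak B=(\Gamma,\Omega)$.** Let $\Gamma$ be the tensor algebra over $R$ of the $R$-$R$-bimodule $\mathcal N=\bigoplus_l R1_{s(A_l)}\,a_l\,1_{t(A_l)}R$ (free on $a_1,\dots,a_n$ as indicated), $\mathcal C=\mathcal C_0\oplus\mathcal C_1$ with $\mathcal C_0\cong R$ generated by $\omega=\sum_Xe_X$, $e_X=1_X\omega$, and $\mathcal C_1=\bigoplus_jR1_{s(V_j)}\,v_j\,1_{t(V_j)}R$, and $\Xi=\Gamma\otimes_R\mathcal C\otimes_R\Gamma$. Put $$\iota_{11}(a_l)=\sum_{i,j}\eta_{ijl}\otimes_{R^{\otimes3}}(v_i\otimes_Ra_j),\quad \tau_{11}(a_l)=\sum_{i,j}\sigma_{ijl}\otimes_{R^{\otimes3}}(a_i\otimes_Rv_j),\quad \partial_1(a_l)=\sum_i\zeta_{il}\otimes_{R^{\otimes2}}v_i,$$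 and let $\Omega$ be the quotient of $\Xi$ by the sub-bimodule generated by $(\omega a_l+\iota_{11}(a_l))-(a_l\omega+\tau_{11}(a_l))+\partial_1(a_l)$, $l=1,\dots,n$. It is a coalgebra over $\Gamma$ with counit $\varepsilon(\omega)=1$, $\varepsilon(v_j)=0$ and comultiplication $\mu(\omega)=\omega\otimes\omega$, $\mu(v_l)=\omega\otimes v_l+v_l\otimes\omega+\sum_{i,j}\gamma_{ijl}\otimes_{R^{\otimes3}}(v_i\otimes v_j)$. The differential determined by $\omega$ is $\delta:\Gamma\to\Omega$, $\delta(g)=g\omega-\omega g$. The category $R(\mathfrak B)$ has as objects the finite-dimensional right $\Gamma$-modules, as morphisms $P\to Q$ the right $\Gamma$-maps $P\otimes_\Gamma\Omega\to Q$, with composition through $\mu$ and identities through $\varepsilon$. **The formal equation.** Let $\Theta=\sum_ia_i*A_i$, $\Upsilon=\sum_Xe_X*E_X$, $\Pi=\sum_jv_j*V_j$ be the $t\times t$ matrices with entries $\sum_iA_i(p,q)\otimes_{R^{\otimes2}}a_i$, $\delta_{pq}e_X$ ($p\in X$), $\sum_jV_j(p,q)\otimes_{R^{\otimes2}}v_j$.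 The formal equation is $(\Theta+H)(\Upsilon+\Pi)=(\Upsilon+\Pi)(\Theta+H)$. **Statement.** Let $\mathfrak A$ be a matrix bimodule problem over $k$ and $\mathfrak B=(\Gamma,\Omega)$ its associated bocs. 1. For every $l$, the $(p_l,q_l)$-entry of the formal equation is $\delta(a_l)=\iota_{11}(a_l)-\tau_{11}(a_l)+\partial_1(a_l)$: in $\Xi$, the $(p_l,q_l)$-entry of $(\Theta+H)(\Upsilon+\Pi)-(\Upsilon+\Pi)(\Theta+H)$ equals $(a_l\omega-\omega a_l)-(\iota_{11}(a_l)-\tau_{11}(a_l)+\partial_1(a_l))$; and in $\Omega$ the formal equation holds and $\delta(a_l)=\iota_{11}(a_l)-\tau_{11}(a_l)+\partial_1(a_l)$. 2. The representation categories $R(\mathfrak A)$ and $R(\mathfrak B)$ are equivalent, by a $k$-linear equivalence. -/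

import Mathlib

open scoped TensorProduct Polynomial
open CategoryTheory

universe u

namespace MBP

section Tensor

variable (k R : Type*) [Field k] [CommRing R] [Algebra k R]

/-- `R^{⊗2}`, `R^{⊗3}`, `R^{⊗4}` over `k`. -/
abbrev T2 := R ⊗[k] R
abbrev T3 := R ⊗[k] (R ⊗[k] R)
abbrev T4 := R ⊗[k] (R ⊗[k] (R ⊗[k] R))

noncomputable instance instT3 : CommRing (T3 k R) := inferInstance
noncomputable instance instT4 : CommRing (T4 k R) := inferInstance

/-- `i_S` inserts the tensor factors at the places listed in `S` and `1` elsewhere. -/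
noncomputable def i12 : T2 k R →ₐ[k] T3 k R :=
  Algebra.TensorProduct.map (AlgHom.id k R) Algebra.TensorProduct.includeLeft
noncomputable def i13 : T2 k R →ₐ[k] T3 k R :=
  Algebra.TensorProduct.map (AlgHom.id k R) Algebra.TensorProduct.includeRight
noncomputable def i23 : T2 k R →ₐ[k] T3 k R := Algebra.TensorProduct.includeRight
noncomputable def i123 : T3 k R →ₐ[k] T4 k R :=
  Algebra.TensorProduct.map (AlgHom.id k R) (i12 k R)
noncomputable def i124 : T3 k R →ₐ[k] T4 k R :=
  Algebra.TensorProduct.map (AlgHom.id k R) (i13 k R)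
noncomputable def i134 : T3 k R →ₐ[k] T4 k R :=
  Algebra.TensorProduct.map (AlgHom.id k R) (i23 k R)
noncomputable def i234 : T3 k R →ₐ[k] T4 k R := Algebra.TensorProduct.includeRight

variable {k R}

@[simp] lemma i12_tmul (a b : R) : i12 k R (a ⊗ₜ b) = a ⊗ₜ (b ⊗ₜ 1) := by simp [i12]
@[simp] lemma i13_tmul (a b : R) : i13 k R (a ⊗ₜ b) = a ⊗ₜ (1 ⊗ₜ b) := by simp [i13]
@[simp] lemma i23_tmul (a b : R) : i23 k R (a ⊗ₜ b) = 1 ⊗ₜ (a ⊗ₜ b) := by simp [i23]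
@[simp] lemma i123_tmul (a b c : R) :
    i123 k R (a ⊗ₜ (b ⊗ₜ c)) = a ⊗ₜ (b ⊗ₜ (c ⊗ₜ 1)) := by simp [i123]
@[simp] lemma i124_tmul (a b c : R) :
    i124 k R (a ⊗ₜ (b ⊗ₜ c)) = a ⊗ₜ (b ⊗ₜ (1 ⊗ₜ c)) := by simp [i124]
@[simp] lemma i134_tmul (a b c : R) :
    i134 k R (a ⊗ₜ (b ⊗ₜ c)) = a ⊗ₜ (1 ⊗ₜ (b ⊗ₜ c)) := by simp [i134]
@[simp] lemma i234_tmul (a b c : R) :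
    i234 k R (a ⊗ₜ (b ⊗ₜ c)) = 1 ⊗ₜ (a ⊗ₜ (b ⊗ₜ c)) := by simp [i234]

lemma T3.ext {N : Type*} [AddCommMonoid N] [Module k N] {f g : T3 k R →ₗ[k] N}
    (h : ∀ a b c, f (a ⊗ₜ (b ⊗ₜ c)) = g (a ⊗ₜ (b ⊗ₜ c))) : f = g := by
  ext a b c; exact h a b c

lemma T3.ind {p : T3 k R → Prop} (x : T3 k R) (h0 : p 0)
    (h : ∀ a b c, p (a ⊗ₜ (b ⊗ₜ c))) (ha : ∀ x y, p x → p y → p (x + y)) : p x := by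
  induction x using TensorProduct.induction_on with
  | zero => exact h0
  | add x y hx hy => exact ha x y hx hy
  | tmul a y =>
    induction y using TensorProduct.induction_on with
    | zero => simpa using h0
    | add x y hx hy => rw [TensorProduct.tmul_add]; exact ha _ _ hx hy
    | tmul b c => exact h a b c

/-- A `k`-space with commuting left and right `R`-actions, i.e. an `R`-`R`-bimodule, is recorded
by the algebra homomorphism `R^{⊗2} → End_k M`. -/
abbrev BiAct (k R M : Type*) [Field k] [CommRing R] [Algebra k R] [AddCommGroup M] [Module k M] :=
  T2 k R →ₐ[k] Module.End k M

section Ev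

variable {M₁ M₂ M₃ M₁₂ M₂₃ M : Type*}
  [AddCommGroup M₁] [Module k M₁] [AddCommGroup M₂] [Module k M₂]
  [AddCommGroup M₃] [Module k M₃] [AddCommGroup M₁₂] [Module k M₁₂]
  [AddCommGroup M₂₃] [Module k M₂₃] [AddCommGroup M] [Module k M]

/-- For a pairing `β` of bimodules, `ev3 β x y (r ⊗ s ⊗ t) = β (r x s) (y t)`; this is
`(r ⊗ s ⊗ t) ⊗_{R^{⊗3}} (x ⊗_R y)`. -/
noncomputable def ev3 (a₁ : BiAct k R M₁) (a₂ : BiAct k R M₂) (β : M₁ →ₗ[k] M₂ →ₗ[k] M)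
    (x : M₁) (y : M₂) : T3 k R →ₗ[k] M :=
  TensorProduct.lift (β.compl₁₂ (LinearMap.applyₗ x ∘ₗ a₁.toLinearMap)
    (LinearMap.applyₗ y ∘ₗ a₂.toLinearMap ∘ₗ
      (Algebra.TensorProduct.includeRight : R →ₐ[k] T2 k R).toLinearMap)) ∘ₗ
    (TensorProduct.assoc k R R R).symm.toLinearMap

@[simp] lemma ev3_tmul (a₁ : BiAct k R M₁) (a₂ : BiAct k R M₂) (β : M₁ →ₗ[k] M₂ →ₗ[k] M)
    (x : M₁) (y : M₂) (r s t : R) :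
    ev3 a₁ a₂ β x y (r ⊗ₜ (s ⊗ₜ t)) = β (a₁ (r ⊗ₜ s) x) (a₂ (1 ⊗ₜ t) y) := by
  simp [ev3]

lemma ev3_add_left (a₁ : BiAct k R M₁) (a₂ : BiAct k R M₂) (β : M₁ →ₗ[k] M₂ →ₗ[k] M)
    (x x' : M₁) (y : M₂) (c : T3 k R) :
    ev3 a₁ a₂ β (x + x') y c = ev3 a₁ a₂ β x y c + ev3 a₁ a₂ β x' y c := by
  rw [← LinearMap.add_apply]; congr 1; apply T3.ext; intros; simp

lemma ev3_add_right (a₁ : BiAct k R M₁) (a₂ : BiAct k R M₂) (β : M₁ →ₗ[k] M₂ →ₗ[k] M)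
    (x : M₁) (y y' : M₂) (c : T3 k R) :
    ev3 a₁ a₂ β x (y + y') c = ev3 a₁ a₂ β x y c + ev3 a₁ a₂ β x y' c := by
  rw [← LinearMap.add_apply]; congr 1; apply T3.ext; intros; simp

lemma ev3_smul_left (a₁ : BiAct k R M₁) (a₂ : BiAct k R M₂) (β : M₁ →ₗ[k] M₂ →ₗ[k] M)
    (e : k) (x : M₁) (y : M₂) (c : T3 k R) :
    ev3 a₁ a₂ β (e • x) y c = e • ev3 a₁ a₂ β x y c := by
  rw [← LinearMap.smul_apply]; congr 1; apply T3.ext; intros; simp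

lemma ev3_smul_right (a₁ : BiAct k R M₁) (a₂ : BiAct k R M₂) (β : M₁ →ₗ[k] M₂ →ₗ[k] M)
    (e : k) (x : M₁) (y : M₂) (c : T3 k R) :
    ev3 a₁ a₂ β x (e • y) c = e • ev3 a₁ a₂ β x y c := by
  rw [← LinearMap.smul_apply]; congr 1; apply T3.ext; intros; simp

/-- `ev3` as a bilinear map in the two arguments. -/
noncomputable def ev3ₗ (a₁ : BiAct k R M₁) (a₂ : BiAct k R M₂) (β : M₁ →ₗ[k] M₂ →ₗ[k] M)
    (c : T3 k R) : M₁ →ₗ[k] M₂ →ₗ[k] M :=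
  LinearMap.mk₂ k (fun x y => ev3 a₁ a₂ β x y c)
    (fun x x' y => ev3_add_left a₁ a₂ β x x' y c) (fun e x y => ev3_smul_left a₁ a₂ β e x y c)
    (fun x y y' => ev3_add_right a₁ a₂ β x y y' c) (fun e x y => ev3_smul_right a₁ a₂ β e x y c)

@[simp] lemma ev3ₗ_apply (a₁ : BiAct k R M₁) (a₂ : BiAct k R M₂) (β : M₁ →ₗ[k] M₂ →ₗ[k] M)
    (c : T3 k R) (x : M₁) (y : M₂) : ev3ₗ a₁ a₂ β c x y = ev3 a₁ a₂ β x y c := rfl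

/-- `β` is an `R`-balanced pairing of `R`-`R`-bimodules. -/
structure IsPairing (a₁ : BiAct k R M₁) (a₂ : BiAct k R M₂) (a : BiAct k R M)
    (β : M₁ →ₗ[k] M₂ →ₗ[k] M) : Prop where
  outer : ∀ r t x y, a (r ⊗ₜ t) (β x y) = β (a₁ (r ⊗ₜ 1) x) (a₂ (1 ⊗ₜ t) y)
  inner : ∀ s x y, β (a₁ (1 ⊗ₜ s) x) y = β x (a₂ (s ⊗ₜ 1) y)

lemma BiAct.mul (a : BiAct k R M) (r s r' s' : R) (x : M) :
    a (r ⊗ₜ s) (a (r' ⊗ₜ s') x) = a ((r * r') ⊗ₜ (s * s')) x := by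
  rw [← Module.End.mul_apply, ← map_mul, Algebra.TensorProduct.tmul_mul_tmul]

lemma ev3_outer {a₁ : BiAct k R M₁} {a₂ : BiAct k R M₂} {a : BiAct k R M}
    {β : M₁ →ₗ[k] M₂ →ₗ[k] M} (h : IsPairing a₁ a₂ a β) (x : M₁) (y : M₂) (u : T2 k R)
    (c : T3 k R) : a u (ev3 a₁ a₂ β x y c) = ev3 a₁ a₂ β x y (i13 k R u * c) := by
  induction u using TensorProduct.induction_on with
  | zero => simp
  | add u v hu hv => simp [add_mul, hu, hv]
  | tmul r t =>
    induction c using T3.ind with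
    | h0 => simp
    | ha _ _ h1 h2 => simp only [map_add, mul_add, h1, h2]
    | h p q s => simp [h.outer, BiAct.mul]

lemma ev3_mul {a₁ : BiAct k R M₁} {a₂ : BiAct k R M₂} {a : BiAct k R M}
    {β : M₁ →ₗ[k] M₂ →ₗ[k] M} (h : IsPairing a₁ a₂ a β) (x : M₁) (y : M₂) (u v : T2 k R) :
    β (a₁ u x) (a₂ v y) = ev3 a₁ a₂ β x y (i12 k R u * i23 k R v) := by
  induction u using TensorProduct.induction_on with
  | zero => simp
  | add u v hu hv => simp [add_mul, hu, hv]
  | tmul r t =>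
    induction v using TensorProduct.induction_on with
    | zero => simp
    | add u v hu hv => simp only [map_add, LinearMap.add_apply, mul_add, hu, hv]
    | tmul p q =>
      have h1 : a₂ (p ⊗ₜ q) y = a₂ (p ⊗ₜ 1) (a₂ (1 ⊗ₜ q) y) := by simp [BiAct.mul]
      rw [h1, ← h.inner]
      simp [BiAct.mul, mul_comm]

/-- `c ⊗_{R^{⊗4}} (x ⊗_R y ⊗_R z)`. -/
noncomputable def ev4 (a₁ : BiAct k R M₁) (a₂ : BiAct k R M₂) (a₃ : BiAct k R M₃)
    (τ : M₁ →ₗ[k] M₂ →ₗ[k] M₃ →ₗ[k] M) (x : M₁) (y : M₂) (z : M₃) : T4 k R →ₗ[k] M :=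
  TensorProduct.lift
    (((TensorProduct.lift ((τ.compl₁₂ (LinearMap.applyₗ x ∘ₗ a₁.toLinearMap)
      (LinearMap.applyₗ y ∘ₗ a₂.toLinearMap ∘ₗ
      (Algebra.TensorProduct.includeRight : R →ₐ[k] T2 k R).toLinearMap))))).compl₁₂
      LinearMap.id (LinearMap.applyₗ z ∘ₗ a₃.toLinearMap ∘ₗ
      (Algebra.TensorProduct.includeRight : R →ₐ[k] T2 k R).toLinearMap)) ∘ₗ
    (TensorProduct.assoc k (R ⊗[k] R) R R).symm.toLinearMap ∘ₗ
    (TensorProduct.assoc k R R (R ⊗[k] R)).symm.toLinearMap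

@[simp] lemma ev4_tmul (a₁ : BiAct k R M₁) (a₂ : BiAct k R M₂) (a₃ : BiAct k R M₃)
    (τ : M₁ →ₗ[k] M₂ →ₗ[k] M₃ →ₗ[k] M) (x : M₁) (y : M₂) (z : M₃) (r s t w : R) :
    ev4 a₁ a₂ a₃ τ x y z (r ⊗ₜ (s ⊗ₜ (t ⊗ₜ w))) =
      τ (a₁ (r ⊗ₜ s) x) (a₂ (1 ⊗ₜ t) y) (a₃ (1 ⊗ₜ w) z) := by
  simp [ev4]

lemma ev3_nest_left {a₁ : BiAct k R M₁} {a₂ : BiAct k R M₂} {a₃ : BiAct k R M₃}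
    {a₁₂ : BiAct k R M₁₂} {β : M₁ →ₗ[k] M₂ →ₗ[k] M₁₂} {β' : M₁₂ →ₗ[k] M₃ →ₗ[k] M}
    {τ : M₁ →ₗ[k] M₂ →ₗ[k] M₃ →ₗ[k] M} (h : IsPairing a₁ a₂ a₁₂ β)
    (hτ : ∀ x y z, τ x y z = β' (β x y) z) (x : M₁) (y : M₂) (z : M₃) (c d : T3 k R) :
    ev3 a₁₂ a₃ β' (ev3 a₁ a₂ β x y c) z d =
      ev4 a₁ a₂ a₃ τ x y z (i123 k R c * i134 k R d) := by
  induction c using T3.ind with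
  | h0 => rw [← ev3ₗ_apply]; simp
  | ha _ _ h1 h2 => rw [map_add, ev3_add_left, h1, h2, map_add, add_mul, map_add]
  | h p q r =>
    induction d using T3.ind with
    | h0 => simp
    | ha _ _ h1 h2 => rw [map_add, h1, h2, map_add, mul_add, map_add]
    | h p' q' r' => simp [h.outer, BiAct.mul, hτ, mul_comm]

lemma ev3_nest_right {a₁ : BiAct k R M₁} {a₂ : BiAct k R M₂} {a₃ : BiAct k R M₃}
    {a₂₃ : BiAct k R M₂₃} {β : M₂ →ₗ[k] M₃ →ₗ[k] M₂₃} {β' : M₁ →ₗ[k] M₂₃ →ₗ[k] M}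
    {τ : M₁ →ₗ[k] M₂ →ₗ[k] M₃ →ₗ[k] M} (h : IsPairing a₂ a₃ a₂₃ β)
    {a : BiAct k R M} (h' : IsPairing a₁ a₂₃ a β')
    (hτ : ∀ x y z, τ x y z = β' x (β y z)) (x : M₁) (y : M₂) (z : M₃) (c d : T3 k R) :
    ev3 a₁ a₂₃ β' x (ev3 a₂ a₃ β y z c) d =
      ev4 a₁ a₂ a₃ τ x y z (i234 k R c * i124 k R d) := by
  induction c using T3.ind with
  | h0 => rw [map_zero, ← ev3ₗ_apply, map_zero]; simp
  | ha _ _ h1 h2 => rw [map_add, ev3_add_right, h1, h2, map_add, add_mul, map_add]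
  | h p q r =>
    induction d using T3.ind with
    | h0 => simp
    | ha _ _ h1 h2 => rw [map_add, h1, h2, map_add, mul_add, map_add]
    | h p' q' r' =>
      have h1 : a₂ (p ⊗ₜ q) y = a₂ (p ⊗ₜ 1) (a₂ (1 ⊗ₜ q) y) := by simp [BiAct.mul]
      have h2 : β (a₂ (p ⊗ₜ 1) (a₂ (1 ⊗ₜ q) y)) (a₃ (1 ⊗ₜ (r' * r)) z) =
          a₂₃ (p ⊗ₜ 1) (β (a₂ (1 ⊗ₜ q) y) (a₃ (1 ⊗ₜ (r' * r)) z)) := by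
        rw [h.outer]; simp [BiAct.mul]
      simp only [ev3_tmul, h.outer, BiAct.mul, one_mul, i234_tmul, i124_tmul,
        Algebra.TensorProduct.tmul_mul_tmul, ev4_tmul, hτ, mul_one]
      rw [h1, h2, ← h'.inner]
      simp [BiAct.mul, mul_comm]

end Ev

end Tensor

section MinimalAlgebra

/-- The algebra at a vertex: `k` at a trivial vertex, `k[x, φ(x)⁻¹]` at a non-trivial one. -/
def LocAlg (k : Type u) [Field k] : Option {p : k[X] // p ≠ 0} → Type u
  | none => k
  | some p => Localization.Away p.1

noncomputable instance (k : Type u) [Field k] (o : Option {p : k[X] // p ≠ 0}) :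
    CommRing (LocAlg k o) :=
  match o with
  | none => inferInstanceAs (CommRing k)
  | some p => inferInstanceAs (CommRing (Localization.Away p.1))

noncomputable instance (k : Type u) [Field k] (o : Option {p : k[X] // p ≠ 0}) :
    Algebra k (LocAlg k o) :=
  match o with
  | none => inferInstanceAs (Algebra k k)
  | some p => inferInstanceAs (Algebra k (Localization.Away p.1))

/-- A finite vertex set with the choice, at each vertex, of `k` or of a localization of `k[x]`. -/
structure MinAlg (k : Type u) [Field k] where
  Vert : Type
  [fin : Fintype Vert]
  [dec : DecidableEq Vert]
  loc : Vert → Option {p : k[X] // p ≠ 0}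

attribute [instance] MinAlg.fin MinAlg.dec

variable {k : Type u} [Field k]

/-- The minimal algebra `R = ∏ R_X`. -/
def MinAlg.R (B : MinAlg k) : Type u := ∀ X : B.Vert, LocAlg k (B.loc X)

noncomputable instance (B : MinAlg k) : CommRing B.R :=
  inferInstanceAs (CommRing (∀ X : B.Vert, LocAlg k (B.loc X)))

noncomputable instance (B : MinAlg k) : Algebra k B.R :=
  inferInstanceAs (Algebra k (∀ X : B.Vert, LocAlg k (B.loc X)))

/-- The idempotent `1_X`. -/
noncomputable def MinAlg.e (B : MinAlg k) (X : B.Vert) : B.R :=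
  (Pi.single X 1 : ∀ X : B.Vert, LocAlg k (B.loc X))

lemma MinAlg.e_mul_self (B : MinAlg k) (X : B.Vert) : B.e X * B.e X = B.e X := by
  have : (Pi.single X 1 : ∀ X : B.Vert, LocAlg k (B.loc X)) * Pi.single X 1 = Pi.single X 1 := by
    rw [← Pi.single_mul, one_mul]
  exact this

/-- `1_X ⊗ 1_Y`. -/
noncomputable def MinAlg.e2 (B : MinAlg k) (X Y : B.Vert) : T2 k B.R := B.e X ⊗ₜ B.e Y

lemma MinAlg.e2_mul_self (B : MinAlg k) (X Y : B.Vert) : B.e2 X Y * B.e2 X Y = B.e2 X Y := by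
  simp [MinAlg.e2, B.e_mul_self]

end MinimalAlgebra

section QuasiBasis

variable {k : Type u} [Field k]

/-- The product `(u_{ij}) (v_{jl}) = (∑ u_{ij} ⊗_R v_{jl})` of two matrices over `R ⊗_k R`,
with entries in `R^{⊗3}`; here `(a ⊗ b) ⊗_R (c ⊗ d) = a ⊗ bc ⊗ d`. -/
noncomputable def prod2 {R : Type*} [CommRing R] [Algebra k R] {t : ℕ}
    (U V : Matrix (Fin t) (Fin t) (T2 k R)) : Matrix (Fin t) (Fin t) (T3 k R) :=
  U.map (i12 k R) * V.map (i23 k R)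

/-- A finite family of `t × t` matrices over `R ⊗_k R`, the `j`-th one with
`1_X U 1_Y = U` for `X = src j`, `Y = tgt j` (so its entries are in `R_X ⊗ R_Y` and sit at the
places `(p, q)` with `p ∈ X`, `q ∈ Y`), which is an `R`-`R`-quasi-basis of the bimodule it
generates. -/
structure QBasis (B : MinAlg k) {t : ℕ} (cls : Fin t → B.Vert) (N : ℕ) where
  src : Fin N → B.Vert
  tgt : Fin N → B.Vert
  mat : Fin N → Matrix (Fin t) (Fin t) (T2 k B.R)
  supp : ∀ j p q, mat j p q ≠ 0 → cls p = src j ∧ cls q = tgt j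
  comp : ∀ j p q, B.e2 (src j) (tgt j) * mat j p q = mat j p q
  free : ∀ c : Fin N → T2 k B.R, ∑ j, c j • mat j = 0 →
    ∀ j, B.e2 (src j) (tgt j) * c j = 0

variable {B : MinAlg k} {t : ℕ} {cls : Fin t → B.Vert} {N₁ N₂ N₃ N₁₂ N₂₃ N : ℕ}

/-- The bimodule of index `2` generated by a quasi-basis: `R^{⊗3} ⊗_{R^{⊗2}} 𝒮₁`. -/
noncomputable def QBasis.span3 (U : QBasis B cls N) : Submodule (T3 k B.R) (Matrix (Fin t) (Fin t) (T3 k B.R)) :=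
  Submodule.span _ (Set.range fun l => (U.mat l).map (i13 k B.R))

/-- The matrix product maps `𝒮₁ × 𝒮₁'` to `𝒮₂''`. -/
def MulClosed (U : QBasis B cls N₁) (U' : QBasis B cls N₂) (U'' : QBasis B cls N₃) : Prop :=
  ∀ i j, prod2 (U.mat i) (U'.mat j) ∈ U''.span3

lemma MulClosed.exists_coef {U : QBasis B cls N₁} {U' : QBasis B cls N₂} {U'' : QBasis B cls N₃}
    (h : MulClosed U U' U'') (i : Fin N₁) (j : Fin N₂) : ∃ c : Fin N₃ → T3 k B.R,
      ∑ l, c l • (U''.mat l).map (i13 k B.R) = prod2 (U.mat i) (U'.mat j) :=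
  (Submodule.mem_span_range_iff_exists_fun _).1 (h i j)

/-- The structure constants: `U_i U'_j = ∑_l coef i j l ⊗ U''_l`, with
`coef i j l ∈ R_X ⊗ R_Y ⊗ R_Z` for `U_i` from `X` to `Y`, `U'_j` from `Y` to `Z` and `U''_l`
from `X` to `Z`, and `coef i j l = 0` if the vertices do not match. -/
noncomputable def MulClosed.coef {U : QBasis B cls N₁} {U' : QBasis B cls N₂}
    {U'' : QBasis B cls N₃} (h : MulClosed U U' U'') (i : Fin N₁) (j : Fin N₂) (l : Fin N₃) :
    T3 k B.R :=
  i13 k B.R (B.e2 (U''.src l) (U''.tgt l)) *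
    (i12 k B.R (B.e2 (U.src i) (U.tgt i)) * i23 k B.R (B.e2 (U'.src j) (U'.tgt j))) *
      Classical.choose (h.exists_coef i j) l

lemma QBasis.map_comp {S : Type*} [CommRing S] (f : T2 k B.R →+* S) (U : QBasis B cls N)
    (l : Fin N) : f (B.e2 (U.src l) (U.tgt l)) • (U.mat l).map f = (U.mat l).map f := by
  ext p q
  simp only [Matrix.smul_apply, Matrix.map_apply, smul_eq_mul]
  rw [← map_mul, U.comp]

lemma MulClosed.coef_spec {U : QBasis B cls N₁} {U' : QBasis B cls N₂} {U'' : QBasis B cls N₃}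
    (h : MulClosed U U' U'') (i : Fin N₁) (j : Fin N₂) :
    prod2 (U.mat i) (U'.mat j) = ∑ l, h.coef i j l • (U''.mat l).map (i13 k B.R) := by
  have h1 := Classical.choose_spec (h.exists_coef i j)
  set c := Classical.choose (h.exists_coef i j)
  have h2 : (i12 k B.R (B.e2 (U.src i) (U.tgt i)) * i23 k B.R (B.e2 (U'.src j) (U'.tgt j))) •
      prod2 (U.mat i) (U'.mat j) = prod2 (U.mat i) (U'.mat j) := by
    unfold prod2
    have a1 := U.map_comp (i12 k B.R).toRingHom i
    have a2 := U'.map_comp (i23 k B.R).toRingHom j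
    simp only [AlgHom.toRingHom_eq_coe, RingHom.coe_coe] at a1 a2
    conv_rhs => rw [← a1, ← a2]
    rw [Matrix.smul_mul, Matrix.mul_smul, smul_smul]
  rw [← h2, ← h1, Finset.smul_sum]
  refine Finset.sum_congr rfl fun l _ => ?_
  have a3 := U''.map_comp (i13 k B.R).toRingHom l
  simp only [AlgHom.toRingHom_eq_coe, RingHom.coe_coe] at a3
  conv_lhs => rw [← a3]
  rw [smul_smul, smul_smul]
  congr 1
  simp only [MulClosed.coef, c]
  ring

lemma MulClosed.coef_cut {U : QBasis B cls N₁} {U' : QBasis B cls N₂} {U'' : QBasis B cls N₃}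
    (h : MulClosed U U' U'') (i : Fin N₁) (j : Fin N₂) (l : Fin N₃) :
    i13 k B.R (B.e2 (U''.src l) (U''.tgt l)) * h.coef i j l = h.coef i j l := by
  unfold MulClosed.coef
  rw [← mul_assoc, ← mul_assoc, ← map_mul, B.e2_mul_self]

lemma tensor_eq_zero {M N : Type*} [AddCommGroup M] [Module k M] [AddCommGroup N] [Module k N]
    (z : M ⊗[k] N)
    (h : ∀ φ : N →ₗ[k] k, TensorProduct.rid k M (LinearMap.lTensor M φ z) = 0) : z = 0 := by
  classical
  let b := Module.Basis.ofVectorSpace k N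
  apply (TensorProduct.equivFinsuppOfBasisRight b).injective
  rw [map_zero]
  ext i
  rw [TensorProduct.equivFinsuppOfBasisRight_apply]
  exact h (b.coord i)

/-- Quasi-freeness is inherited by an extension `f : R^{⊗2} → S` that has enough
`R^{⊗2}`-linear functionals. -/
lemma QBasis.free_map (U : QBasis B cls N) {S : Type*} [CommRing S] (f : T2 k B.R →+* S)
    (hf : ∀ z : S, (∀ Φ : S →+ T2 k B.R, (∀ u c, Φ (c * f u) = Φ c * u) → Φ z = 0) → z = 0)
    (c : Fin N → S) (h : ∑ j, c j • (U.mat j).map f = 0) (j : Fin N) :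
    f (B.e2 (U.src j) (U.tgt j)) * c j = 0 := by
  apply hf
  intro Φ hΦ
  rw [mul_comm, hΦ, mul_comm]
  refine U.free (fun j => Φ (c j)) ?_ j
  ext p q
  have := congrArg Φ (congrFun (congrFun h p) q)
  simpa [Matrix.sum_apply, hΦ] using this

lemma T3.sep {R : Type*} [CommRing R] [Algebra k R] (z : T3 k R)
    (hz : ∀ Φ : T3 k R →+ T2 k R, (∀ u c, Φ (c * i13 k R u) = Φ c * u) → Φ z = 0) : z = 0 := by
  let E : T3 k R ≃ₗ[k] (T2 k R) ⊗[k] R :=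
    (LinearEquiv.lTensor R (TensorProduct.comm k R R)).trans (TensorProduct.assoc k R R R).symm
  apply E.injective
  rw [map_zero]
  apply tensor_eq_zero
  intro φ
  let Ψ : T3 k R →ₗ[k] T2 k R :=
    ((TensorProduct.rid k (T2 k R)).toLinearMap ∘ₗ LinearMap.lTensor (T2 k R) φ) ∘ₗ E.toLinearMap
  refine hz Ψ.toAddMonoidHom ?_
  intro u c
  change Ψ _ = Ψ _ * u
  induction u using TensorProduct.induction_on with
  | zero => simp
  | add x y hx hy => simp only [map_add, mul_add, hx, hy]
  | tmul r s =>
    induction c using T3.ind with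
    | h0 => simp
    | ha _ _ h1 h2 => simp only [map_add, add_mul, h1, h2]
    | h a b c => simp [Ψ, E]

/-- `R^{⊗2} → R^{⊗4}`, first and last place. -/
noncomputable def i14 (k R : Type*) [Field k] [CommRing R] [Algebra k R] : T2 k R →ₐ[k] T4 k R :=
  (i134 k R).comp (i13 k R)

lemma i14_eq {R : Type*} [CommRing R] [Algebra k R] :
    i14 k R = (i124 k R).comp (i13 k R) := by
  ext <;> simp [i14]

lemma T4.ind {R : Type*} [CommRing R] [Algebra k R] {p : T4 k R → Prop} (x : T4 k R) (h0 : p 0)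
    (h : ∀ a b c d, p (a ⊗ₜ (b ⊗ₜ (c ⊗ₜ d)))) (ha : ∀ x y, p x → p y → p (x + y)) : p x := by
  induction x using TensorProduct.induction_on with
  | zero => exact h0
  | add x y hx hy => exact ha x y hx hy
  | tmul a y =>
    induction y using T3.ind with
    | h0 => simpa using h0
    | ha _ _ h1 h2 => rw [TensorProduct.tmul_add]; exact ha _ _ h1 h2
    | h b c d => exact h a b c d

lemma T4.sep {R : Type*} [CommRing R] [Algebra k R] (z : T4 k R)
    (hz : ∀ Φ : T4 k R →+ T2 k R, (∀ u c, Φ (c * i14 k R u) = Φ c * u) → Φ z = 0) : z = 0 := by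
  let E : T4 k R ≃ₗ[k] (T2 k R) ⊗[k] (T2 k R) :=
    (LinearEquiv.lTensor R ((TensorProduct.assoc k R R R).symm.trans
      (TensorProduct.comm k (R ⊗[k] R) R))).trans (TensorProduct.assoc k R R (R ⊗[k] R)).symm
  apply E.injective
  rw [map_zero]
  apply tensor_eq_zero
  intro φ
  let Ψ : T4 k R →ₗ[k] T2 k R :=
    ((TensorProduct.rid k (T2 k R)).toLinearMap ∘ₗ LinearMap.lTensor (T2 k R) φ) ∘ₗ E.toLinearMap
  refine hz Ψ.toAddMonoidHom ?_
  intro u c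
  change Ψ _ = Ψ _ * u
  induction u using TensorProduct.induction_on with
  | zero => simp
  | add x y hx hy => simp only [map_add, mul_add, hx, hy]
  | tmul r s =>
    induction c using T4.ind with
    | h0 => simp
    | ha _ _ h1 h2 => simp only [map_add, add_mul, h1, h2]
    | h a b c d => simp [Ψ, E, i14]

section Places

variable {R : Type*} [CommRing R] [Algebra k R]

lemma i123_i12 (u : T2 k R) : i123 k R (i12 k R u) = i124 k R (i12 k R u) :=
  DFunLike.congr_fun (show (i123 k R).comp (i12 k R) = (i124 k R).comp (i12 k R) by
    ext <;> simp) u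
lemma i123_i13 (u : T2 k R) : i123 k R (i13 k R u) = i134 k R (i12 k R u) :=
  DFunLike.congr_fun (show (i123 k R).comp (i13 k R) = (i134 k R).comp (i12 k R) by
    ext <;> simp) u

end Places

lemma map_smul_mat {S S' : Type*} [CommRing S] [CommRing S'] (f : S →+* S') (c : S)
    (X : Matrix (Fin t) (Fin t) S) : (c • X).map f = f c • X.map f := by
  ext; simp

lemma map_sum_mat {S S' ι : Type*} [CommRing S] [CommRing S'] (f : S →+* S') (s : Finset ι)
    (X : ι → Matrix (Fin t) (Fin t) S) : (∑ i ∈ s, X i).map f = ∑ i ∈ s, (X i).map f := by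
  ext; simp [Matrix.sum_apply]

/-- Associativity of the matrix product, in terms of structure constants. -/
lemma coef_assoc {U₁ : QBasis B cls N₁} {U₂ : QBasis B cls N₂} {U₃ : QBasis B cls N₃}
    {U₁₂ : QBasis B cls N₁₂} {U₂₃ : QBasis B cls N₂₃} {G : QBasis B cls N}
    (h₁₂ : MulClosed U₁ U₂ U₁₂) (h₂₃ : MulClosed U₂ U₃ U₂₃)
    (hl : MulClosed U₁₂ U₃ G) (hr : MulClosed U₁ U₂₃ G) (i : Fin N₁) (j : Fin N₂) (n : Fin N₃)
    (l : Fin N) :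
    ∑ a, i123 k B.R (h₁₂.coef i j a) * i134 k B.R (hl.coef a n l) =
      ∑ a, i234 k B.R (h₂₃.coef j n a) * i124 k B.R (hr.coef i a l) := by
  have hL : (prod2 (U₁.mat i) (U₂.mat j)).map (i123 k B.R).toRingHom *
      (U₃.mat n).map ((i134 k B.R).comp (i23 k B.R)).toRingHom =
      ∑ l, (∑ a, i123 k B.R (h₁₂.coef i j a) * i134 k B.R (hl.coef a n l)) •
        (G.mat l).map (i14 k B.R).toRingHom := by
    rw [h₁₂.coef_spec, map_sum_mat, Finset.sum_mul]
    have : ∀ a, (h₁₂.coef i j a • (U₁₂.mat a).map (i13 k B.R)).map (i123 k B.R).toRingHom *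
        (U₃.mat n).map ((i134 k B.R).comp (i23 k B.R)).toRingHom =
        ∑ l, (i123 k B.R (h₁₂.coef i j a) * i134 k B.R (hl.coef a n l)) •
        (G.mat l).map (i14 k B.R).toRingHom := by
      intro a
      have e1 : ((U₁₂.mat a).map (i13 k B.R)).map (i123 k B.R).toRingHom *
        (U₃.mat n).map ((i134 k B.R).comp (i23 k B.R)).toRingHom =
        (prod2 (U₁₂.mat a) (U₃.mat n)).map (i134 k B.R).toRingHom := by
        rw [prod2, Matrix.map_mul, Matrix.map_map, Matrix.map_map, Matrix.map_map]
        congr 1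
        ext p q : 2
        simp [i123_i13]
      rw [map_smul_mat, Matrix.smul_mul, e1, hl.coef_spec, map_sum_mat, Finset.smul_sum]
      refine Finset.sum_congr rfl fun l _ => ?_
      rw [map_smul_mat, smul_smul, Matrix.map_map]
      rfl
    rw [Finset.sum_congr rfl fun a _ => this a, Finset.sum_comm]
    simp_rw [Finset.sum_smul]
  have hR : (U₁.mat i).map ((i124 k B.R).comp (i12 k B.R)).toRingHom *
      (prod2 (U₂.mat j) (U₃.mat n)).map (i234 k B.R).toRingHom  =
      ∑ l, (∑ a, i234 k B.R (h₂₃.coef j n a) * i124 k B.R (hr.coef i a l)) •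
        (G.mat l).map (i14 k B.R).toRingHom := by
    rw [h₂₃.coef_spec, map_sum_mat, Finset.mul_sum]
    have : ∀ a, (U₁.mat i).map ((i124 k B.R).comp (i12 k B.R)).toRingHom *
        (h₂₃.coef j n a • (U₂₃.mat a).map (i13 k B.R)).map (i234 k B.R).toRingHom =
        ∑ l, (i234 k B.R (h₂₃.coef j n a) * i124 k B.R (hr.coef i a l)) •
        (G.mat l).map (i14 k B.R).toRingHom := by
      intro a
      have e1 : (U₁.mat i).map ((i124 k B.R).comp (i12 k B.R)).toRingHom *
        ((U₂₃.mat a).map (i13 k B.R)).map (i234 k B.R).toRingHom =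
        (prod2 (U₁.mat i) (U₂₃.mat a)).map (i124 k B.R).toRingHom := by
        rw [prod2, Matrix.map_mul, Matrix.map_map, Matrix.map_map, Matrix.map_map]
        congr 1
      rw [map_smul_mat, Matrix.mul_smul, e1, hr.coef_spec, map_sum_mat, Finset.smul_sum]
      refine Finset.sum_congr rfl fun l _ => ?_
      rw [map_smul_mat, smul_smul, Matrix.map_map, i14_eq]
      rfl
    rw [Finset.sum_congr rfl fun a _ => this a, Finset.sum_comm]
    simp_rw [Finset.sum_smul]
  have hLR : (prod2 (U₁.mat i) (U₂.mat j)).map (i123 k B.R).toRingHom *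
      (U₃.mat n).map ((i134 k B.R).comp (i23 k B.R)).toRingHom =
      (U₁.mat i).map ((i124 k B.R).comp (i12 k B.R)).toRingHom *
      (prod2 (U₂.mat j) (U₃.mat n)).map (i234 k B.R).toRingHom := by
    rw [prod2, prod2, Matrix.map_mul, Matrix.map_mul, ← Matrix.mul_assoc]
    simp only [Matrix.map_map]
    congr 1
    congr 1
    ext p q : 2
    simp [i123_i12]
  have key : ∑ l, (∑ a, i123 k B.R (h₁₂.coef i j a) * i134 k B.R (hl.coef a n l) -
      ∑ a, i234 k B.R (h₂₃.coef j n a) * i124 k B.R (hr.coef i a l)) •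
        (G.mat l).map (i14 k B.R).toRingHom = 0 := by
    simp_rw [sub_smul]
    rw [Finset.sum_sub_distrib, ← hL, ← hR, hLR, sub_self]
  have h0 := G.free_map (i14 k B.R).toRingHom (T4.sep) _ key l
  rw [mul_sub, sub_eq_zero, Finset.mul_sum, Finset.mul_sum] at h0
  have c1 : ∀ a, i14 k B.R (B.e2 (G.src l) (G.tgt l)) *
      (i123 k B.R (h₁₂.coef i j a) * i134 k B.R (hl.coef a n l)) =
      i123 k B.R (h₁₂.coef i j a) * i134 k B.R (hl.coef a n l) := by
    intro a
    rw [mul_left_comm]; congr 1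
    rw [i14, AlgHom.comp_apply, ← map_mul, hl.coef_cut]
  have c2 : ∀ a, i14 k B.R (B.e2 (G.src l) (G.tgt l)) *
      (i234 k B.R (h₂₃.coef j n a) * i124 k B.R (hr.coef i a l)) =
      i234 k B.R (h₂₃.coef j n a) * i124 k B.R (hr.coef i a l) := by
    intro a
    rw [mul_left_comm]; congr 1
    rw [i14_eq, AlgHom.comp_apply, ← map_mul, hr.coef_cut]
  have d1 := Finset.sum_congr (rfl : (Finset.univ : Finset (Fin N₁₂)) = _) fun a _ => c1 a
  have d2 := Finset.sum_congr (rfl : (Finset.univ : Finset (Fin N₂₃)) = _) fun a _ => c2 a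
  rw [← d1, ← d2]
  exact h0

end QuasiBasis

section Problem

/-- The order on matrix places: `(i, j) ≼ (i', j')` iff `i > i'`, or `i = i'` and `j ≤ j'`. -/
def PosLE {t : ℕ} (a b : Fin t × Fin t) : Prop := b.1 < a.1 ∨ (a.1 = b.1 ∧ a.2 ≤ b.2)

/-- A matrix bimodule problem `𝔄 = (R, 𝒦, ℳ, H)`. The index set `T = {1, …, t}` is partitioned by
`cls : T → 𝒯`. The algebra `𝒦 = 𝒦₀ ⊕ (Δ̄ ⊗ 𝒦₁)` and the bimodule `ℳ = Δ̄ ⊗ ℳ₁` are given by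
the quasi-bases `V` of `𝒦₁` and `A` of `ℳ₁`; since `𝒦`, `ℳ` carry the usual matrix product and are
generated in index `(0, 1)`, closure under this product is closure for
`𝒦₁ × 𝒦₁ → 𝒦₂`, `𝒦₁ × ℳ₁ → ℳ₂`, `ℳ₁ × 𝒦₁ → ℳ₂`. -/
structure MatrixBimoduleProblem (k : Type u) [Field k] where
  base : MinAlg k
  t : ℕ
  cls : Fin t → base.Vert
  cls_surj : Function.Surjective cls
  m : ℕ
  V : QBasis base cls m
  V_upper : ∀ j p q, q ≤ p → V.mat j p q = 0
  n : ℕ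
  A : QBasis base cls n
  A_scalar : ∀ l p q, ∃ c : k, A.mat l p q = c • base.e2 (A.src l) (A.tgt l)
  /-- the leading position `(p_l, q_l)` of `A_l` -/
  lead : Fin n → Fin t × Fin t
  lead_entry : ∀ l, A.mat l (lead l).1 (lead l).2 = base.e2 (A.src l) (A.tgt l)
  lead_first : ∀ l p q, A.mat l p q ≠ 0 → PosLE (lead l) (p, q)
  lead_other : ∀ l j, j ≠ l → A.mat j (lead l).1 (lead l).2 = 0
  lead_order : ∀ i j, i ≤ j ↔ PosLE (lead i) (lead j)
  VV : MulClosed V V V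
  VA : MulClosed V A A
  AV : MulClosed A V A
  H : Matrix (Fin t) (Fin t) base.R
  H_supp : ∀ p q, cls p ≠ cls q → H p q = 0
  H_comp : ∀ p q, base.e (cls p) * H p q = H p q
  /-- `d(V_j) = V_j H - H V_j ∈ ℳ₁` -/
  d_mem : ∀ j, V.mat j * H.map (Algebra.TensorProduct.includeRight : _ →ₐ[k] T2 k base.R) -
      H.map (Algebra.TensorProduct.includeLeft : _ →ₐ[k] T2 k base.R) * V.mat j ∈
    Submodule.span (T2 k base.R) (Set.range A.mat)

variable {k : Type u} [Field k] (𝔄 : MatrixBimoduleProblem k)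

namespace MatrixBimoduleProblem

/-- `R`, and its vertex set `𝒯`. -/
abbrev R := 𝔄.base.R
abbrev Vert := 𝔄.base.Vert

/-- `V_i V_j = ∑_l γ_{ijl} ⊗ V_l`. -/
noncomputable def γ (i j l : Fin 𝔄.m) : T3 k 𝔄.R := 𝔄.VV.coef i j l
/-- `V_i A_j = ∑_l η_{ijl} ⊗ A_l`. -/
noncomputable def η (i : Fin 𝔄.m) (j l : Fin 𝔄.n) : T3 k 𝔄.R := 𝔄.VA.coef i j l
/-- `A_i V_j = ∑_l σ_{ijl} ⊗ A_l`. -/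
noncomputable def σ (i : Fin 𝔄.n) (j : Fin 𝔄.m) (l : Fin 𝔄.n) : T3 k 𝔄.R := 𝔄.AV.coef i j l

/-- The derivation `d₁(V_j) = V_j H - H V_j`. -/
noncomputable def d (j : Fin 𝔄.m) : Matrix (Fin 𝔄.t) (Fin 𝔄.t) (T2 k 𝔄.R) :=
  𝔄.V.mat j * 𝔄.H.map (Algebra.TensorProduct.includeRight : _ →ₐ[k] T2 k 𝔄.R) -
      𝔄.H.map (Algebra.TensorProduct.includeLeft : _ →ₐ[k] T2 k 𝔄.R) * 𝔄.V.mat j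

lemma exists_zeta (j : Fin 𝔄.m) : ∃ c : Fin 𝔄.n → T2 k 𝔄.R, ∑ l, c l • 𝔄.A.mat l = 𝔄.d j :=
  (Submodule.mem_span_range_iff_exists_fun _).1 (𝔄.d_mem j)

/-- `d₁(V_i) = ∑_l ζ_{il} ⊗ A_l`, `ζ_{il} ∈ R_X ⊗ R_Y` for `A_l` from `X` to `Y`. -/
noncomputable def ζ (i : Fin 𝔄.m) (l : Fin 𝔄.n) : T2 k 𝔄.R :=
  𝔄.base.e2 (𝔄.A.src l) (𝔄.A.tgt l) * Classical.choose (𝔄.exists_zeta i) l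

lemma zeta_spec (i : Fin 𝔄.m) : 𝔄.d i = ∑ l, 𝔄.ζ i l • 𝔄.A.mat l := by
  rw [← Classical.choose_spec (𝔄.exists_zeta i)]
  refine Finset.sum_congr rfl fun l _ => ?_
  ext p q
  simp only [ζ, Matrix.smul_apply, smul_eq_mul]
  conv_lhs => rw [← 𝔄.A.comp]
  ring

lemma zeta_cut (i : Fin 𝔄.m) (l : Fin 𝔄.n) :
    𝔄.base.e2 (𝔄.A.src l) (𝔄.A.tgt l) * 𝔄.ζ i l = 𝔄.ζ i l := by
  rw [ζ, ← mul_assoc, MinAlg.e2_mul_self]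

/-- `d(V_i V_j) = d(V_i) V_j + V_i d(V_j)`, in terms of structure constants. -/
lemma zeta_leibniz (i j : Fin 𝔄.m) (l : Fin 𝔄.n) :
    ∑ a, 𝔄.γ i j a * i13 k 𝔄.R (𝔄.ζ a l) =
      ∑ a, i12 k 𝔄.R (𝔄.ζ i a) * 𝔄.σ a j l + ∑ b, i23 k 𝔄.R (𝔄.ζ j b) * 𝔄.η i b l := by
  let G := fun l => (𝔄.A.mat l).map (i13 k 𝔄.R).toRingHom
  let h1 : 𝔄.R →ₐ[k] T3 k 𝔄.R := (i12 k 𝔄.R).comp Algebra.TensorProduct.includeLeft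
  let h2 : 𝔄.R →ₐ[k] T3 k 𝔄.R := (i12 k 𝔄.R).comp Algebra.TensorProduct.includeRight
  let h3 : 𝔄.R →ₐ[k] T3 k 𝔄.R := (i23 k 𝔄.R).comp Algebra.TensorProduct.includeRight
  have d12 : (𝔄.d i).map (i12 k 𝔄.R).toRingHom =
      (𝔄.V.mat i).map (i12 k 𝔄.R) * 𝔄.H.map h2 - 𝔄.H.map h1 * (𝔄.V.mat i).map (i12 k 𝔄.R) := by
    rw [d, Matrix.map_sub _ (map_sub _), Matrix.map_mul, Matrix.map_mul, Matrix.map_map,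
      Matrix.map_map]
    rfl
  have d23 : (𝔄.d j).map (i23 k 𝔄.R).toRingHom =
      (𝔄.V.mat j).map (i23 k 𝔄.R) * 𝔄.H.map h3 - 𝔄.H.map h2 * (𝔄.V.mat j).map (i23 k 𝔄.R) := by
    rw [d, Matrix.map_sub _ (map_sub _), Matrix.map_mul, Matrix.map_mul, Matrix.map_map,
      Matrix.map_map]
    congr 2
  have d13 : ∀ a, (𝔄.d a).map (i13 k 𝔄.R).toRingHom =
      (𝔄.V.mat a).map (i13 k 𝔄.R) * 𝔄.H.map h3 - 𝔄.H.map h1 * (𝔄.V.mat a).map (i13 k 𝔄.R) := by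
    intro a
    rw [d, Matrix.map_sub _ (map_sub _), Matrix.map_mul, Matrix.map_mul, Matrix.map_map,
      Matrix.map_map]
    congr 2
  have hL : prod2 (𝔄.V.mat i) (𝔄.V.mat j) * 𝔄.H.map h3 -
      𝔄.H.map h1 * prod2 (𝔄.V.mat i) (𝔄.V.mat j) =
      ∑ l, (∑ a, 𝔄.γ i j a * i13 k 𝔄.R (𝔄.ζ a l)) • G l := by
    rw [𝔄.VV.coef_spec, Finset.sum_mul, Finset.mul_sum, ← Finset.sum_sub_distrib]
    have : ∀ a, (𝔄.VV.coef i j a • (𝔄.V.mat a).map (i13 k 𝔄.R)) * 𝔄.H.map h3 -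
        𝔄.H.map h1 * (𝔄.VV.coef i j a • (𝔄.V.mat a).map (i13 k 𝔄.R)) =
        ∑ l, (𝔄.γ i j a * i13 k 𝔄.R (𝔄.ζ a l)) • G l := by
      intro a
      rw [Matrix.smul_mul, Matrix.mul_smul, ← smul_sub, ← d13, zeta_spec, map_sum_mat,
        Finset.smul_sum]
      refine Finset.sum_congr rfl fun l _ => ?_
      rw [map_smul_mat, smul_smul]
      rfl
    rw [Finset.sum_congr rfl fun a _ => this a, Finset.sum_comm]
    simp_rw [Finset.sum_smul]
  have hR1 : (𝔄.d i).map (i12 k 𝔄.R).toRingHom * (𝔄.V.mat j).map (i23 k 𝔄.R) =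
      ∑ l, (∑ a, i12 k 𝔄.R (𝔄.ζ i a) * 𝔄.σ a j l) • G l := by
    rw [zeta_spec, map_sum_mat, Finset.sum_mul]
    have : ∀ a, (𝔄.ζ i a • 𝔄.A.mat a).map (i12 k 𝔄.R).toRingHom * (𝔄.V.mat j).map (i23 k 𝔄.R) =
        ∑ l, (i12 k 𝔄.R (𝔄.ζ i a) * 𝔄.σ a j l) • G l := by
      intro a
      rw [map_smul_mat, Matrix.smul_mul]
      change _ • prod2 (𝔄.A.mat a) (𝔄.V.mat j) = _
      rw [𝔄.AV.coef_spec, Finset.smul_sum]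
      refine Finset.sum_congr rfl fun l _ => ?_
      rw [smul_smul]
      rfl
    rw [Finset.sum_congr rfl fun a _ => this a, Finset.sum_comm]
    simp_rw [Finset.sum_smul]
  have hR2 : (𝔄.V.mat i).map (i12 k 𝔄.R) * (𝔄.d j).map (i23 k 𝔄.R).toRingHom =
      ∑ l, (∑ b, i23 k 𝔄.R (𝔄.ζ j b) * 𝔄.η i b l) • G l := by
    rw [zeta_spec, map_sum_mat, Finset.mul_sum]
    have : ∀ b, (𝔄.V.mat i).map (i12 k 𝔄.R) * (𝔄.ζ j b • 𝔄.A.mat b).map (i23 k 𝔄.R).toRingHom =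
        ∑ l, (i23 k 𝔄.R (𝔄.ζ j b) * 𝔄.η i b l) • G l := by
      intro a
      rw [map_smul_mat, Matrix.mul_smul]
      change _ • prod2 (𝔄.V.mat i) (𝔄.A.mat a) = _
      rw [𝔄.VA.coef_spec, Finset.smul_sum]
      refine Finset.sum_congr rfl fun l _ => ?_
      rw [smul_smul]
      rfl
    rw [Finset.sum_congr rfl fun a _ => this a, Finset.sum_comm]
    simp_rw [Finset.sum_smul]
  have key : ∑ l, (∑ a, 𝔄.γ i j a * i13 k 𝔄.R (𝔄.ζ a l) -
      (∑ a, i12 k 𝔄.R (𝔄.ζ i a) * 𝔄.σ a j l + ∑ b, i23 k 𝔄.R (𝔄.ζ j b) * 𝔄.η i b l)) • G l = 0 := by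
    simp_rw [sub_smul, add_smul]
    rw [Finset.sum_sub_distrib, Finset.sum_add_distrib, ← hL, ← hR1, ← hR2, d12, d23, prod2]
    noncomm_ring
  have h0 := 𝔄.A.free_map (i13 k 𝔄.R).toRingHom T3.sep _ key l
  have c1 : ∀ a, i13 k 𝔄.R (𝔄.base.e2 (𝔄.A.src l) (𝔄.A.tgt l)) *
      (𝔄.γ i j a * i13 k 𝔄.R (𝔄.ζ a l)) = 𝔄.γ i j a * i13 k 𝔄.R (𝔄.ζ a l) := by
    intro a; rw [mul_left_comm, ← map_mul, zeta_cut]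
  have c2 : ∀ a, i13 k 𝔄.R (𝔄.base.e2 (𝔄.A.src l) (𝔄.A.tgt l)) *
      (i12 k 𝔄.R (𝔄.ζ i a) * 𝔄.σ a j l) = i12 k 𝔄.R (𝔄.ζ i a) * 𝔄.σ a j l := by
    intro a; rw [mul_left_comm, σ, 𝔄.AV.coef_cut]
  have c3 : ∀ a, i13 k 𝔄.R (𝔄.base.e2 (𝔄.A.src l) (𝔄.A.tgt l)) *
      (i23 k 𝔄.R (𝔄.ζ j a) * 𝔄.η i a l) = i23 k 𝔄.R (𝔄.ζ j a) * 𝔄.η i a l := by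
    intro a; rw [mul_left_comm, η, 𝔄.VA.coef_cut]
  rw [mul_sub, sub_eq_zero, mul_add, Finset.mul_sum, Finset.mul_sum, Finset.mul_sum] at h0
  rw [← Finset.sum_congr rfl fun a _ => c1 a, ← Finset.sum_congr rfl fun a _ => c2 a,
    ← Finset.sum_congr rfl fun a _ => c3 a]
  exact h0

end MatrixBimoduleProblem

end Problem

section Composition

variable {k : Type u} [Field k] (𝔄 : MatrixBimoduleProblem k)

variable {M₁ M₂ M₃ M₁₂ M₂₃ M : Type*}
  [AddCommGroup M₁] [Module k M₁] [AddCommGroup M₂] [Module k M₂]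
  [AddCommGroup M₃] [Module k M₃] [AddCommGroup M₁₂] [Module k M₁₂]
  [AddCommGroup M₂₃] [Module k M₂₃] [AddCommGroup M] [Module k M]

/-- The element commutes with `R`. -/
def Central {R : Type*} [CommRing R] [Algebra k R] (a : BiAct k R M) (x : M) : Prop :=
  ∀ r : R, a (r ⊗ₜ 1) x = a (1 ⊗ₜ r) x

section

variable {R : Type*} [CommRing R] [Algebra k R]
  {a₁ : BiAct k R M₁} {a₂ : BiAct k R M₂} {a₃ : BiAct k R M₃}
  {a₁₂ : BiAct k R M₁₂} {a₂₃ : BiAct k R M₂₃} {a : BiAct k R M}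
  {β₁₂ : M₁ →ₗ[k] M₂ →ₗ[k] M₁₂} {βl : M₁₂ →ₗ[k] M₃ →ₗ[k] M}
  {β₂₃ : M₂ →ₗ[k] M₃ →ₗ[k] M₂₃} {βr : M₁ →ₗ[k] M₂₃ →ₗ[k] M}

lemma ev3_central_left (h₁₂ : IsPairing a₁ a₂ a₁₂ β₁₂)
    (hass : ∀ x y z, βl (β₁₂ x y) z = βr x (β₂₃ y z)) {x : M₁} (hx : Central a₁ x)
    (y : M₂) (z : M₃) (c : T3 k R) (h₂₃ : IsPairing a₂ a₃ a₂₃ β₂₃) (hr : IsPairing a₁ a₂₃ a βr) :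
    ev3 a₁₂ a₃ βl (β₁₂ x y) z c = βr x (ev3 a₂ a₃ β₂₃ y z c) := by
  induction c using T3.ind with
  | h0 => simp
  | ha _ _ h1 h2 => simp only [map_add, h1, h2]
  | h p q r =>
    simp only [ev3_tmul, h₁₂.outer, hx p, hass]
    rw [hr.inner, h₂₃.outer]
    simp [BiAct.mul]

lemma ev3_central_mid (h₁₂ : IsPairing a₁ a₂ a₁₂ β₁₂)
    (hass : ∀ x y z, βl (β₁₂ x y) z = βr x (β₂₃ y z)) (x : M₁) {y : M₂} (hy : Central a₂ y)
    (z : M₃) (c : T3 k R) (h₂₃ : IsPairing a₂ a₃ a₂₃ β₂₃) :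
    ev3 a₁₂ a₃ βl (β₁₂ x y) z c = ev3 a₁ a₂₃ βr x (β₂₃ y z) c := by
  induction c using T3.ind with
  | h0 => simp
  | ha _ _ h1 h2 => simp only [map_add, h1, h2]
  | h p q r =>
    simp only [ev3_tmul, h₁₂.outer, h₂₃.outer]
    have h11 : a₂ (1 ⊗ₜ 1) y = y := by rw [← Algebra.TensorProduct.one_def, map_one]; rfl
    rw [show a₁ (p ⊗ₜ q) x = a₁ (1 ⊗ₜ q) (a₁ (p ⊗ₜ 1) x) by simp [BiAct.mul], ← hass, h₁₂.inner, h11, hy q]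

lemma ev3_central_right (hass : ∀ x y z, βl (β₁₂ x y) z = βr x (β₂₃ y z)) (x : M₁) (y : M₂) {z : M₃}
    (hz : Central a₃ z) (c : T3 k R) (h₂₃ : IsPairing a₂ a₃ a₂₃ β₂₃) :
    βl (ev3 a₁ a₂ β₁₂ x y c) z = ev3 a₁ a₂₃ βr x (β₂₃ y z) c := by
  induction c using T3.ind with
  | h0 => simp
  | ha _ _ h1 h2 => simp only [map_add, LinearMap.add_apply, h1, h2]
  | h p q r =>
    simp only [ev3_tmul, h₂₃.outer, hass]
    rw [← hz r, ← h₂₃.inner]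
    simp [← Algebra.TensorProduct.one_def]

end

/-- The `v_l`-component of a composite:
`f₀ g(v_l) + f(v_l) g₀ + ∑_{i,j} γ_{ijl} ⊗_{R^{⊗3}} (f(v_i) ⊗_R g(v_j))`. -/
noncomputable def compv (a₁ : BiAct k 𝔄.R M₁) (a₂ : BiAct k 𝔄.R M₂) (β : M₁ →ₗ[k] M₂ →ₗ[k] M)
    (f0 : M₁) (f : Fin 𝔄.m → M₁) (g0 : M₂) (g : Fin 𝔄.m → M₂) (l : Fin 𝔄.m) : M :=
  β f0 (g l) + β (f l) g0 + ∑ i, ∑ j, ev3 a₁ a₂ β (f i) (g j) (𝔄.γ i j l)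

lemma ev3_zero_left {R : Type*} [CommRing R] [Algebra k R] (a₁ : BiAct k R M₁)
    (a₂ : BiAct k R M₂) (β : M₁ →ₗ[k] M₂ →ₗ[k] M) (y : M₂) (c : T3 k R) :
    ev3 a₁ a₂ β 0 y c = 0 := by
  rw [← ev3ₗ_apply, map_zero, LinearMap.zero_apply]

lemma ev3_zero_right {R : Type*} [CommRing R] [Algebra k R] (a₁ : BiAct k R M₁)
    (a₂ : BiAct k R M₂) (β : M₁ →ₗ[k] M₂ →ₗ[k] M) (x : M₁) (c : T3 k R) :
    ev3 a₁ a₂ β x 0 c = 0 := by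
  rw [← ev3ₗ_apply, map_zero]

section Bilinear

variable (a₁ : BiAct k 𝔄.R M₁) (a₂ : BiAct k 𝔄.R M₂) (β : M₁ →ₗ[k] M₂ →ₗ[k] M)
  (f0 f0' : M₁) (f f' : Fin 𝔄.m → M₁) (g0 g0' : M₂) (g g' : Fin 𝔄.m → M₂) (c : k) (l : Fin 𝔄.m)

lemma compv_add_left : compv 𝔄 a₁ a₂ β (f0 + f0') (f + f') g0 g l =
    compv 𝔄 a₁ a₂ β f0 f g0 g l + compv 𝔄 a₁ a₂ β f0' f' g0 g l := by
  simp only [compv, Pi.add_apply, map_add, LinearMap.add_apply, ev3_add_left,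
    Finset.sum_add_distrib]
  abel

lemma compv_add_right : compv 𝔄 a₁ a₂ β f0 f (g0 + g0') (g + g') l =
    compv 𝔄 a₁ a₂ β f0 f g0 g l + compv 𝔄 a₁ a₂ β f0 f g0' g' l := by
  simp only [compv, Pi.add_apply, map_add, ev3_add_right, Finset.sum_add_distrib]
  abel

lemma compv_smul_left : compv 𝔄 a₁ a₂ β (c • f0) (c • f) g0 g l =
    c • compv 𝔄 a₁ a₂ β f0 f g0 g l := by
  simp only [compv, Pi.smul_apply, map_smul, LinearMap.smul_apply, ev3_smul_left, smul_add,
    Finset.smul_sum]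

lemma compv_smul_right : compv 𝔄 a₁ a₂ β f0 f (c • g0) (c • g) l =
    c • compv 𝔄 a₁ a₂ β f0 f g0 g l := by
  simp only [compv, Pi.smul_apply, map_smul, ev3_smul_right, smul_add, Finset.smul_sum]

end Bilinear

variable {a₁ : BiAct k 𝔄.R M₁} {a₂ : BiAct k 𝔄.R M₂} {a₃ : BiAct k 𝔄.R M₃}
  {a₁₂ : BiAct k 𝔄.R M₁₂} {a₂₃ : BiAct k 𝔄.R M₂₃} {a : BiAct k 𝔄.R M}
  {β₁₂ : M₁ →ₗ[k] M₂ →ₗ[k] M₁₂} {βl : M₁₂ →ₗ[k] M₃ →ₗ[k] M}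
  {β₂₃ : M₂ →ₗ[k] M₃ →ₗ[k] M₂₃} {βr : M₁ →ₗ[k] M₂₃ →ₗ[k] M}

/-- Nested evaluations of structure constants agree when the constants do. -/
lemma ev3_assoc {R : Type*} [CommRing R] [Algebra k R]
    {a₁ : BiAct k R M₁} {a₂ : BiAct k R M₂} {a₃ : BiAct k R M₃}
    {a₁₂ : BiAct k R M₁₂} {a₂₃ : BiAct k R M₂₃} {a : BiAct k R M}
    (h₁₂ : IsPairing a₁ a₂ a₁₂ β₁₂) (h₂₃ : IsPairing a₂ a₃ a₂₃ β₂₃)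
    (hr : IsPairing a₁ a₂₃ a βr)
    (hass : ∀ x y z, βl (β₁₂ x y) z = βr x (β₂₃ y z))
    {ι ι' : Type*} [Fintype ι] [Fintype ι'] (c d : ι → T3 k R) (c' d' : ι' → T3 k R)
    (hc : ∑ i, i123 k R (c i) * i134 k R (d i) = ∑ i, i234 k R (c' i) * i124 k R (d' i))
    (x : M₁) (y : M₂) (z : M₃) :
    ∑ i, ev3 a₁₂ a₃ βl (ev3 a₁ a₂ β₁₂ x y (c i)) z (d i) =
      ∑ i, ev3 a₁ a₂₃ βr x (ev3 a₂ a₃ β₂₃ y z (c' i)) (d' i) := by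
  let τ : M₁ →ₗ[k] M₂ →ₗ[k] M₃ →ₗ[k] M := β₁₂.compr₂ βl
  have e1 : ∀ i, ev3 a₁₂ a₃ βl (ev3 a₁ a₂ β₁₂ x y (c i)) z (d i) =
      ev4 a₁ a₂ a₃ τ x y z (i123 k R (c i) * i134 k R (d i)) :=
    fun i => ev3_nest_left h₁₂ (fun _ _ _ => rfl) x y z _ _
  have e2 : ∀ i, ev3 a₁ a₂₃ βr x (ev3 a₂ a₃ β₂₃ y z (c' i)) (d' i) =
      ev4 a₁ a₂ a₃ τ x y z (i234 k R (c' i) * i124 k R (d' i)) :=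
    fun i => ev3_nest_right h₂₃ hr (fun x y z => hass x y z) x y z _ _
  simp_rw [e1, e2, ← map_sum, hc]

lemma ev3_sum_left {R ι : Type*} [CommRing R] [Algebra k R] (a₁ : BiAct k R M₁)
    (a₂ : BiAct k R M₂) (β : M₁ →ₗ[k] M₂ →ₗ[k] M) (s : Finset ι)
    (x : ι → M₁) (y : M₂) (c : T3 k R) :
    ev3 a₁ a₂ β (∑ i ∈ s, x i) y c = ∑ i ∈ s, ev3 a₁ a₂ β (x i) y c := by
  simp_rw [← ev3ₗ_apply]; simp

lemma ev3_sum_right {R ι : Type*} [CommRing R] [Algebra k R] (a₁ : BiAct k R M₁)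
    (a₂ : BiAct k R M₂) (β : M₁ →ₗ[k] M₂ →ₗ[k] M) (s : Finset ι)
    (x : M₁) (y : ι → M₂) (c : T3 k R) :
    ev3 a₁ a₂ β x (∑ i ∈ s, y i) c = ∑ i ∈ s, ev3 a₁ a₂ β x (y i) c := by
  simp_rw [← ev3ₗ_apply]; simp

lemma sum4_comm {α β γ δ N : Type*} [Fintype α] [Fintype β] [Fintype γ] [Fintype δ]
    [AddCommMonoid N] (F : α → β → γ → δ → N) :
    ∑ i, ∑ j, ∑ p, ∑ q, F i j p q = ∑ p, ∑ q, ∑ j, ∑ i, F i j p q := by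
  have e1 : ∀ i, ∑ j, ∑ p, ∑ q, F i j p q = ∑ p, ∑ q, ∑ j, F i j p q := fun i => by
    rw [Finset.sum_comm]
    exact Finset.sum_congr rfl fun p _ => Finset.sum_comm
  have e2 : ∀ p, ∑ i, ∑ q, ∑ j, F i j p q = ∑ q, ∑ j, ∑ i, F i j p q := fun p => by
    rw [Finset.sum_comm]
    exact Finset.sum_congr rfl fun q _ => Finset.sum_comm
  rw [Finset.sum_congr rfl fun i _ => e1 i, Finset.sum_comm, Finset.sum_congr rfl fun p _ => e2 p]

lemma sum4_comm' {α β γ δ N : Type*} [Fintype α] [Fintype β] [Fintype γ] [Fintype δ]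
    [AddCommMonoid N] (F : α → β → γ → δ → N) :
    ∑ i, ∑ j, ∑ p, ∑ q, F i j p q = ∑ i, ∑ p, ∑ q, ∑ j, F i j p q := by
  refine Finset.sum_congr rfl fun i _ => ?_
  rw [Finset.sum_comm]
  exact Finset.sum_congr rfl fun p _ => Finset.sum_comm

lemma compv_assoc (h₁₂ : IsPairing a₁ a₂ a₁₂ β₁₂) (h₂₃ : IsPairing a₂ a₃ a₂₃ β₂₃)
    (hr : IsPairing a₁ a₂₃ a βr)
    (hass : ∀ x y z, βl (β₁₂ x y) z = βr x (β₂₃ y z))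
    {f0 : M₁} (hf : Central a₁ f0) {g0 : M₂} (hg : Central a₂ g0) {h0 : M₃} (hh : Central a₃ h0)
    (f : Fin 𝔄.m → M₁) (g : Fin 𝔄.m → M₂) (h : Fin 𝔄.m → M₃) (l : Fin 𝔄.m) :
    compv 𝔄 a₁₂ a₃ βl (β₁₂ f0 g0) (compv 𝔄 a₁ a₂ β₁₂ f0 f g0 g) h0 h l =
      compv 𝔄 a₁ a₂₃ βr f0 f (β₂₃ g0 h0) (compv 𝔄 a₂ a₃ β₂₃ g0 g h0 h) l := by
  have hγ : ∑ i, ∑ j, ∑ p, ∑ q, ev3 a₁₂ a₃ βl (ev3 a₁ a₂ β₁₂ (f p) (g q) (𝔄.γ p q i)) (h j)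
      (𝔄.γ i j l) = ∑ i, ∑ j, ∑ p, ∑ q, ev3 a₁ a₂₃ βr (f i)
        (ev3 a₂ a₃ β₂₃ (g p) (h q) (𝔄.γ p q j)) (𝔄.γ i j l) := by
    have e : ∀ p q j, ∑ i, ev3 a₁₂ a₃ βl (ev3 a₁ a₂ β₁₂ (f p) (g q) (𝔄.γ p q i)) (h j)
        (𝔄.γ i j l) = ∑ i, ev3 a₁ a₂₃ βr (f p)
        (ev3 a₂ a₃ β₂₃ (g q) (h j) (𝔄.γ q j i)) (𝔄.γ p i l) := by
      intro p q j
      exact ev3_assoc h₁₂ h₂₃ hr hass _ _ _ _ (coef_assoc 𝔄.VV 𝔄.VV 𝔄.VV 𝔄.VV p q j l) _ _ _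
    rw [sum4_comm]
    refine Eq.trans ?_ (sum4_comm' _).symm
    simp_rw [e]
  unfold compv
  simp only [map_add, map_sum, LinearMap.add_apply, LinearMap.sum_apply, ev3_add_left,
    ev3_add_right, ev3_sum_left, ev3_sum_right, Finset.sum_add_distrib, hass]
  rw [hγ]
  simp_rw [ev3_central_left h₁₂ hass hf _ _ _ h₂₃ hr, ev3_central_mid h₁₂ hass _ hg _ _ h₂₃,
    ev3_central_right hass _ _ hh _ h₂₃]
  abel

end Composition

set_option linter.unusedSectionVars false

section Weyr

variable {k : Type u} [Field k]

/-- A Weyr matrix: a direct sum, over distinct eigenvalues `lam i`, of upper block bidiagonal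
matrices with diagonal blocks `lam i • I` of non-increasing sizes `b i 0 ≥ b i 1 ≥ …` and
superdiagonal blocks `(I 0)ᵀ`. Rows and columns are ordered by eigenvalue, block, place in the
block. -/
def IsWeyr {d : ℕ} (W : Matrix (Fin d) (Fin d) k) : Prop :=
  ∃ (s : ℕ) (lam : Fin s → k) (c : Fin s → ℕ) (b : (i : Fin s) → Fin (c i) → ℕ)
    (e : (Σₗ (i : Fin s), Σₗ (j : Fin (c i)), Fin (b i j)) ≃o Fin d),
    Function.Injective lam ∧ (∀ i, Antitone (b i)) ∧
    ∀ (i i' : Fin s) (j : Fin (c i)) (j' : Fin (c i')) (a : Fin (b i j)) (a' : Fin (b i' j')),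
      W (e (toLex ⟨i, toLex ⟨j, a⟩⟩)) (e (toLex ⟨i', toLex ⟨j', a'⟩⟩)) =
        if i = i' ∧ (j : ℕ) = j' ∧ (a : ℕ) = a' then lam i
        else if i = i' ∧ (j : ℕ) + 1 = j' ∧ (a : ℕ) = a' then 1 else 0

/-- `R_X`-regular Weyr matrices: the identity at a trivial vertex; at a non-trivial vertex, a Weyr
matrix none of whose eigenvalues is a root of `φ_X`. -/
def IsRegularWeyr (o : Option {p : k[X] // p ≠ 0}) {d : ℕ} (W : Matrix (Fin d) (Fin d) k) : Prop :=
  match o with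
  | none => W = 1
  | some p => IsWeyr W ∧ ∀ c ∈ spectrum k W, p.1.eval c ≠ 0

lemma IsRegularWeyr.isUnit [IsAlgClosed k] {p : {p : k[X] // p ≠ 0}} {d : ℕ}
    {W : Matrix (Fin d) (Fin d) k} (h : IsRegularWeyr (some p) W) :
    IsUnit (Polynomial.aeval W p.1) := by
  rcases Nat.eq_zero_or_pos d with rfl | hd
  · exact isUnit_of_subsingleton _
  · have : Nonempty (Fin d) := ⟨⟨0, hd⟩⟩
    by_contra hu
    have h0 : (0 : k) ∈ spectrum k (Polynomial.aeval W p.1) := spectrum.zero_mem_iff k |>.2 hu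
    rw [spectrum.map_polynomial_aeval_of_nonempty W p.1
      (spectrum.nonempty_of_isAlgClosed_of_finiteDimensional k W)] at h0
    obtain ⟨c, hc, hc0⟩ := h0
    exact h.2 c hc hc0

/-- `h ↦ h(W)` for `h ∈ R_X`. -/
noncomputable def evalLoc [IsAlgClosed k] : (o : Option {p : k[X] // p ≠ 0}) → {d : ℕ} →
    (W : Matrix (Fin d) (Fin d) k) → IsRegularWeyr o W → LocAlg k o →ₐ[k] Matrix (Fin d) (Fin d) k
  | none, _, _, _ => Algebra.ofId k _
  | some p, d, W, h =>
    { OreLocalization.universalHom (S := Submonoid.powers p.1)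
        (Polynomial.aeval (R := k) W : k[X] →+* Matrix (Fin d) (Fin d) k)
        (IsUnit.liftRight
          ((Polynomial.aeval (R := k) W : k[X] →* Matrix (Fin d) (Fin d) k).comp
            (Submonoid.powers p.1).subtype)
          (fun s => by
            obtain ⟨n, hn⟩ := s.2
            simpa [← hn] using h.isUnit.pow n))
        (fun s => rfl) with
      commutes' := fun c => by
        change OreLocalization.universalHom _ _ _ (algebraMap k (Localization.Away p.1) c) = _
        rw [IsScalarTower.algebraMap_apply k k[X] (Localization.Away p.1)]
        refine (OreLocalization.universalHom_commutes _ _ _).trans ?_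
        simp }

end Weyr

section RepA

variable {k : Type u} [Field k]

section MatBim

variable {R : Type*} [CommRing R] [Algebra k R] {I J L O : Type*} [Fintype I] [DecidableEq I]
  [Fintype J] [DecidableEq J] [Fintype L] [DecidableEq L] [Fintype O] [DecidableEq O]

/-- Left and right multiplication on matrices through `ρ`. -/
noncomputable def matL (ρ : R →ₐ[k] Matrix I I k) : R →ₐ[k] Module.End k (Matrix I J k) :=
  AlgHom.ofLinearMap
    (LinearMap.mk₂ k (fun r (C : Matrix I J k) => ρ r * C)
      (by intros; simp [Matrix.add_mul]) (by intros; simp)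
      (by intros; simp [Matrix.mul_add]) (by intros; simp))
    (by ext : 1; simp) (by intro r s; ext : 1; simp [Matrix.mul_assoc])
noncomputable def matR (ρ' : R →ₐ[k] Matrix J J k) : R →ₐ[k] Module.End k (Matrix I J k) :=
  AlgHom.ofLinearMap
    (LinearMap.mk₂ k (fun r (C : Matrix I J k) => C * ρ' r)
      (by intros; simp [Matrix.mul_add]) (by intros; simp)
      (by intros; simp [Matrix.add_mul]) (by intros; simp))
    (by ext : 1; simp)
    (by intro r s; ext : 1; simp [Matrix.mul_assoc, ← map_mul, mul_comm])

lemma matL_matR (ρ : R →ₐ[k] Matrix I I k) (ρ' : R →ₐ[k] Matrix J J k) (r s : R) :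
    Commute (matL (J := J) ρ r) (matR ρ' s) := by
  ext C : 1
  simp [matL, matR, Matrix.mul_assoc]

/-- The bimodule structure `r C s = ρ(r) C ρ'(s)` on matrices. -/
noncomputable def matBim (ρ : R →ₐ[k] Matrix I I k) (ρ' : R →ₐ[k] Matrix J J k) :
    BiAct k R (Matrix I J k) :=
  Algebra.TensorProduct.lift (matL ρ) (matR ρ') (matL_matR ρ ρ')

@[simp] lemma matBim_tmul (ρ : R →ₐ[k] Matrix I I k) (ρ' : R →ₐ[k] Matrix J J k) (r s : R)
    (C : Matrix I J k) : matBim ρ ρ' (r ⊗ₜ s) C = ρ r * C * ρ' s := by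
  rw [matBim, Algebra.TensorProduct.lift_tmul, Matrix.mul_assoc]
  rfl

/-- Matrix multiplication as a bilinear map. -/
def matMul : Matrix I J k →ₗ[k] Matrix J L k →ₗ[k] Matrix I L k :=
  LinearMap.mk₂ k (fun C D => C * D) (by intros; simp [Matrix.add_mul]) (by intros; simp)
    (by intros; simp [Matrix.mul_add]) (by intros; simp)

@[simp] lemma matMul_apply (C : Matrix I J k) (D : Matrix J L k) : matMul C D = C * D := rfl

lemma matMul_pairing (ρ : R →ₐ[k] Matrix I I k) (ρ' : R →ₐ[k] Matrix J J k)
    (ρ'' : R →ₐ[k] Matrix L L k) :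
    IsPairing (matBim ρ ρ') (matBim ρ' ρ'') (matBim ρ ρ'') matMul where
  outer := by intros; simp [Matrix.mul_assoc]
  inner := by intros; simp [Matrix.mul_assoc]

end MatBim

variable [IsAlgClosed k] (𝔄 : MatrixBimoduleProblem k)

/-- A representation of `𝔄`: dimensions `m_X` (equivalently a size vector, `m_i = m_X` for
`i ∈ X`), `R_X`-regular Weyr matrices `W_X`, and matrices `P(a_l)` of size `m_X × m_Y` for
`A_l` from `X` to `Y`. An `m_X × m_Y` matrix is regarded as the `(X, Y)`-block of a matrix with
rows and columns indexed by `⊔_X {1, …, m_X}`. -/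
structure RepA where
  dim : 𝔄.Vert → ℕ
  W : ∀ X, Matrix (Fin (dim X)) (Fin (dim X)) k
  W_reg : ∀ X, IsRegularWeyr (𝔄.base.loc X) (W X)
  a : Fin 𝔄.n → Matrix (Σ X, Fin (dim X)) (Σ X, Fin (dim X)) k
  a_supp : ∀ l x y, a l x y ≠ 0 → x.1 = 𝔄.A.src l ∧ y.1 = 𝔄.A.tgt l

namespace RepA

variable {𝔄}

/-- Indices of the block matrices `⊕_X k^{m_X}`, and of the `m × m`-partitioned matrices. -/
abbrev I (P : RepA 𝔄) := Σ X, Fin (P.dim X)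
abbrev J (P : RepA 𝔄) := Σ i : Fin 𝔄.t, Fin (P.dim (𝔄.cls i))

/-- The index of `⊕_X k^{m_X}` belonging to an index of the partitioned matrices. -/
def J.toI {P : RepA 𝔄} (x : P.J) : P.I := ⟨𝔄.cls x.1, x.2⟩

/-- `r ↦ diag(r_X(W_X))`. -/
noncomputable def rhoFun (P : RepA 𝔄) (r : 𝔄.R) : Matrix P.I P.I k :=
  Matrix.blockDiagonal' fun X => evalLoc (𝔄.base.loc X) (P.W X) (P.W_reg X) (r X)

/-- The action of `R` on `⊕_X k^{m_X}`. -/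
noncomputable def rho (P : RepA 𝔄) : 𝔄.R →ₐ[k] Matrix P.I P.I k :=
  AlgHom.ofLinearMap
    { toFun := P.rhoFun
      map_add' := fun r s => by
        unfold rhoFun
        rw [← Matrix.blockDiagonal'_add]; congr 1; funext X; exact map_add _ _ _
      map_smul' := fun c r => by
        unfold rhoFun
        rw [RingHom.id_apply, ← Matrix.blockDiagonal'_smul]
        congr 1; funext X; exact map_smul _ _ _ }
    (by
      change P.rhoFun 1 = 1
      unfold rhoFun
      rw [← Matrix.blockDiagonal'_one]
      congr 1; funext X; exact map_one _)
    (fun r s => by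
      change P.rhoFun (r * s) = P.rhoFun r * P.rhoFun s
      unfold rhoFun
      rw [← Matrix.blockDiagonal'_mul]
      congr 1; funext X; exact map_mul _ _ _)

/-- The `R`-`R`-bimodule structure `C ⊗ (x ⊗ y) = W_X C W'_Y`. -/
noncomputable abbrev bim (P Q : RepA 𝔄) : BiAct k 𝔄.R (Matrix P.I Q.I k) := matBim P.rho Q.rho

/-- The star product `C ∗ U`: the partitioned matrix with `(i, j)`-block `C ⊗ u_{ij}`. -/
noncomputable def star (P Q : RepA 𝔄) (C : Matrix P.I Q.I k)
    (U : Matrix (Fin 𝔄.t) (Fin 𝔄.t) (T2 k 𝔄.R)) : Matrix P.J Q.J k :=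
  Matrix.of fun x y => bim P Q (U x.1 y.1) C x.toI y.toI

/-- `∑_X F_X ∗ E_X`: the diagonal partitioned matrix with `(i, i)`-block `F_X`, `i ∈ X`. -/
def starE (P Q : RepA 𝔄) (F : Matrix P.I Q.I k) : Matrix P.J Q.J k :=
  Matrix.of fun x y => if x.1 = y.1 then F x.toI y.toI else 0

/-- `∑_X H_X(W_X)`: the partitioned matrix with `(i, j)`-block `h_{ij}(W_X)`, `i, j ∈ X`. -/
noncomputable def starH (P : RepA 𝔄) : Matrix P.J P.J k :=
  Matrix.of fun x y => P.rho (𝔄.H x.1 y.1) x.toI y.toI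

/-- The partitioned matrix `P̄ = ∑_X H_X(W_X) + ∑_l P(a_l) ∗ A_l`. -/
noncomputable def bar (P : RepA 𝔄) : Matrix P.J P.J k :=
  P.starH + ∑ l, star P P (P.a l) (𝔄.A.mat l)

/-- The partitioned matrix `f̄ = ∑_X f_X ∗ E_X + ∑_j f(v_j) ∗ V_j`. -/
noncomputable def barHom (P Q : RepA 𝔄)
    (f : Matrix P.I Q.I k × (Fin 𝔄.m → Matrix P.I Q.I k)) : Matrix P.J Q.J k :=
  starE P Q f.1 + ∑ j, star P Q (f.2 j) (𝔄.V.mat j)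

lemma star_add (P Q : RepA 𝔄) (C D : Matrix P.I Q.I k) (U : Matrix (Fin 𝔄.t) (Fin 𝔄.t) _) :
    star P Q (C + D) U = star P Q C U + star P Q D U := by
  ext; simp [star]

lemma star_smul (P Q : RepA 𝔄) (c : k) (C : Matrix P.I Q.I k)
    (U : Matrix (Fin 𝔄.t) (Fin 𝔄.t) _) : star P Q (c • C) U = c • star P Q C U := by
  ext; simp [star]

lemma star_sum (P Q : RepA 𝔄) {ι : Type*} (s : Finset ι) (C : ι → Matrix P.I Q.I k)
    (U : Matrix (Fin 𝔄.t) (Fin 𝔄.t) _) :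
    star P Q (∑ i ∈ s, C i) U = ∑ i ∈ s, star P Q (C i) U := by
  ext; simp [star, Matrix.sum_apply]

lemma starE_add (P Q : RepA 𝔄) (C D : Matrix P.I Q.I k) :
    starE P Q (C + D) = starE P Q C + starE P Q D := by
  ext x y; by_cases h : x.1 = y.1 <;> simp [starE, h]

lemma starE_smul (P Q : RepA 𝔄) (c : k) (C : Matrix P.I Q.I k) :
    starE P Q (c • C) = c • starE P Q C := by
  ext; simp [starE]

lemma barHom_add (P Q : RepA 𝔄) (f g) : barHom P Q (f + g) = barHom P Q f + barHom P Q g := by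
  simp only [barHom, Prod.fst_add, Prod.snd_add, Pi.add_apply, star_add, starE_add,
    Finset.sum_add_distrib]
  abel

lemma barHom_smul (P Q : RepA 𝔄) (c : k) (f) : barHom P Q (c • f) = c • barHom P Q f := by
  simp only [barHom, Prod.smul_fst, Prod.smul_snd, Pi.smul_apply, star_smul, starE_smul,
    smul_add, Finset.smul_sum]

/-- Morphisms `P → Q` of `R(𝔄)`: families `f = (f_X; f(v_j))`, where `f₀ = diag(f_X)` is
`R`-linear and `f(v_j)` is an `m_X × n_Y`-matrix for `V_j` from `X` to `Y`,
such that `P̄ f̄ = f̄ Q̄`. -/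
def homs (P Q : RepA 𝔄) :
    Submodule k (Matrix P.I Q.I k × (Fin 𝔄.m → Matrix P.I Q.I k)) where
  carrier := {f | (∀ r, P.rho r * f.1 = f.1 * Q.rho r) ∧
    (∀ j x y, f.2 j x y ≠ 0 → x.1 = 𝔄.V.src j ∧ y.1 = 𝔄.V.tgt j) ∧
    P.bar * barHom P Q f = barHom P Q f * Q.bar}
  add_mem' := by
    rintro f g ⟨h1, h2, h3⟩ ⟨h1', h2', h3'⟩
    refine ⟨fun r => ?_, fun j x y h => ?_, ?_⟩
    · simp [Matrix.mul_add, Matrix.add_mul, h1, h1']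
    · by_cases hf : f.2 j x y = 0
      · exact h2' j x y (by simpa [hf] using h)
      · exact h2 j x y hf
    · rw [barHom_add, Matrix.mul_add, Matrix.add_mul, h3, h3']
  zero_mem' := by
    refine ⟨fun r => by simp, fun j x y h => absurd rfl h, ?_⟩
    have : barHom P Q 0 = 0 := by simpa using barHom_smul P Q 0 0
    rw [this]; simp
  smul_mem' := by
    rintro c f ⟨h1, h2, h3⟩
    refine ⟨fun r => ?_, fun j x y h => h2 j x y ?_, ?_⟩
    · simp [h1]
    · intro h0; exact h (by simp [h0])
    · rw [barHom_smul, Matrix.mul_smul, Matrix.smul_mul, h3]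

end RepA

end RepA

section RepACat

variable {k : Type u} [Field k] [IsAlgClosed k] {𝔄 : MatrixBimoduleProblem k}

namespace RepA

lemma rho_e (P : RepA 𝔄) (X : 𝔄.Vert) :
    P.rho (𝔄.base.e X) = Matrix.diagonal fun x => if x.1 = X then 1 else 0 := by
  change P.rhoFun _ = _
  unfold rhoFun
  ext ⟨Y, a⟩ ⟨Z, b⟩
  by_cases hYZ : Y = Z
  · subst hYZ
    rw [Matrix.blockDiagonal'_apply_eq]
    by_cases hX : Y = X
    · subst hX
      have : 𝔄.base.e Y Y = 1 := Pi.single_eq_same _ _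
      rw [this, map_one]
      by_cases hab : a = b
      · subst hab; simp
      · rw [Matrix.one_apply_ne hab, Matrix.diagonal_apply_ne]
        intro h; exact hab (by simpa using h)
    · have : 𝔄.base.e X Y = 0 := Pi.single_eq_of_ne hX _
      rw [this, map_zero, Matrix.diagonal_apply]
      simp [hX]
  · rw [Matrix.blockDiagonal'_apply_ne _ _ _ hYZ, Matrix.diagonal_apply_ne]
    intro h; exact hYZ (congrArg Sigma.fst h)

lemma bim_e2_apply (P Q : RepA 𝔄) (X Y : 𝔄.Vert) (C : Matrix P.I Q.I k) (x : P.I) (y : Q.I) :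
    bim P Q (𝔄.base.e2 X Y) C x y = if x.1 = X ∧ y.1 = Y then C x y else 0 := by
  rw [MinAlg.e2, matBim_tmul, rho_e, rho_e, Matrix.mul_diagonal, Matrix.diagonal_mul]
  by_cases h1 : x.1 = X <;> by_cases h2 : y.1 = Y <;> simp [h1, h2]

lemma supp_iff (P Q : RepA 𝔄) (X Y : 𝔄.Vert) (C : Matrix P.I Q.I k) :
    (∀ x y, C x y ≠ 0 → x.1 = X ∧ y.1 = Y) ↔ bim P Q (𝔄.base.e2 X Y) C = C := by
  constructor
  · intro h
    ext x y
    rw [bim_e2_apply]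
    split_ifs with h1
    · rfl
    · by_contra h2; exact h1 (h x y (Ne.symm h2))
  · intro h x y hC
    rw [← h, bim_e2_apply] at hC
    by_contra h1
    exact hC (if_neg h1)

lemma bim_supp (P Q : RepA 𝔄) {X Y : 𝔄.Vert} {u : T2 k 𝔄.R} (hu : 𝔄.base.e2 X Y * u = u)
    (C : Matrix P.I Q.I k) (x : P.I) (y : Q.I) (h : bim P Q u C x y ≠ 0) : x.1 = X ∧ y.1 = Y := by
  refine (supp_iff P Q X Y (bim P Q u C)).2 ?_ x y h
  rw [← Module.End.mul_apply, ← map_mul, hu]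

lemma sum_block (Q : RepA 𝔄) (r : Fin 𝔄.t) (f : Q.I → k) (h : ∀ y, f y ≠ 0 → y.1 = 𝔄.cls r) :
    ∑ b, f ⟨𝔄.cls r, b⟩ = ∑ y, f y := by
  rw [Fintype.sum_sigma]
  symm
  refine Finset.sum_eq_single (𝔄.cls r) (fun X _ hX => ?_) (fun h => absurd (Finset.mem_univ _) h)
  refine Finset.sum_eq_zero fun b _ => ?_
  by_contra h0
  exact hX (h _ h0)

lemma star_mul_star (P Q S : RepA 𝔄) {N₁ N₂ N₃ : ℕ} {U : QBasis 𝔄.base 𝔄.cls N₁}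
    {U' : QBasis 𝔄.base 𝔄.cls N₂} {U'' : QBasis 𝔄.base 𝔄.cls N₃} (h : MulClosed U U' U'')
    (i : Fin N₁) (j : Fin N₂) (C : Matrix P.I Q.I k) (D : Matrix Q.I S.I k) :
    star P Q C (U.mat i) * star Q S D (U'.mat j) =
      ∑ l, star P S (ev3 (bim P Q) (bim Q S) matMul C D (h.coef i j l)) (U''.mat l) := by
  ext x z
  have h1 : ∀ r : Fin 𝔄.t, ∑ b, star P Q C (U.mat i) x ⟨r, b⟩ * star Q S D (U'.mat j) ⟨r, b⟩ z =
      ev3 (bim P Q) (bim Q S) matMul C D (i12 k 𝔄.R (U.mat i x.1 r) * i23 k 𝔄.R (U'.mat j r z.1))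
        x.toI z.toI := by
    intro r
    rw [← ev3_mul (matMul_pairing P.rho Q.rho S.rho), matMul_apply, Matrix.mul_apply]
    rw [← sum_block Q r]
    · rfl
    · intro y hy
      have hy' := left_ne_zero_of_mul hy
      have hu : U.mat i x.1 r ≠ 0 := by
        rintro h0; rw [h0, map_zero] at hy'; exact hy' rfl
      rw [(U.supp i _ _ hu).2]
      exact (bim_supp P Q (U.comp i x.1 r) C _ _ hy').2
  rw [Matrix.mul_apply, Fintype.sum_sigma, Finset.sum_congr rfl fun r _ => h1 r]
  have h2 := congrFun (congrFun (h.coef_spec i j) x.1) z.1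
  rw [prod2, Matrix.mul_apply, Matrix.sum_apply] at h2
  rw [← Matrix.sum_apply, ← map_sum]
  simp only [Matrix.map_apply, Matrix.smul_apply, smul_eq_mul] at h2
  rw [h2, map_sum, Matrix.sum_apply, Matrix.sum_apply]
  refine Finset.sum_congr rfl fun l _ => ?_
  rw [mul_comm, ← ev3_outer (matMul_pairing P.rho Q.rho S.rho)]
  rfl

lemma bim_central_left (P Q S : RepA 𝔄) {F : Matrix P.I Q.I k}
    (hF : ∀ r, P.rho r * F = F * Q.rho r) (C : Matrix Q.I S.I k) (u : T2 k 𝔄.R) :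
    F * bim Q S u C = bim P S u (F * C) := by
  induction u using TensorProduct.induction_on with
  | zero => simp
  | add u v hu hv => simp [Matrix.mul_add, hu, hv]
  | tmul r s => simp only [matBim_tmul, ← Matrix.mul_assoc, hF]

lemma bim_central_right (P Q S : RepA 𝔄) {F : Matrix Q.I S.I k}
    (hF : ∀ r, Q.rho r * F = F * S.rho r) (C : Matrix P.I Q.I k) (u : T2 k 𝔄.R) :
    bim P Q u C * F = bim P S u (C * F) := by
  induction u using TensorProduct.induction_on with
  | zero => simp
  | add u v hu hv => simp [Matrix.add_mul, hu, hv]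
  | tmul r s => simp only [matBim_tmul, Matrix.mul_assoc, hF]

lemma block_of_central (P Q : RepA 𝔄) {F : Matrix P.I Q.I k}
    (hF : ∀ r, P.rho r * F = F * Q.rho r) (x : P.I) (y : Q.I) (h : F x y ≠ 0) : x.1 = y.1 := by
  have h1 := congrFun (congrFun (hF (𝔄.base.e x.1)) x) y
  rw [rho_e, rho_e, Matrix.diagonal_mul, Matrix.mul_diagonal] at h1
  by_contra h2
  rw [if_pos rfl, if_neg (Ne.symm h2), one_mul, mul_zero] at h1
  exact h h1

lemma starE_mul_star (P Q S : RepA 𝔄) {F : Matrix P.I Q.I k}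
    (hF : ∀ r, P.rho r * F = F * Q.rho r) (C : Matrix Q.I S.I k)
    (U : Matrix (Fin 𝔄.t) (Fin 𝔄.t) (T2 k 𝔄.R)) :
    starE P Q F * star Q S C U = star P S (F * C) U := by
  ext x z
  rw [Matrix.mul_apply, Fintype.sum_sigma, Finset.sum_eq_single x.1]
  · have : ∀ b, starE P Q F x ⟨x.1, b⟩ * star Q S C U ⟨x.1, b⟩ z =
        (fun y => F x.toI y * bim Q S (U x.1 z.1) C y z.toI) ⟨𝔄.cls x.1, b⟩ := fun b => by
      simp [starE, star, J.toI]
    refine (Finset.sum_congr rfl fun b _ => this b).trans ((sum_block Q x.1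
      (fun y => F x.toI y * bim Q S (U x.1 z.1) C y z.toI) ?_).trans ?_)
    · intro y hy
      exact (block_of_central P Q hF _ _ (left_ne_zero_of_mul hy)).symm
    · change (F * bim Q S (U x.1 z.1) C) x.toI z.toI = _
      rw [bim_central_left P Q S hF]
      rfl
  · intro r _ hr
    exact Finset.sum_eq_zero fun b _ => by simp [starE, hr.symm]
  · intro h; exact absurd (Finset.mem_univ _) h

lemma star_mul_starE (P Q S : RepA 𝔄) {F : Matrix Q.I S.I k}
    (hF : ∀ r, Q.rho r * F = F * S.rho r) (C : Matrix P.I Q.I k)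
    (U : Matrix (Fin 𝔄.t) (Fin 𝔄.t) (T2 k 𝔄.R)) :
    star P Q C U * starE Q S F = star P S (C * F) U := by
  ext x z
  rw [Matrix.mul_apply, Fintype.sum_sigma, Finset.sum_eq_single z.1]
  · have : ∀ b, star P Q C U x ⟨z.1, b⟩ * starE Q S F ⟨z.1, b⟩ z =
        (fun y => bim P Q (U x.1 z.1) C x.toI y * F y z.toI) ⟨𝔄.cls z.1, b⟩ := fun b => by
      simp [starE, star, J.toI]
    refine (Finset.sum_congr rfl fun b _ => this b).trans ((sum_block Q z.1
      (fun y => bim P Q (U x.1 z.1) C x.toI y * F y z.toI) ?_).trans ?_)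
    · intro y hy
      exact block_of_central Q S hF _ _ (right_ne_zero_of_mul hy)
    · change (bim P Q (U x.1 z.1) C * F) x.toI z.toI = _
      rw [bim_central_right P Q S hF]
      rfl
  · intro r _ hr
    exact Finset.sum_eq_zero fun b _ => by simp [starE, hr]
  · intro h; exact absurd (Finset.mem_univ _) h

lemma starE_mul_starE (P Q S : RepA 𝔄) {F : Matrix P.I Q.I k}
    (hF : ∀ r, P.rho r * F = F * Q.rho r) (G : Matrix Q.I S.I k) :
    starE P Q F * starE Q S G = starE P S (F * G) := by
  ext x z
  rw [Matrix.mul_apply, Fintype.sum_sigma, Finset.sum_eq_single x.1]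
  · by_cases hxz : x.1 = z.1
    · have : ∀ b, starE P Q F x ⟨x.1, b⟩ * starE Q S G ⟨x.1, b⟩ z =
          (fun y => F x.toI y * G y z.toI) ⟨𝔄.cls x.1, b⟩ := fun b => by
        simp [starE, J.toI, hxz]
      refine (Finset.sum_congr rfl fun b _ => this b).trans ((sum_block Q x.1
        (fun y => F x.toI y * G y z.toI) ?_).trans ?_)
      · intro y hy
        exact (block_of_central P Q hF _ _ (left_ne_zero_of_mul hy)).symm
      · change (F * G) x.toI z.toI = _
        simp [starE, hxz]
    · simp [starE, hxz]
  · intro r _ hr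
    exact Finset.sum_eq_zero fun b _ => by simp [starE, hr.symm]
  · intro h; exact absurd (Finset.mem_univ _) h

/-- Composition of the families `(f_X; f(v_j))`. -/
noncomputable def compFam (P Q S : RepA 𝔄) (f : Matrix P.I Q.I k × (Fin 𝔄.m → Matrix P.I Q.I k))
    (g : Matrix Q.I S.I k × (Fin 𝔄.m → Matrix Q.I S.I k)) :
    Matrix P.I S.I k × (Fin 𝔄.m → Matrix P.I S.I k) :=
  (f.1 * g.1, compv 𝔄 (bim P Q) (bim Q S) matMul f.1 f.2 g.1 g.2)

lemma barHom_comp (P Q S : RepA 𝔄) (f : Matrix P.I Q.I k × (Fin 𝔄.m → Matrix P.I Q.I k))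
    (g : Matrix Q.I S.I k × (Fin 𝔄.m → Matrix Q.I S.I k))
    (hf : ∀ r, P.rho r * f.1 = f.1 * Q.rho r) (hg : ∀ r, Q.rho r * g.1 = g.1 * S.rho r) :
    barHom P S (compFam P Q S f g) = barHom P Q f * barHom Q S g := by
  simp only [barHom, compFam, compv, star_add, Matrix.add_mul, Matrix.mul_add, star_sum,
    Finset.sum_add_distrib, Matrix.sum_mul, Matrix.mul_sum, starE_mul_starE P Q S hf,
    starE_mul_star P Q S hf, star_mul_starE P Q S hg, star_mul_star P Q S 𝔄.VV, matMul_apply]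
  have e : ∑ l, ∑ i, ∑ j, star P S (ev3 (bim P Q) (bim Q S) matMul (f.2 i) (g.2 j) (𝔄.γ i j l))
      (𝔄.V.mat l) = ∑ j, ∑ i, ∑ l, star P S (ev3 (bim P Q) (bim Q S) matMul (f.2 i) (g.2 j)
        (𝔄.VV.coef i j l)) (𝔄.V.mat l) := by
    rw [Finset.sum_comm]
    rw [Finset.sum_comm (s := (Finset.univ : Finset (Fin 𝔄.m))) (t := Finset.univ)
      (f := fun j i => ∑ l, star P S (ev3 (bim P Q) (bim Q S) matMul (f.2 i) (g.2 j)
        (𝔄.VV.coef i j l)) (𝔄.V.mat l))]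
    exact Finset.sum_congr rfl fun i _ => Finset.sum_comm
  rw [e]
  abel

lemma ev3_supp (P Q S : RepA 𝔄) (C : Matrix P.I Q.I k) (D : Matrix Q.I S.I k) (i j l : Fin 𝔄.m) :
    bim P S (𝔄.base.e2 (𝔄.V.src l) (𝔄.V.tgt l))
      (ev3 (bim P Q) (bim Q S) matMul C D (𝔄.γ i j l)) =
      ev3 (bim P Q) (bim Q S) matMul C D (𝔄.γ i j l) := by
  rw [ev3_outer (matMul_pairing P.rho Q.rho S.rho), MatrixBimoduleProblem.γ, 𝔄.VV.coef_cut]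

lemma comp_mem (P Q S : RepA 𝔄) {f} (hf : f ∈ homs P Q) {g} (hg : g ∈ homs Q S) :
    compFam P Q S f g ∈ homs P S := by
  obtain ⟨f1, f2, f3⟩ := hf
  obtain ⟨g1, g2, g3⟩ := hg
  refine ⟨fun r => ?_, fun l => ?_, ?_⟩
  · simp only [compFam]
    rw [← Matrix.mul_assoc, f1, Matrix.mul_assoc, g1, Matrix.mul_assoc]
  · rw [supp_iff]
    simp only [compFam, compv, map_add, map_sum, ev3_supp, matMul_apply]
    rw [← bim_central_left P Q S f1, ← bim_central_right P Q S g1,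
      (supp_iff Q S _ _ _).1 (g2 l), (supp_iff P Q _ _ _).1 (f2 l)]
  · rw [barHom_comp P Q S f g f1 g1, ← Matrix.mul_assoc, f3, Matrix.mul_assoc, g3,
      Matrix.mul_assoc]

lemma id_mem (P : RepA 𝔄) :
    ((1, 0) : Matrix P.I P.I k × (Fin 𝔄.m → Matrix P.I P.I k)) ∈ homs P P := by
  refine ⟨fun r => by simp, fun j x y h => absurd rfl h, ?_⟩
  have : barHom P P (1, 0) = 1 := by
    ext ⟨i, a⟩ ⟨j, b⟩
    have h0 : ∀ l, star P P (0 : Matrix P.I P.I k) (𝔄.V.mat l) = 0 := fun l => by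
      simpa using star_smul P P 0 0 (𝔄.V.mat l)
    simp only [barHom, Pi.zero_apply, h0, Finset.sum_const_zero, add_zero]
    by_cases hij : i = j
    · subst hij
      by_cases hab : a = b
      · subst hab; simp [starE]
      · rw [Matrix.one_apply_ne (by intro h; exact hab (by simpa using h))]
        simp only [starE, Matrix.of_apply, if_true]
        exact Matrix.one_apply_ne (by intro h; exact hab (by simpa [J.toI] using h))
    · rw [Matrix.one_apply_ne (by intro h; exact hij (congrArg Sigma.fst h))]
      simp [starE, hij]
  rw [this]; simp

lemma central_iff (P Q : RepA 𝔄) (F : Matrix P.I Q.I k) :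
    Central (bim P Q) F ↔ ∀ r, P.rho r * F = F * Q.rho r := by
  simp [Central]

lemma compFam_add_left (P Q S : RepA 𝔄) (f f' : Matrix P.I Q.I k × (Fin 𝔄.m → Matrix P.I Q.I k))
    (g : Matrix Q.I S.I k × (Fin 𝔄.m → Matrix Q.I S.I k)) :
    compFam P Q S (f + f') g = compFam P Q S f g + compFam P Q S f' g :=
  Prod.ext (Matrix.add_mul _ _ _) (funext fun _ => compv_add_left ..)

lemma compFam_add_right (P Q S : RepA 𝔄) (f : Matrix P.I Q.I k × (Fin 𝔄.m → Matrix P.I Q.I k))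
    (g g' : Matrix Q.I S.I k × (Fin 𝔄.m → Matrix Q.I S.I k)) :
    compFam P Q S f (g + g') = compFam P Q S f g + compFam P Q S f g' :=
  Prod.ext (Matrix.mul_add _ _ _) (funext fun _ => compv_add_right ..)

lemma compFam_smul_left (P Q S : RepA 𝔄) (c : k)
    (f : Matrix P.I Q.I k × (Fin 𝔄.m → Matrix P.I Q.I k))
    (g : Matrix Q.I S.I k × (Fin 𝔄.m → Matrix Q.I S.I k)) :
    compFam P Q S (c • f) g = c • compFam P Q S f g :=
  Prod.ext (Matrix.smul_mul _ _ _) (funext fun _ => compv_smul_left ..)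

lemma compFam_smul_right (P Q S : RepA 𝔄) (c : k)
    (f : Matrix P.I Q.I k × (Fin 𝔄.m → Matrix P.I Q.I k))
    (g : Matrix Q.I S.I k × (Fin 𝔄.m → Matrix Q.I S.I k)) :
    compFam P Q S f (c • g) = c • compFam P Q S f g :=
  Prod.ext (Matrix.mul_smul _ _ _) (funext fun _ => compv_smul_right ..)

/-- The representation category `R(𝔄)`. -/
noncomputable instance category : Category (RepA 𝔄) where
  Hom P Q := homs P Q
  id P := ⟨(1, 0), id_mem P⟩
  comp {P Q S} f g := ⟨compFam P Q S f.1 g.1, comp_mem P Q S f.2 g.2⟩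
  id_comp {P Q} f := by
    apply Subtype.ext
    refine Prod.ext (Matrix.one_mul _) ?_
    funext l
    simp only [compFam, compv, Pi.zero_apply, matMul_apply, ev3_zero_left]
    simp
  comp_id {P Q} f := by
    apply Subtype.ext
    refine Prod.ext (Matrix.mul_one _) ?_
    funext l
    simp only [compFam, compv, Pi.zero_apply, matMul_apply, ev3_zero_right]
    simp
  assoc {P Q S T} f g h := by
    apply Subtype.ext
    refine Prod.ext (Matrix.mul_assoc _ _ _) ?_
    funext l
    exact compv_assoc 𝔄 (matMul_pairing P.rho Q.rho S.rho) (matMul_pairing Q.rho S.rho T.rho)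
      (matMul_pairing P.rho Q.rho T.rho) (fun x y z => Matrix.mul_assoc x y z)
      ((central_iff _ _ _).2 f.2.1) ((central_iff _ _ _).2 g.2.1) ((central_iff _ _ _).2 h.2.1)
      _ _ _ l

noncomputable instance : Preadditive (RepA 𝔄) where
  homGroup P Q := inferInstanceAs (AddCommGroup (homs P Q))
  add_comp P Q S f f' g := Subtype.ext (compFam_add_left P Q S f.1 f'.1 g.1)
  comp_add P Q S f g g' := Subtype.ext (compFam_add_right P Q S f.1 g.1 g'.1)

noncomputable instance : Linear k (RepA 𝔄) where
  homModule P Q := inferInstanceAs (Module k (homs P Q))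
  smul_comp P Q S c f g := Subtype.ext (compFam_smul_left P Q S c f.1 g.1)
  comp_smul P Q S f c g := Subtype.ext (compFam_smul_right P Q S c f.1 g.1)

end RepA

end RepACat

section Bocs

variable {k : Type u} [Field k] (𝔄 : MatrixBimoduleProblem k)

open MulOpposite

/-- The relations that define the tensor algebra of `𝒩` over `R`: the elements of `R` form a
`k`-algebra, and `a_l = 1_X a_l 1_Y` for `a_l` from `X` to `Y`. -/
inductive GamRel : FreeAlgebra k (𝔄.R ⊕ Fin 𝔄.n) → FreeAlgebra k (𝔄.R ⊕ Fin 𝔄.n) → Prop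
  | add (r s : 𝔄.R) : GamRel (FreeAlgebra.ι k (Sum.inl (r + s)))
      (FreeAlgebra.ι k (Sum.inl r) + FreeAlgebra.ι k (Sum.inl s))
  | mul (r s : 𝔄.R) : GamRel (FreeAlgebra.ι k (Sum.inl (r * s)))
      (FreeAlgebra.ι k (Sum.inl r) * FreeAlgebra.ι k (Sum.inl s))
  | scalar (c : k) : GamRel (FreeAlgebra.ι k (Sum.inl (algebraMap k 𝔄.R c)))
      (algebraMap k _ c)
  | src (l : Fin 𝔄.n) : GamRel (FreeAlgebra.ι k (Sum.inl (𝔄.base.e (𝔄.A.src l))) *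
      FreeAlgebra.ι k (Sum.inr l)) (FreeAlgebra.ι k (Sum.inr l))
  | tgt (l : Fin 𝔄.n) : GamRel (FreeAlgebra.ι k (Sum.inr l) *
      FreeAlgebra.ι k (Sum.inl (𝔄.base.e (𝔄.A.tgt l)))) (FreeAlgebra.ι k (Sum.inr l))

/-- `Γ`, the tensor algebra over `R` of the quasi-free bimodule `𝒩` with quasi-basis
`a_1, …, a_n` dual to `A_1, …, A_n`. -/
def Gam : Type u := RingQuot (GamRel 𝔄)

noncomputable instance : Ring (Gam 𝔄) := inferInstanceAs (Ring (RingQuot (GamRel 𝔄)))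
noncomputable instance : Algebra k (Gam 𝔄) := inferInstanceAs (Algebra k (RingQuot (GamRel 𝔄)))

namespace Gam

/-- The projection of the free algebra onto `Γ`. -/
noncomputable def mk : FreeAlgebra k (𝔄.R ⊕ Fin 𝔄.n) →ₐ[k] Gam 𝔄 :=
  RingQuot.mkAlgHom k (GamRel 𝔄)

variable {𝔄} in
lemma mk_rel {x y : FreeAlgebra k (𝔄.R ⊕ Fin 𝔄.n)} (h : GamRel 𝔄 x y) : mk 𝔄 x = mk 𝔄 y :=
  RingQuot.mkAlgHom_rel k h

/-- The inclusion `R → Γ`. -/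
noncomputable def inc : 𝔄.R →ₐ[k] Gam 𝔄 where
  toFun r := mk 𝔄 (FreeAlgebra.ι k (Sum.inl r))
  map_one' := by
    have := mk_rel (GamRel.scalar (𝔄 := 𝔄) 1)
    rwa [map_one, map_one, map_one] at this
  map_mul' r s := by rw [mk_rel (GamRel.mul r s), map_mul]
  map_zero' := by
    have := mk_rel (GamRel.scalar (𝔄 := 𝔄) 0)
    rwa [map_zero, map_zero, map_zero] at this
  map_add' r s := by rw [mk_rel (GamRel.add r s), map_add]
  commutes' c := by rw [mk_rel (GamRel.scalar c)]; exact AlgHom.commutes _ c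

/-- The generators `a_l`. -/
noncomputable def a (l : Fin 𝔄.n) : Gam 𝔄 := mk 𝔄 (FreeAlgebra.ι k (Sum.inr l))

end Gam

/-- `Γ`-`Γ`-bimodules are modules over `Γ ⊗_k Γᵒᵖ`. -/
def Ge : Type u := Gam 𝔄 ⊗[k] (Gam 𝔄)ᵐᵒᵖ

noncomputable instance : Ring (Ge 𝔄) := inferInstanceAs (Ring (Gam 𝔄 ⊗[k] (Gam 𝔄)ᵐᵒᵖ))
noncomputable instance : Algebra k (Ge 𝔄) := inferInstanceAs (Algebra k (Gam 𝔄 ⊗[k] (Gam 𝔄)ᵐᵒᵖ))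

/-- The element `a ⊗ b` of `Γ ⊗_k Γᵒᵖ`; it acts by `x ↦ a x b`. -/
noncomputable def Ge.t (a b : Gam 𝔄) : Ge 𝔄 := (a ⊗ₜ[k] op b : Gam 𝔄 ⊗[k] (Gam 𝔄)ᵐᵒᵖ)

lemma Ge.t_mul (a b c d : Gam 𝔄) : Ge.t 𝔄 a b * Ge.t 𝔄 c d = Ge.t 𝔄 (a * c) (d * b) :=
  Algebra.TensorProduct.tmul_mul_tmul ..

lemma Ge.ind {p : Ge 𝔄 → Prop} (z : Ge 𝔄) (h0 : p 0) (h : ∀ a b, p (Ge.t 𝔄 a b))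
    (ha : ∀ x y, p x → p y → p (x + y)) : p z :=
  TensorProduct.induction_on (motive := p) z h0 (fun a b => h a b.unop) ha

/-- `R ⊗_k R → Γ ⊗_k Γᵒᵖ`. -/
noncomputable def jR : T2 k 𝔄.R →ₐ[k] Ge 𝔄 :=
  (Algebra.TensorProduct.map (Gam.inc 𝔄) ((Gam.inc 𝔄).toOpposite fun x y => by
      rw [Commute, SemiconjBy, ← map_mul, mul_comm, map_mul]) :
    T2 k 𝔄.R →ₐ[k] Gam 𝔄 ⊗[k] (Gam 𝔄)ᵐᵒᵖ)

@[simp] lemma jR_tmul (r s : 𝔄.R) : jR 𝔄 (r ⊗ₜ s) = Ge.t 𝔄 (Gam.inc 𝔄 r) (Gam.inc 𝔄 s) := rfl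

/-- `a ↦ a ⊗ 1` and `b ↦ 1 ⊗ b`. -/
noncomputable def Ge.l : Gam 𝔄 →ₐ[k] Ge 𝔄 :=
  (Algebra.TensorProduct.includeLeft : Gam 𝔄 →ₐ[k] Gam 𝔄 ⊗[k] (Gam 𝔄)ᵐᵒᵖ)
noncomputable def Ge.r : (Gam 𝔄)ᵐᵒᵖ →ₐ[k] Ge 𝔄 :=
  (Algebra.TensorProduct.includeRight : (Gam 𝔄)ᵐᵒᵖ →ₐ[k] Gam 𝔄 ⊗[k] (Gam 𝔄)ᵐᵒᵖ)

/-- `Γ ⊗_k Γᵒᵖ → End_k Γ`. -/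
noncomputable def Ge.onGam : Ge 𝔄 →ₐ[k] Module.End k (Gam 𝔄) := AlgHom.mulLeftRight k (Gam 𝔄)

noncomputable instance : Module (Ge 𝔄) (Gam 𝔄) :=
  Module.compHom (Gam 𝔄) (Ge.onGam 𝔄).toRingHom

lemma Gam.smul_def (z : Ge 𝔄) (x : Gam 𝔄) : z • x = Ge.onGam 𝔄 z x := rfl

instance : IsScalarTower k (Ge 𝔄) (Gam 𝔄) where
  smul_assoc c z x := by rw [Gam.smul_def, Gam.smul_def, map_smul]; rfl

@[simp] lemma Gam.tmul_smul (a b x : Gam 𝔄) :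
    Ge.t 𝔄 a b • x = a * x * b := AlgHom.mulLeftRight_apply ..

section Bimodule

variable (N N' : Type u) [AddCommGroup N] [Module k N] [Module (Ge 𝔄) N] [IsScalarTower k (Ge 𝔄) N]
  [AddCommGroup N'] [Module k N'] [Module (Ge 𝔄) N'] [IsScalarTower k (Ge 𝔄) N']

/-- The underlying `R`-`R`-bimodule of a `Γ`-`Γ`-bimodule. -/
noncomputable def bact : BiAct k 𝔄.R N := (Algebra.lsmul k k N).comp (jR 𝔄)

/-- Left and right multiplication by elements of `Γ`. -/
noncomputable def lmul : Gam 𝔄 →ₗ[k] N →ₗ[k] N :=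
  (Algebra.lsmul k k N).toLinearMap ∘ₗ (Ge.l 𝔄).toLinearMap
noncomputable def rmul : N →ₗ[k] Gam 𝔄 →ₗ[k] N :=
  ((Algebra.lsmul k k N).toLinearMap ∘ₗ (Ge.r 𝔄).toLinearMap ∘ₗ
      (opLinearEquiv k : Gam 𝔄 ≃ₗ[k] _).toLinearMap).flip

variable {N N'}

lemma bact_apply (u : T2 k 𝔄.R) (x : N) : bact 𝔄 N u x = jR 𝔄 u • x := rfl
lemma lmul_apply (g : Gam 𝔄) (x : N) : lmul 𝔄 N g x = Ge.t 𝔄 g 1 • x := rfl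
lemma rmul_apply (g : Gam 𝔄) (x : N) : rmul 𝔄 N x g = Ge.t 𝔄 1 g • x := rfl

lemma rmul_pairing : IsPairing (bact 𝔄 N) (bact 𝔄 (Gam 𝔄)) (bact 𝔄 N) (rmul 𝔄 N) where
  outer r t x y := by
    simp only [bact_apply, rmul_apply, jR_tmul, smul_smul, Ge.t_mul,
      Gam.tmul_smul, map_one, one_mul, mul_one]
  inner s x y := by
    simp only [bact_apply, rmul_apply, jR_tmul, smul_smul, Ge.t_mul,
      Gam.tmul_smul, map_one, one_mul, mul_one]

lemma lmul_pairing : IsPairing (bact 𝔄 (Gam 𝔄)) (bact 𝔄 N) (bact 𝔄 N) (lmul 𝔄 N) where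
  outer r t x y := by
    simp only [bact_apply, lmul_apply, jR_tmul, smul_smul, Ge.t_mul,
      Gam.tmul_smul, map_one, one_mul, mul_one]
  inner s x y := by
    simp only [bact_apply, lmul_apply, jR_tmul, smul_smul, Ge.t_mul,
      Gam.tmul_smul, map_one, one_mul, mul_one]

variable (w : N) (v : Fin 𝔄.m → N)

/-- `ι₁₁(a_l) = ∑_{i,j} η_{ijl} ⊗_{R^{⊗3}} (v_i ⊗_R a_j)`. -/
noncomputable def iota11 (l : Fin 𝔄.n) : N :=
  ∑ i, ∑ j, ev3 (bact 𝔄 N) (bact 𝔄 (Gam 𝔄)) (rmul 𝔄 N) (v i) (Gam.a 𝔄 j) (𝔄.η i j l)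

/-- `τ₁₁(a_l) = ∑_{i,j} σ_{ijl} ⊗_{R^{⊗3}} (a_i ⊗_R v_j)`. -/
noncomputable def tau11 (l : Fin 𝔄.n) : N :=
  ∑ i, ∑ j, ev3 (bact 𝔄 (Gam 𝔄)) (bact 𝔄 N) (lmul 𝔄 N) (Gam.a 𝔄 i) (v j) (𝔄.σ i j l)

/-- `∂₁(a_l) = ∑_i ζ_{il} ⊗_{R^{⊗2}} v_i`. -/
noncomputable def del1 (l : Fin 𝔄.n) : N := ∑ i, bact 𝔄 N (𝔄.ζ i l) (v i)

/-- `(κ₁ - κ₂ + κ₃)(a_l) = (ω a_l + ι₁₁(a_l)) - (a_l ω + τ₁₁(a_l)) + ∂₁(a_l)`. -/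
noncomputable def kap (l : Fin 𝔄.n) : N :=
  (rmul 𝔄 N w (Gam.a 𝔄 l) + iota11 𝔄 v l) - (lmul 𝔄 N (Gam.a 𝔄 l) w + tau11 𝔄 v l) + del1 𝔄 v l

variable (φ : N →ₗ[Ge 𝔄] N')

lemma map_kscal (c : k) (x : N) : φ (c • x) = c • φ x := by
  rw [← one_smul (Ge 𝔄) x, ← smul_assoc, map_smul, smul_assoc, map_smul, one_smul]

lemma map_rmul (x : N) (g : Gam 𝔄) : φ (rmul 𝔄 N x g) = rmul 𝔄 N' (φ x) g := map_smul φ _ _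
lemma map_lmul (g : Gam 𝔄) (x : N) : φ (lmul 𝔄 N g x) = lmul 𝔄 N' g (φ x) := map_smul φ _ _
lemma map_bact (u : T2 k 𝔄.R) (x : N) : φ (bact 𝔄 N u x) = bact 𝔄 N' u (φ x) := map_smul φ _ _

lemma map_iota11 (l : Fin 𝔄.n) : φ (iota11 𝔄 v l) = iota11 𝔄 (fun j => φ (v j)) l := by
  have h : ∀ x y c, φ (ev3 (bact 𝔄 N) (bact 𝔄 (Gam 𝔄)) (rmul 𝔄 N) x y c) =
      ev3 (bact 𝔄 N') (bact 𝔄 (Gam 𝔄)) (rmul 𝔄 N') (φ x) y c := by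
    intro x y c
    induction c using T3.ind with
    | h0 => simp
    | ha _ _ h1 h2 => simp only [map_add, h1, h2]
    | h p q r => simp only [ev3_tmul, map_rmul, map_bact]
  simp only [iota11, map_sum, h]

lemma map_tau11 (l : Fin 𝔄.n) : φ (tau11 𝔄 v l) = tau11 𝔄 (fun j => φ (v j)) l := by
  have h : ∀ x y c, φ (ev3 (bact 𝔄 (Gam 𝔄)) (bact 𝔄 N) (lmul 𝔄 N) x y c) =
      ev3 (bact 𝔄 (Gam 𝔄)) (bact 𝔄 N') (lmul 𝔄 N') x (φ y) c := by
    intro x y c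
    induction c using T3.ind with
    | h0 => simp
    | ha _ _ h1 h2 => simp only [map_add, h1, h2]
    | h p q r => simp only [ev3_tmul, map_lmul, map_bact]
  simp only [tau11, map_sum, h]

lemma map_del1 (l : Fin 𝔄.n) : φ (del1 𝔄 v l) = del1 𝔄 (fun j => φ (v j)) l := by
  simp only [del1, map_sum, map_bact]

lemma map_kap (l : Fin 𝔄.n) : φ (kap 𝔄 w v l) = kap 𝔄 (φ w) (fun j => φ (v j)) l := by
  simp only [kap, map_add, map_sub, map_rmul, map_lmul, map_iota11, map_tau11, map_del1]

end Bimodule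

/-- The relations of `Ξ`: `ω` (`none`) commutes with `R`, and `v_j = 1_X v_j 1_Y` for `v_j` from
`X` to `Y`. -/
noncomputable def xiRel : Submodule (Ge 𝔄) (Option (Fin 𝔄.m) →₀ Ge 𝔄) :=
  Submodule.span _
    ((Set.range fun r : 𝔄.R => Finsupp.single none (jR 𝔄 (r ⊗ₜ 1) - jR 𝔄 (1 ⊗ₜ r))) ∪
      Set.range fun j : Fin 𝔄.m =>
        Finsupp.single (some j) (jR 𝔄 (𝔄.base.e2 (𝔄.V.src j) (𝔄.V.tgt j)) - 1))

/-- `Ξ = Γ ⊗_R 𝒞 ⊗_R Γ`, where `𝒞 = 𝒞₀ ⊕ 𝒞₁`, `𝒞₀ ≅ R` is generated by `ω = ∑_X e_X`, and `𝒞₁` is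
quasi-free with quasi-basis `v_1, …, v_m` dual to `V_1, …, V_m`. -/
def Xi : Type u := (Option (Fin 𝔄.m) →₀ Ge 𝔄) ⧸ xiRel 𝔄

noncomputable instance : AddCommGroup (Xi 𝔄) :=
  inferInstanceAs (AddCommGroup ((Option (Fin 𝔄.m) →₀ Ge 𝔄) ⧸ xiRel 𝔄))
noncomputable instance : Module (Ge 𝔄) (Xi 𝔄) :=
  inferInstanceAs (Module (Ge 𝔄) ((Option (Fin 𝔄.m) →₀ Ge 𝔄) ⧸ xiRel 𝔄))
noncomputable instance : Module k (Xi 𝔄) :=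
  inferInstanceAs (Module k ((Option (Fin 𝔄.m) →₀ Ge 𝔄) ⧸ xiRel 𝔄))
noncomputable instance : IsScalarTower k (Ge 𝔄) (Xi 𝔄) :=
  inferInstanceAs (IsScalarTower k (Ge 𝔄) ((Option (Fin 𝔄.m) →₀ Ge 𝔄) ⧸ xiRel 𝔄))

namespace Xi

/-- The generators of `Ξ`. -/
noncomputable def gen (o : Option (Fin 𝔄.m)) : Xi 𝔄 := (xiRel 𝔄).mkQ (Finsupp.single o 1)
noncomputable def ω : Xi 𝔄 := gen 𝔄 none
noncomputable def v (j : Fin 𝔄.m) : Xi 𝔄 := gen 𝔄 (some j)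

/-- The universal property of `Ξ`. -/
noncomputable def lift {N : Type u} [AddCommGroup N] [Module k N] [Module (Ge 𝔄) N]
    [IsScalarTower k (Ge 𝔄) N]
    (w : N) (v : Fin 𝔄.m → N) (hw : Central (bact 𝔄 N) w)
    (hv : ∀ j, bact 𝔄 N (𝔄.base.e2 (𝔄.V.src j) (𝔄.V.tgt j)) (v j) = v j) : Xi 𝔄 →ₗ[Ge 𝔄] N :=
  (xiRel 𝔄).liftQ (Finsupp.linearCombination (Ge 𝔄) (fun o : Option (Fin 𝔄.m) => o.elim w v)) (by
    rw [xiRel, Submodule.span_le]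
    rintro _ (⟨r, rfl⟩ | ⟨j, rfl⟩)
    · have := hw r
      rw [bact_apply, bact_apply] at this
      simp [this, -jR_tmul]
    · have := hv j
      rw [bact_apply] at this
      simp [this])

section

variable {N : Type u} [AddCommGroup N] [Module k N] [Module (Ge 𝔄) N]
    [IsScalarTower k (Ge 𝔄) N]
    (w : N) (v : Fin 𝔄.m → N) (hw : Central (bact 𝔄 N) w)
    (hv : ∀ j, bact 𝔄 N (𝔄.base.e2 (𝔄.V.src j) (𝔄.V.tgt j)) (v j) = v j)

@[simp] lemma lift_ω : lift 𝔄 w v hw hv (ω 𝔄) = w := by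
  change Finsupp.linearCombination (Ge 𝔄) _ (Finsupp.single none 1) = w
  simp
@[simp] lemma lift_v (j : Fin 𝔄.m) : lift 𝔄 w v hw hv (Xi.v 𝔄 j) = v j := by
  change Finsupp.linearCombination (Ge 𝔄) _ (Finsupp.single (some j) 1) = v j
  simp

end

lemma smul_gen (z : Ge 𝔄) (o : Option (Fin 𝔄.m)) :
    z • gen 𝔄 o = (xiRel 𝔄).mkQ (Finsupp.single o z) := by
  change z • (xiRel 𝔄).mkQ (Finsupp.single o 1) = _
  rw [← map_smul, Finsupp.smul_single, smul_eq_mul, mul_one]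

lemma central (r : 𝔄.R) : jR 𝔄 (r ⊗ₜ 1) • ω 𝔄 = jR 𝔄 (1 ⊗ₜ r) • ω 𝔄 := by
  rw [← sub_eq_zero, ← sub_smul, ω, smul_gen]
  exact (Submodule.Quotient.mk_eq_zero _).2 (Submodule.subset_span (Or.inl ⟨r, rfl⟩))

lemma v_cut (j : Fin 𝔄.m) : jR 𝔄 (𝔄.base.e2 (𝔄.V.src j) (𝔄.V.tgt j)) • v 𝔄 j = v 𝔄 j := by
  rw [← sub_eq_zero]
  nth_rewrite 2 [← one_smul (Ge 𝔄) (v 𝔄 j)]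
  rw [← sub_smul, v, smul_gen]
  exact (Submodule.Quotient.mk_eq_zero _).2 (Submodule.subset_span (Or.inr ⟨j, rfl⟩))

lemma span_gen : Submodule.span (Ge 𝔄) (Set.range (gen 𝔄)) = ⊤ := by
  rw [eq_top_iff]
  rintro x -
  obtain ⟨y, rfl⟩ := (xiRel 𝔄).mkQ_surjective x
  induction y using Finsupp.induction_linear with
  | zero => rw [map_zero]; exact zero_mem _
  | add f g hf hg => rw [map_add]; exact add_mem hf hg
  | single o z =>
    rw [← smul_gen]
    exact Submodule.smul_mem _ _ (Submodule.subset_span ⟨o, rfl⟩)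

end Xi

/-- The sub-bimodule of `Ξ` generated by the image of `κ₁ - κ₂ + κ₃`. -/
noncomputable def kapIm : Submodule (Ge 𝔄) (Xi 𝔄) :=
  Submodule.span _ (Set.range fun l => kap 𝔄 (Xi.ω 𝔄) (Xi.v 𝔄) l)

/-- The bimodule `Ω = Ξ / Im(κ₁ - κ₂ + κ₃)` of the bocs. -/
def Om : Type u := Xi 𝔄 ⧸ kapIm 𝔄

noncomputable instance : AddCommGroup (Om 𝔄) := inferInstanceAs (AddCommGroup (Xi 𝔄 ⧸ kapIm 𝔄))
noncomputable instance : Module (Ge 𝔄) (Om 𝔄) := inferInstanceAs (Module _ (Xi 𝔄 ⧸ kapIm 𝔄))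
noncomputable instance : Module k (Om 𝔄) := inferInstanceAs (Module k (Xi 𝔄 ⧸ kapIm 𝔄))
noncomputable instance : IsScalarTower k (Ge 𝔄) (Om 𝔄) :=
  inferInstanceAs (IsScalarTower k (Ge 𝔄) (Xi 𝔄 ⧸ kapIm 𝔄))

namespace Om

/-- The projection `Ξ → Ω`. -/
noncomputable def mk : Xi 𝔄 →ₗ[Ge 𝔄] Om 𝔄 := (kapIm 𝔄).mkQ
/-- The images of `ω = ∑_X e_X` and of the `v_j` in `Ω`. -/
noncomputable def ω : Om 𝔄 := mk 𝔄 (Xi.ω 𝔄)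
noncomputable def v (j : Fin 𝔄.m) : Om 𝔄 := mk 𝔄 (Xi.v 𝔄 j)

lemma central : Central (bact 𝔄 (Om 𝔄)) (ω 𝔄) := fun r => by
  rw [ω, ← map_bact, ← map_bact]; exact congrArg _ (Xi.central 𝔄 r)

lemma v_cut (j : Fin 𝔄.m) :
    bact 𝔄 (Om 𝔄) (𝔄.base.e2 (𝔄.V.src j) (𝔄.V.tgt j)) (v 𝔄 j) = v 𝔄 j := by
  rw [v, ← map_bact]; exact congrArg _ (Xi.v_cut 𝔄 j)

lemma kap_eq_zero (l : Fin 𝔄.n) : kap 𝔄 (ω 𝔄) (v 𝔄) l = 0 := by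
  have := map_kap 𝔄 (Xi.ω 𝔄) (Xi.v 𝔄) (mk 𝔄) l
  refine this.symm.trans ?_
  exact (Submodule.Quotient.mk_eq_zero _).2 (Submodule.subset_span ⟨l, rfl⟩)

/-- The universal property of `Ω`. -/
noncomputable def lift {N : Type u} [AddCommGroup N] [Module k N] [Module (Ge 𝔄) N]
    [IsScalarTower k (Ge 𝔄) N] (w : N) (v : Fin 𝔄.m → N) (hw : Central (bact 𝔄 N) w)
    (hv : ∀ j, bact 𝔄 N (𝔄.base.e2 (𝔄.V.src j) (𝔄.V.tgt j)) (v j) = v j)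
    (hk : ∀ l, kap 𝔄 w v l = 0) : Om 𝔄 →ₗ[Ge 𝔄] N :=
  (kapIm 𝔄).liftQ (Xi.lift 𝔄 w v hw hv) (by
    rw [kapIm, Submodule.span_le]
    rintro _ ⟨l, rfl⟩
    change Xi.lift 𝔄 w v hw hv (kap 𝔄 (Xi.ω 𝔄) (Xi.v 𝔄) l) = 0
    rw [map_kap, Xi.lift_ω]
    simp only [Xi.lift_v]
    exact hk l)

section

variable {N : Type u} [AddCommGroup N] [Module k N] [Module (Ge 𝔄) N]
    [IsScalarTower k (Ge 𝔄) N] (w : N) (v : Fin 𝔄.m → N) (hw : Central (bact 𝔄 N) w)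
    (hv : ∀ j, bact 𝔄 N (𝔄.base.e2 (𝔄.V.src j) (𝔄.V.tgt j)) (v j) = v j)
    (hk : ∀ l, kap 𝔄 w v l = 0)

@[simp] lemma lift_ω : lift 𝔄 w v hw hv hk (ω 𝔄) = w := Xi.lift_ω 𝔄 w v hw hv
@[simp] lemma lift_v (j : Fin 𝔄.m) : lift 𝔄 w v hw hv hk (Om.v 𝔄 j) = v j :=
  Xi.lift_v 𝔄 w v hw hv j

end

/-- An additive property stable under both multiplications that holds for `ω` and the `v_j` holds
for all elements of `Ω`. -/
lemma ind {p : Om 𝔄 → Prop} (x : Om 𝔄) (h0 : p 0) (hadd : ∀ x y, p x → p y → p (x + y))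
    (hω : p (ω 𝔄)) (hv : ∀ j, p (v 𝔄 j))
    (hs : ∀ (a b : Gam 𝔄) x, p x → p (Ge.t 𝔄 a b • x)) : p x := by
  obtain ⟨y, rfl⟩ := (kapIm 𝔄).mkQ_surjective x
  have hy : y ∈ Submodule.span (Ge 𝔄) (Set.range (Xi.gen 𝔄)) := by
    rw [Xi.span_gen]; trivial
  have hs' : ∀ (z : Ge 𝔄) x, p x → p (z • x) := by
    intro z x hx
    induction z using Ge.ind with
    | h0 => rw [zero_smul]; exact h0
    | ha z z' h1 h2 => rw [add_smul]; exact hadd _ _ h1 h2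
    | h a b => exact hs a b x hx
  induction hy using Submodule.span_induction with
  | zero => rw [map_zero]; exact h0
  | add x y _ _ h1 h2 => rw [map_add]; exact hadd _ _ h1 h2
  | smul z x _ h1 => rw [map_smul]; exact hs' z _ h1
  | mem x hx =>
    obtain ⟨o, rfl⟩ := hx
    cases o with
    | none => exact hω
    | some j => exact hv j

/-- The counit `ε : Ω → Γ`, `ω ↦ 1`, `v_j ↦ 0`. -/
noncomputable def ε : Om 𝔄 →ₗ[Ge 𝔄] Gam 𝔄 :=
  lift 𝔄 1 (fun _ => 0) (fun r => by simp [bact_apply]) (fun j => map_zero _) (fun l => by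
    have h1 : iota11 𝔄 (fun _ => (0 : Gam 𝔄)) l = 0 := by simp [iota11, ev3_zero_left]
    have h2 : tau11 𝔄 (fun _ => (0 : Gam 𝔄)) l = 0 := by simp [tau11, ev3_zero_right]
    simp [kap, h1, h2, del1, rmul_apply, lmul_apply])

/-- The differential `δ : Γ → Ω`, `δ(g) = g ω - ω g`, determined by `ω`. -/
noncomputable def δ : Gam 𝔄 →ₗ[k] Om 𝔄 := (lmul 𝔄 (Om 𝔄)).flip (ω 𝔄) - rmul 𝔄 (Om 𝔄) (ω 𝔄)

end Om

end Bocs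

section Coalgebra

variable {k : Type u} [Field k] (𝔄 : MatrixBimoduleProblem k)

open MulOpposite

/-- `Ω ⊗_k Ω` with the outer `Γ`-`Γ`-bimodule structure. -/
def PreOm2 : Type u := Om 𝔄 ⊗[k] Om 𝔄

noncomputable instance : AddCommGroup (PreOm2 𝔄) := inferInstanceAs (AddCommGroup (Om 𝔄 ⊗[k] Om 𝔄))
noncomputable instance : Module k (PreOm2 𝔄) := inferInstanceAs (Module k (Om 𝔄 ⊗[k] Om 𝔄))

lemma tensor_commute {M N : Type*} [AddCommGroup M] [Module k M] [AddCommGroup N] [Module k N]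
    (f : Module.End k M) (g : Module.End k N) :
    Commute (Module.End.rTensorAlgHom k M N f) (Module.End.lTensorAlgHom k N M g) :=
  TensorProduct.ext' fun _ _ => rfl

/-- `a (x ⊗ y) b = (a x) ⊗ (y b)`. -/
noncomputable def Ge.onPre : Ge 𝔄 →ₐ[k] Module.End k (PreOm2 𝔄) :=
  (Algebra.TensorProduct.lift
    ((Module.End.rTensorAlgHom k (Om 𝔄) (Om 𝔄)).comp ((Algebra.lsmul k k (Om 𝔄)).comp (Ge.l 𝔄)))
    ((Module.End.lTensorAlgHom k (Om 𝔄) (Om 𝔄)).comp ((Algebra.lsmul k k (Om 𝔄)).comp (Ge.r 𝔄)))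
    (fun _ _ => tensor_commute _ _) :
      Gam 𝔄 ⊗[k] (Gam 𝔄)ᵐᵒᵖ →ₐ[k] Module.End k (Om 𝔄 ⊗[k] Om 𝔄))

noncomputable instance : Module (Ge 𝔄) (PreOm2 𝔄) :=
  Module.compHom (PreOm2 𝔄) (Ge.onPre 𝔄).toRingHom

lemma PreOm2.smul_def (z : Ge 𝔄) (x : PreOm2 𝔄) : z • x = Ge.onPre 𝔄 z x := rfl

instance : IsScalarTower k (Ge 𝔄) (PreOm2 𝔄) where
  smul_assoc c z x := by rw [PreOm2.smul_def, PreOm2.smul_def, map_smul]; rfl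

/-- The pure tensor `x ⊗ y`. -/
noncomputable def PreOm2.mk : Om 𝔄 →ₗ[k] Om 𝔄 →ₗ[k] PreOm2 𝔄 := TensorProduct.mk k (Om 𝔄) (Om 𝔄)

lemma PreOm2.t_smul (a b : Gam 𝔄) (x y : Om 𝔄) :
    Ge.t 𝔄 a b • PreOm2.mk 𝔄 x y = PreOm2.mk 𝔄 (Ge.t 𝔄 a 1 • x) (Ge.t 𝔄 1 b • y) := by
  rw [PreOm2.smul_def]
  exact DFunLike.congr_fun (Algebra.TensorProduct.lift_tmul
    ((Module.End.rTensorAlgHom k (Om 𝔄) (Om 𝔄)).comp ((Algebra.lsmul k k (Om 𝔄)).comp (Ge.l 𝔄)))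
    ((Module.End.lTensorAlgHom k (Om 𝔄) (Om 𝔄)).comp ((Algebra.lsmul k k (Om 𝔄)).comp (Ge.r 𝔄)))
    (fun _ _ => tensor_commute _ _) a (op b)) (x ⊗ₜ[k] y)

/-- The relations `x g ⊗ y = x ⊗ g y`, `g ∈ Γ`. -/
noncomputable def om2Rel : Submodule (Ge 𝔄) (PreOm2 𝔄) :=
  Submodule.span _ {z | ∃ (x y : Om 𝔄) (g : Gam 𝔄), z =
    PreOm2.mk 𝔄 (rmul 𝔄 (Om 𝔄) x g) y - PreOm2.mk 𝔄 x (lmul 𝔄 (Om 𝔄) g y)}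

/-- `Ω ⊗_Γ Ω`. -/
def Om2 : Type u := PreOm2 𝔄 ⧸ om2Rel 𝔄

noncomputable instance : AddCommGroup (Om2 𝔄) := inferInstanceAs (AddCommGroup (PreOm2 𝔄 ⧸ om2Rel 𝔄))
noncomputable instance : Module (Ge 𝔄) (Om2 𝔄) := inferInstanceAs (Module _ (PreOm2 𝔄 ⧸ om2Rel 𝔄))
noncomputable instance : Module k (Om2 𝔄) := inferInstanceAs (Module k (PreOm2 𝔄 ⧸ om2Rel 𝔄))
noncomputable instance : IsScalarTower k (Ge 𝔄) (Om2 𝔄) :=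
  inferInstanceAs (IsScalarTower k (Ge 𝔄) (PreOm2 𝔄 ⧸ om2Rel 𝔄))

namespace Om2

/-- The projection `Ω ⊗_k Ω → Ω ⊗_Γ Ω`. -/
noncomputable def proj : PreOm2 𝔄 →ₗ[Ge 𝔄] Om2 𝔄 := (om2Rel 𝔄).mkQ

/-- `x ⊗_Γ y`. -/
noncomputable def tens : Om 𝔄 →ₗ[k] Om 𝔄 →ₗ[k] Om2 𝔄 :=
  (PreOm2.mk 𝔄).compr₂ ((proj 𝔄).restrictScalars k)

lemma tens_apply (x y : Om 𝔄) : tens 𝔄 x y = proj 𝔄 (PreOm2.mk 𝔄 x y) := rfl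

lemma t_smul (a b : Gam 𝔄) (x y : Om 𝔄) :
    Ge.t 𝔄 a b • tens 𝔄 x y = tens 𝔄 (Ge.t 𝔄 a 1 • x) (Ge.t 𝔄 1 b • y) := by
  rw [tens_apply, ← map_smul, PreOm2.t_smul]; rfl

lemma balanced (x y : Om 𝔄) (g : Gam 𝔄) :
    tens 𝔄 (rmul 𝔄 (Om 𝔄) x g) y = tens 𝔄 x (lmul 𝔄 (Om 𝔄) g y) := by
  rw [← sub_eq_zero, tens_apply, tens_apply, ← map_sub]
  exact (Submodule.Quotient.mk_eq_zero _).2 (Submodule.subset_span ⟨x, y, g, rfl⟩)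

lemma pairing : IsPairing (bact 𝔄 (Om 𝔄)) (bact 𝔄 (Om 𝔄)) (bact 𝔄 (Om2 𝔄)) (tens 𝔄) where
  outer r t x y := by
    simp only [bact_apply, jR_tmul, t_smul, map_one]
  inner s x y := by
    have := balanced 𝔄 x y (Gam.inc 𝔄 s)
    simpa only [bact_apply, jR_tmul, map_one, rmul_apply, lmul_apply] using this

lemma rmul_tens (x y : Om 𝔄) (g : Gam 𝔄) :
    rmul 𝔄 (Om2 𝔄) (tens 𝔄 x y) g = tens 𝔄 x (rmul 𝔄 (Om 𝔄) y g) := by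
  rw [rmul_apply, t_smul, rmul_apply]
  congr 2
  exact one_smul (Ge 𝔄) x

lemma lmul_tens (x y : Om 𝔄) (g : Gam 𝔄) :
    lmul 𝔄 (Om2 𝔄) g (tens 𝔄 x y) = tens 𝔄 (lmul 𝔄 (Om 𝔄) g x) y := by
  rw [lmul_apply, t_smul, lmul_apply]
  congr 1
  exact one_smul (Ge 𝔄) y

/-- The universal property of `Ω ⊗_Γ Ω`: a balanced `k`-bilinear map factors. -/
noncomputable def lift {N : Type*} [AddCommGroup N] [Module k N] (β : Om 𝔄 →ₗ[k] Om 𝔄 →ₗ[k] N)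
    (hβ : ∀ x y g, β (rmul 𝔄 (Om 𝔄) x g) y = β x (lmul 𝔄 (Om 𝔄) g y)) : Om2 𝔄 →ₗ[k] N :=
  ((om2Rel 𝔄).restrictScalars k).liftQ
    (TensorProduct.lift β : Om 𝔄 ⊗[k] Om 𝔄 →ₗ[k] N) (by
      have key : ∀ w ∈ om2Rel 𝔄, ∀ (β : Om 𝔄 →ₗ[k] Om 𝔄 →ₗ[k] N)
          (_ : ∀ x y g, β (rmul 𝔄 (Om 𝔄) x g) y = β x (lmul 𝔄 (Om 𝔄) g y)),
          (TensorProduct.lift β : Om 𝔄 ⊗[k] Om 𝔄 →ₗ[k] N) w = 0 := by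
        intro w hw
        induction hw using Submodule.span_induction with
        | zero => intro β _; exact map_zero _
        | add x y _ _ h1 h2 =>
          intro β hβ
          refine (map_add (TensorProduct.lift β) _ _).trans ?_
          rw [h1 β hβ, h2 β hβ, add_zero]
        | mem z hz =>
          obtain ⟨x, y, g, rfl⟩ := hz
          intro β hβ
          refine (map_sub (TensorProduct.lift β) _ _).trans ?_
          exact sub_eq_zero.2 (hβ x y g)
        | smul z w _ h =>
          intro β hβ
          induction z using Ge.ind with
          | h0 => rw [zero_smul]; exact map_zero _
          | ha z z' h1 h2 =>
            rw [add_smul]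
            refine (map_add (TensorProduct.lift β) _ _).trans ?_
            rw [h1, h2, add_zero]
          | h a b =>
            let β' : Om 𝔄 →ₗ[k] Om 𝔄 →ₗ[k] N :=
              β.compl₁₂ (lmul 𝔄 (Om 𝔄) a) ((rmul 𝔄 (Om 𝔄)).flip b)
            have hβ' : ∀ x y g, β' (rmul 𝔄 (Om 𝔄) x g) y = β' x (lmul 𝔄 (Om 𝔄) g y) := by
              intro x y g
              change β (lmul 𝔄 (Om 𝔄) a (rmul 𝔄 (Om 𝔄) x g)) (rmul 𝔄 (Om 𝔄) y b) =
                β (lmul 𝔄 (Om 𝔄) a x) (rmul 𝔄 (Om 𝔄) (lmul 𝔄 (Om 𝔄) g y) b)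
              have e1 : lmul 𝔄 (Om 𝔄) a (rmul 𝔄 (Om 𝔄) x g) =
                  rmul 𝔄 (Om 𝔄) (lmul 𝔄 (Om 𝔄) a x) g := by
                simp only [lmul_apply, rmul_apply, smul_smul, Ge.t_mul, mul_one, one_mul]
              have e2 : rmul 𝔄 (Om 𝔄) (lmul 𝔄 (Om 𝔄) g y) b =
                  lmul 𝔄 (Om 𝔄) g (rmul 𝔄 (Om 𝔄) y b) := by
                simp only [lmul_apply, rmul_apply, smul_smul, Ge.t_mul, mul_one, one_mul]
              rw [e1, e2, hβ]
            rw [← h β' hβ']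
            have : (TensorProduct.lift β : Om 𝔄 ⊗[k] Om 𝔄 →ₗ[k] N) ∘ₗ
                (Ge.onPre 𝔄 (Ge.t 𝔄 a b) : Module.End k (Om 𝔄 ⊗[k] Om 𝔄)) =
                TensorProduct.lift β' := by
              refine TensorProduct.ext' fun x y => ?_
              change TensorProduct.lift β (Ge.t 𝔄 a b • PreOm2.mk 𝔄 x y) = _
              rw [PreOm2.t_smul]
              rfl
            exact DFunLike.congr_fun this w
      exact fun w hw => key w hw β hβ)

@[simp] lemma lift_tens {N : Type*} [AddCommGroup N] [Module k N] (β : Om 𝔄 →ₗ[k] Om 𝔄 →ₗ[k] N)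
    (hβ : ∀ x y g, β (rmul 𝔄 (Om 𝔄) x g) y = β x (lmul 𝔄 (Om 𝔄) g y)) (x y : Om 𝔄) :
    lift 𝔄 β hβ (tens 𝔄 x y) = β x y := rfl

end Om2

/-- `μ(v_l) = ω ⊗ v_l + v_l ⊗ ω + ∑_{i,j} γ_{ijl} ⊗_{R^{⊗3}} (v_i ⊗ v_j)`. -/
noncomputable def muv (l : Fin 𝔄.m) : Om2 𝔄 :=
  compv 𝔄 (bact 𝔄 (Om 𝔄)) (bact 𝔄 (Om 𝔄)) (Om2.tens 𝔄) (Om.ω 𝔄) (Om.v 𝔄) (Om.ω 𝔄) (Om.v 𝔄) l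

section Coideal

variable {M₁ M₂ M : Type*} [AddCommGroup M₁] [Module k M₁] [AddCommGroup M₂] [Module k M₂]
  [AddCommGroup M] [Module k M] {R : Type*} [CommRing R] [Algebra k R]
  {a₁ : BiAct k R M₁} {a₂ : BiAct k R M₂} {a : BiAct k R M} {β : M₁ →ₗ[k] M₂ →ₗ[k] M}

lemma bi_central_left (h : IsPairing a₁ a₂ a β) {x : M₁} (hx : Central a₁ x) (y : M₂)
    (u : T2 k R) : a u (β x y) = β x (a₂ u y) := by
  induction u using TensorProduct.induction_on with
  | zero => simp
  | add u v hu hv => simp [hu, hv]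
  | tmul r s => rw [h.outer, hx r, h.inner]; simp [BiAct.mul]

lemma bi_central_right (h : IsPairing a₁ a₂ a β) (x : M₁) {y : M₂} (hy : Central a₂ y)
    (u : T2 k R) : a u (β x y) = β (a₁ u x) y := by
  induction u using TensorProduct.induction_on with
  | zero => simp
  | add u v hu hv => simp [hu, hv]
  | tmul r s => rw [h.outer, ← hy s, ← h.inner]; simp [BiAct.mul]

end Coideal

lemma omega_central2 : Central (bact 𝔄 (Om2 𝔄)) (Om2.tens 𝔄 (Om.ω 𝔄) (Om.ω 𝔄)) := fun r => by
  rw [bi_central_left (Om2.pairing 𝔄) (Om.central 𝔄), bi_central_left (Om2.pairing 𝔄) (Om.central 𝔄),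
    Om.central 𝔄 r]

lemma muv_cut (l : Fin 𝔄.m) :
    bact 𝔄 (Om2 𝔄) (𝔄.base.e2 (𝔄.V.src l) (𝔄.V.tgt l)) (muv 𝔄 l) = muv 𝔄 l := by
  simp only [muv, compv, map_add, map_sum]
  rw [bi_central_left (Om2.pairing 𝔄) (Om.central 𝔄), bi_central_right (Om2.pairing 𝔄) _ (Om.central 𝔄),
    Om.v_cut]
  simp only [ev3_outer (Om2.pairing 𝔄), MatrixBimoduleProblem.γ, 𝔄.VV.coef_cut]

/-- `ω a_l = a_l ω - (ι₁₁ - τ₁₁ + ∂₁)(a_l)` in `Ω`. -/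
lemma omega_a (l : Fin 𝔄.n) : rmul 𝔄 (Om 𝔄) (Om.ω 𝔄) (Gam.a 𝔄 l) =
    lmul 𝔄 (Om 𝔄) (Gam.a 𝔄 l) (Om.ω 𝔄) -
      (iota11 𝔄 (Om.v 𝔄) l - tau11 𝔄 (Om.v 𝔄) l + del1 𝔄 (Om.v 𝔄) l) := by
  have := Om.kap_eq_zero 𝔄 l
  rw [kap] at this
  rw [← sub_eq_zero, ← this]
  abel

/-- The image of `κ₁ - κ₂ + κ₃` is a coideal. -/
lemma coideal (l : Fin 𝔄.n) : kap 𝔄 (Om2.tens 𝔄 (Om.ω 𝔄) (Om.ω 𝔄)) (muv 𝔄) l = 0 := by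
  have pR := rmul_pairing 𝔄 (N := Om 𝔄)
  have pL := lmul_pairing 𝔄 (N := Om 𝔄)
  have pL2 := lmul_pairing 𝔄 (N := Om2 𝔄)
  have pT := Om2.pairing 𝔄
  have hω := Om.central 𝔄
  -- `(x ⊗ y) g = x ⊗ (y g)`, `(g x) ⊗ y = g (x ⊗ y)`, `(x g) ⊗ y = x ⊗ (g y)`
  have as1 := fun x y g => Om2.rmul_tens 𝔄 x y g
  have as2 := fun g x y => (Om2.lmul_tens 𝔄 x y g).symm
  have as3 := fun x g y => Om2.balanced 𝔄 x y g
  -- the three associativity relations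
  have A : ∑ i, ∑ j, ∑ p, ∑ q, ev3 (bact 𝔄 (Om2 𝔄)) (bact 𝔄 (Gam 𝔄)) (rmul 𝔄 (Om2 𝔄))
      (ev3 (bact 𝔄 (Om 𝔄)) (bact 𝔄 (Om 𝔄)) (Om2.tens 𝔄) (Om.v 𝔄 p) (Om.v 𝔄 q) (𝔄.γ p q i))
        (Gam.a 𝔄 j) (𝔄.η i j l) =
      ∑ i, ∑ j, ev3 (bact 𝔄 (Om 𝔄)) (bact 𝔄 (Om 𝔄)) (Om2.tens 𝔄) (Om.v 𝔄 i)
        (iota11 𝔄 (Om.v 𝔄) j) (𝔄.η i j l) := by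
    simp only [iota11, ev3_sum_right]
    rw [sum4_comm]
    refine Eq.trans ?_ (sum4_comm' _).symm
    refine Finset.sum_congr rfl fun p _ => Finset.sum_congr rfl fun q _ =>
      Finset.sum_congr rfl fun j _ => ?_
    exact ev3_assoc pT pR pT as1 _ _ _ _ (coef_assoc 𝔄.VV 𝔄.VA 𝔄.VA 𝔄.VA p q j l) _ _ _
  have B : ∑ i, ∑ j, ev3 (bact 𝔄 (Om 𝔄)) (bact 𝔄 (Om 𝔄)) (Om2.tens 𝔄)
        (tau11 𝔄 (Om.v 𝔄) i) (Om.v 𝔄 j) (𝔄.σ i j l) =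
      ∑ i, ∑ j, ∑ p, ∑ q, ev3 (bact 𝔄 (Gam 𝔄)) (bact 𝔄 (Om2 𝔄)) (lmul 𝔄 (Om2 𝔄)) (Gam.a 𝔄 i)
      (ev3 (bact 𝔄 (Om 𝔄)) (bact 𝔄 (Om 𝔄)) (Om2.tens 𝔄) (Om.v 𝔄 p) (Om.v 𝔄 q) (𝔄.γ p q j))
        (𝔄.σ i j l) := by
    simp only [tau11, ev3_sum_left]
    rw [sum4_comm]
    refine Eq.trans ?_ (sum4_comm' _).symm
    refine Finset.sum_congr rfl fun p _ => Finset.sum_congr rfl fun q _ =>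
      Finset.sum_congr rfl fun j _ => ?_
    exact ev3_assoc pL pT pL2 as2 _ _ _ _ (coef_assoc 𝔄.AV 𝔄.VV 𝔄.AV 𝔄.AV p q j l) _ _ _
  have C : ∑ i, ∑ j, ev3 (bact 𝔄 (Om 𝔄)) (bact 𝔄 (Om 𝔄)) (Om2.tens 𝔄)
        (iota11 𝔄 (Om.v 𝔄) i) (Om.v 𝔄 j) (𝔄.σ i j l) =
      ∑ i, ∑ j, ev3 (bact 𝔄 (Om 𝔄)) (bact 𝔄 (Om 𝔄)) (Om2.tens 𝔄) (Om.v 𝔄 i)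
        (tau11 𝔄 (Om.v 𝔄) j) (𝔄.η i j l) := by
    simp only [tau11, iota11, ev3_sum_left, ev3_sum_right]
    rw [sum4_comm]
    refine Eq.trans ?_ (sum4_comm' _).symm
    refine Finset.sum_congr rfl fun p _ => Finset.sum_congr rfl fun q _ =>
      Finset.sum_congr rfl fun j _ => ?_
    exact ev3_assoc pR pL pT as3 _ _ _ _ (coef_assoc 𝔄.VA 𝔄.AV 𝔄.AV 𝔄.VA p q j l) _ _ _
  have nest1 : ∀ (x y : Om 𝔄) (u : T2 k 𝔄.R) (c : T3 k 𝔄.R),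
      ev3 (bact 𝔄 (Om 𝔄)) (bact 𝔄 (Om 𝔄)) (Om2.tens 𝔄) (bact 𝔄 (Om 𝔄) u x) y c =
      ev3 (bact 𝔄 (Om 𝔄)) (bact 𝔄 (Om 𝔄)) (Om2.tens 𝔄) x y (i12 k 𝔄.R u * c) := by
    intro x y u c
    induction u using TensorProduct.induction_on with
    | zero => simp [ev3_zero_left]
    | add u v hu hv => simp [ev3_add_left, hu, hv, add_mul]
    | tmul r s =>
      induction c using T3.ind with
      | h0 => simp
      | ha _ _ h1 h2 => simp only [map_add, h1, h2, mul_add]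
      | h p q r => simp [BiAct.mul, mul_comm, -jR_tmul]
  have nest2 : ∀ (x y : Om 𝔄) (u : T2 k 𝔄.R) (c : T3 k 𝔄.R),
      ev3 (bact 𝔄 (Om 𝔄)) (bact 𝔄 (Om 𝔄)) (Om2.tens 𝔄) x (bact 𝔄 (Om 𝔄) u y) c =
      ev3 (bact 𝔄 (Om 𝔄)) (bact 𝔄 (Om 𝔄)) (Om2.tens 𝔄) x y (i23 k 𝔄.R u * c) := by
    intro x y u c
    induction c using T3.ind with
    | h0 => simp
    | ha _ _ h1 h2 => simp only [map_add, h1, h2, mul_add]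
    | h p q r =>
      have e1 : (p ⊗ₜ (q ⊗ₜ r) : T3 k 𝔄.R) = i12 k 𝔄.R (p ⊗ₜ q) * i23 k 𝔄.R (1 ⊗ₜ r) := by simp
      rw [ev3_tmul, ← Module.End.mul_apply, ← map_mul, ev3_mul pT, e1, map_mul (i23 k 𝔄.R)]
      congr 1
      ring
  have D : ∑ i, bact 𝔄 (Om2 𝔄) (𝔄.ζ i l) (∑ p, ∑ q,
      ev3 (bact 𝔄 (Om 𝔄)) (bact 𝔄 (Om 𝔄)) (Om2.tens 𝔄) (Om.v 𝔄 p) (Om.v 𝔄 q) (𝔄.γ p q i)) =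
      ∑ i, ∑ j, ev3 (bact 𝔄 (Om 𝔄)) (bact 𝔄 (Om 𝔄)) (Om2.tens 𝔄)
        (del1 𝔄 (Om.v 𝔄) i) (Om.v 𝔄 j) (𝔄.σ i j l) +
      ∑ i, ∑ j, ev3 (bact 𝔄 (Om 𝔄)) (bact 𝔄 (Om 𝔄)) (Om2.tens 𝔄) (Om.v 𝔄 i)
        (del1 𝔄 (Om.v 𝔄) j) (𝔄.η i j l) := by
    have d1 : ∑ i, ∑ j, ev3 (bact 𝔄 (Om 𝔄)) (bact 𝔄 (Om 𝔄)) (Om2.tens 𝔄)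
        (del1 𝔄 (Om.v 𝔄) i) (Om.v 𝔄 j) (𝔄.σ i j l) = ∑ p, ∑ q, ∑ i,
        ev3 (bact 𝔄 (Om 𝔄)) (bact 𝔄 (Om 𝔄)) (Om2.tens 𝔄) (Om.v 𝔄 p) (Om.v 𝔄 q)
          (i12 k 𝔄.R (𝔄.ζ p i) * 𝔄.σ i q l) := by
      simp only [del1, ev3_sum_left, nest1]
      rw [Finset.sum_comm, Finset.sum_congr rfl fun j _ => Finset.sum_comm, Finset.sum_comm]
    have d2 : ∑ i, ∑ j, ev3 (bact 𝔄 (Om 𝔄)) (bact 𝔄 (Om 𝔄)) (Om2.tens 𝔄) (Om.v 𝔄 i)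
        (del1 𝔄 (Om.v 𝔄) j) (𝔄.η i j l) = ∑ p, ∑ q, ∑ i,
        ev3 (bact 𝔄 (Om 𝔄)) (bact 𝔄 (Om 𝔄)) (Om2.tens 𝔄) (Om.v 𝔄 p) (Om.v 𝔄 q)
          (i23 k 𝔄.R (𝔄.ζ q i) * 𝔄.η p i l) := by
      simp only [del1, ev3_sum_right, nest2]
      exact Finset.sum_congr rfl fun i _ => Finset.sum_comm
    rw [d1, d2]
    simp only [← map_sum, ← Finset.sum_add_distrib, ← map_add, ← 𝔄.zeta_leibniz]
    simp only [map_sum, ev3_outer pT]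
    rw [Finset.sum_comm]
    refine Finset.sum_congr rfl fun p _ => ?_
    rw [Finset.sum_comm]
    refine Finset.sum_congr rfl fun q _ => Finset.sum_congr rfl fun i _ => ?_
    rw [mul_comm]
  -- the terms with `ω`
  have w1 : ∀ i j, ev3 (bact 𝔄 (Om2 𝔄)) (bact 𝔄 (Gam 𝔄)) (rmul 𝔄 (Om2 𝔄))
      (Om2.tens 𝔄 (Om.ω 𝔄) (Om.v 𝔄 i)) (Gam.a 𝔄 j) (𝔄.η i j l) = Om2.tens 𝔄 (Om.ω 𝔄)
        (ev3 (bact 𝔄 (Om 𝔄)) (bact 𝔄 (Gam 𝔄)) (rmul 𝔄 (Om 𝔄)) (Om.v 𝔄 i) (Gam.a 𝔄 j)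
          (𝔄.η i j l)) := fun i j => ev3_central_left pT as1 hω _ _ _ pR pT
  have w2 : ∀ i j, ev3 (bact 𝔄 (Om2 𝔄)) (bact 𝔄 (Gam 𝔄)) (rmul 𝔄 (Om2 𝔄))
      (Om2.tens 𝔄 (Om.v 𝔄 i) (Om.ω 𝔄)) (Gam.a 𝔄 j) (𝔄.η i j l) =
        ev3 (bact 𝔄 (Om 𝔄)) (bact 𝔄 (Om 𝔄)) (Om2.tens 𝔄) (Om.v 𝔄 i)
          (rmul 𝔄 (Om 𝔄) (Om.ω 𝔄) (Gam.a 𝔄 j)) (𝔄.η i j l) :=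
    fun i j => ev3_central_mid pT as1 _ hω _ _ pR
  have w3 : ∀ i j, ev3 (bact 𝔄 (Gam 𝔄)) (bact 𝔄 (Om2 𝔄)) (lmul 𝔄 (Om2 𝔄)) (Gam.a 𝔄 i)
      (Om2.tens 𝔄 (Om.ω 𝔄) (Om.v 𝔄 j)) (𝔄.σ i j l) =
        ev3 (bact 𝔄 (Om 𝔄)) (bact 𝔄 (Om 𝔄)) (Om2.tens 𝔄)
          (lmul 𝔄 (Om 𝔄) (Gam.a 𝔄 i) (Om.ω 𝔄)) (Om.v 𝔄 j) (𝔄.σ i j l) :=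
    fun i j => (ev3_central_mid pL as2 _ hω _ _ pT).symm
  have w4 : ∀ i j, ev3 (bact 𝔄 (Gam 𝔄)) (bact 𝔄 (Om2 𝔄)) (lmul 𝔄 (Om2 𝔄)) (Gam.a 𝔄 i)
      (Om2.tens 𝔄 (Om.v 𝔄 j) (Om.ω 𝔄)) (𝔄.σ i j l) = Om2.tens 𝔄
        (ev3 (bact 𝔄 (Gam 𝔄)) (bact 𝔄 (Om 𝔄)) (lmul 𝔄 (Om 𝔄)) (Gam.a 𝔄 i) (Om.v 𝔄 j)
          (𝔄.σ i j l)) (Om.ω 𝔄) := fun i j => (ev3_central_right as2 _ _ hω _ pT).symm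
  have w5 : Om2.tens 𝔄 (iota11 𝔄 (Om.v 𝔄) l) (Om.ω 𝔄) =
      ∑ i, ∑ j, ev3 (bact 𝔄 (Om 𝔄)) (bact 𝔄 (Om 𝔄)) (Om2.tens 𝔄) (Om.v 𝔄 i)
          (lmul 𝔄 (Om 𝔄) (Gam.a 𝔄 j) (Om.ω 𝔄)) (𝔄.η i j l) := by
    simp only [iota11, map_sum, LinearMap.sum_apply]
    exact Finset.sum_congr rfl fun i _ => Finset.sum_congr rfl fun j _ =>
      ev3_central_right as3 _ _ hω _ pL
  have w6 : Om2.tens 𝔄 (Om.ω 𝔄) (tau11 𝔄 (Om.v 𝔄) l) =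
      ∑ i, ∑ j, ev3 (bact 𝔄 (Om 𝔄)) (bact 𝔄 (Om 𝔄)) (Om2.tens 𝔄)
          (rmul 𝔄 (Om 𝔄) (Om.ω 𝔄) (Gam.a 𝔄 i)) (Om.v 𝔄 j) (𝔄.σ i j l) := by
    simp only [tau11, map_sum]
    exact Finset.sum_congr rfl fun i _ => Finset.sum_congr rfl fun j _ =>
      (ev3_central_left pR as3 hω _ _ _ pL pT).symm
  have I2 : iota11 𝔄 (muv 𝔄) l = Om2.tens 𝔄 (Om.ω 𝔄) (iota11 𝔄 (Om.v 𝔄) l) +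
      ∑ i, ∑ j, ev3 (bact 𝔄 (Om 𝔄)) (bact 𝔄 (Om 𝔄)) (Om2.tens 𝔄) (Om.v 𝔄 i)
          (rmul 𝔄 (Om 𝔄) (Om.ω 𝔄) (Gam.a 𝔄 j)) (𝔄.η i j l) +
      ∑ i, ∑ j, ev3 (bact 𝔄 (Om 𝔄)) (bact 𝔄 (Om 𝔄)) (Om2.tens 𝔄) (Om.v 𝔄 i)
        (iota11 𝔄 (Om.v 𝔄) j) (𝔄.η i j l) := by
    rw [← A]
    simp only [iota11, muv, compv, ev3_add_left, ev3_sum_left, Finset.sum_add_distrib, w1, w2,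
      map_sum]
  have T2' : tau11 𝔄 (muv 𝔄) l = ∑ i, ∑ j, ev3 (bact 𝔄 (Om 𝔄)) (bact 𝔄 (Om 𝔄)) (Om2.tens 𝔄)
          (lmul 𝔄 (Om 𝔄) (Gam.a 𝔄 i) (Om.ω 𝔄)) (Om.v 𝔄 j) (𝔄.σ i j l) +
      Om2.tens 𝔄 (tau11 𝔄 (Om.v 𝔄) l) (Om.ω 𝔄) +
      ∑ i, ∑ j, ev3 (bact 𝔄 (Om 𝔄)) (bact 𝔄 (Om 𝔄)) (Om2.tens 𝔄)
        (tau11 𝔄 (Om.v 𝔄) i) (Om.v 𝔄 j) (𝔄.σ i j l) := by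
    rw [B]
    simp only [tau11, muv, compv, ev3_add_right, ev3_sum_right, Finset.sum_add_distrib, w3, w4,
      map_sum, LinearMap.sum_apply]
  have D2 : del1 𝔄 (muv 𝔄) l = Om2.tens 𝔄 (Om.ω 𝔄) (del1 𝔄 (Om.v 𝔄) l) +
      Om2.tens 𝔄 (del1 𝔄 (Om.v 𝔄) l) (Om.ω 𝔄) + (∑ i, ∑ j,
        ev3 (bact 𝔄 (Om 𝔄)) (bact 𝔄 (Om 𝔄)) (Om2.tens 𝔄)
        (del1 𝔄 (Om.v 𝔄) i) (Om.v 𝔄 j) (𝔄.σ i j l) +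
      ∑ i, ∑ j, ev3 (bact 𝔄 (Om 𝔄)) (bact 𝔄 (Om 𝔄)) (Om2.tens 𝔄) (Om.v 𝔄 i)
        (del1 𝔄 (Om.v 𝔄) j) (𝔄.η i j l)) := by
    rw [← D]
    simp only [del1, muv, compv, map_add, Finset.sum_add_distrib, map_sum, LinearMap.sum_apply,
      bi_central_left pT hω, bi_central_right pT _ hω]
  have key : Om2.tens 𝔄 (Om.ω 𝔄) (rmul 𝔄 (Om 𝔄) (Om.ω 𝔄) (Gam.a 𝔄 l)) -
      Om2.tens 𝔄 (lmul 𝔄 (Om 𝔄) (Gam.a 𝔄 l) (Om.ω 𝔄)) (Om.ω 𝔄) =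
      - (Om2.tens 𝔄 (Om.ω 𝔄) (iota11 𝔄 (Om.v 𝔄) l - tau11 𝔄 (Om.v 𝔄) l + del1 𝔄 (Om.v 𝔄) l) +
      Om2.tens 𝔄 (iota11 𝔄 (Om.v 𝔄) l - tau11 𝔄 (Om.v 𝔄) l + del1 𝔄 (Om.v 𝔄) l) (Om.ω 𝔄)) := by
    have e := Om2.balanced 𝔄 (Om.ω 𝔄) (Om.ω 𝔄) (Gam.a 𝔄 l)
    rw [omega_a, map_sub, LinearMap.sub_apply] at e
    rw [omega_a, map_sub, ← e]
    abel
  have hs : ∀ x y c, ev3 (bact 𝔄 (Om 𝔄)) (bact 𝔄 (Om 𝔄)) (Om2.tens 𝔄) x y c =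
      ev3ₗ (bact 𝔄 (Om 𝔄)) (bact 𝔄 (Om 𝔄)) (Om2.tens 𝔄) c x y := fun _ _ _ => rfl
  have r1 : ∑ i, ∑ j, ev3 (bact 𝔄 (Om 𝔄)) (bact 𝔄 (Om 𝔄)) (Om2.tens 𝔄) (Om.v 𝔄 i)
          (rmul 𝔄 (Om 𝔄) (Om.ω 𝔄) (Gam.a 𝔄 j)) (𝔄.η i j l) =
      Om2.tens 𝔄 (iota11 𝔄 (Om.v 𝔄) l) (Om.ω 𝔄) -
      (∑ i, ∑ j, ev3 (bact 𝔄 (Om 𝔄)) (bact 𝔄 (Om 𝔄)) (Om2.tens 𝔄) (Om.v 𝔄 i)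
        (iota11 𝔄 (Om.v 𝔄) j) (𝔄.η i j l) -
       ∑ i, ∑ j, ev3 (bact 𝔄 (Om 𝔄)) (bact 𝔄 (Om 𝔄)) (Om2.tens 𝔄) (Om.v 𝔄 i)
        (tau11 𝔄 (Om.v 𝔄) j) (𝔄.η i j l) +
       ∑ i, ∑ j, ev3 (bact 𝔄 (Om 𝔄)) (bact 𝔄 (Om 𝔄)) (Om2.tens 𝔄) (Om.v 𝔄 i)
        (del1 𝔄 (Om.v 𝔄) j) (𝔄.η i j l)) := by
    rw [w5]
    simp only [omega_a, hs, map_sub, map_add, Finset.sum_sub_distrib, Finset.sum_add_distrib]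
  have r2 : ∑ i, ∑ j, ev3 (bact 𝔄 (Om 𝔄)) (bact 𝔄 (Om 𝔄)) (Om2.tens 𝔄)
          (lmul 𝔄 (Om 𝔄) (Gam.a 𝔄 i) (Om.ω 𝔄)) (Om.v 𝔄 j) (𝔄.σ i j l) =
      Om2.tens 𝔄 (Om.ω 𝔄) (tau11 𝔄 (Om.v 𝔄) l) +
      (∑ i, ∑ j, ev3 (bact 𝔄 (Om 𝔄)) (bact 𝔄 (Om 𝔄)) (Om2.tens 𝔄)
        (iota11 𝔄 (Om.v 𝔄) i) (Om.v 𝔄 j) (𝔄.σ i j l) -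
       ∑ i, ∑ j, ev3 (bact 𝔄 (Om 𝔄)) (bact 𝔄 (Om 𝔄)) (Om2.tens 𝔄)
        (tau11 𝔄 (Om.v 𝔄) i) (Om.v 𝔄 j) (𝔄.σ i j l) +
       ∑ i, ∑ j, ev3 (bact 𝔄 (Om 𝔄)) (bact 𝔄 (Om 𝔄)) (Om2.tens 𝔄)
        (del1 𝔄 (Om.v 𝔄) i) (Om.v 𝔄 j) (𝔄.σ i j l)) := by
    rw [w6]
    simp only [omega_a, hs, map_sub, map_add, Finset.sum_sub_distrib, Finset.sum_add_distrib,
      LinearMap.sub_apply, LinearMap.add_apply]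
    abel
  rw [kap, Om2.rmul_tens, Om2.lmul_tens, I2, T2', D2, r1, r2, C]
  rw [sub_eq_iff_eq_add] at key
  rw [key]
  simp only [map_add, map_sub, LinearMap.sub_apply, LinearMap.add_apply]
  abel

/-- The comultiplication `μ : Ω → Ω ⊗_Γ Ω`, `ω ↦ ω ⊗ ω`,
`v_l ↦ ω ⊗ v_l + v_l ⊗ ω + ∑_{i,j} γ_{ijl} ⊗_{R^{⊗3}} (v_i ⊗ v_j)`. -/
noncomputable def Om.μ : Om 𝔄 →ₗ[Ge 𝔄] Om2 𝔄 :=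
  Om.lift 𝔄 (Om2.tens 𝔄 (Om.ω 𝔄) (Om.ω 𝔄)) (muv 𝔄) (omega_central2 𝔄) (muv_cut 𝔄) (coideal 𝔄)

end Coalgebra

section RepB

variable {k : Type u} [Field k] (𝔄 : MatrixBimoduleProblem k)

open MulOpposite

/-- A representation of the bocs `𝔅 = (Γ, Ω)`: a finite-dimensional right `Γ`-module. -/
structure RepB where
  carrier : Type u
  [grp : AddCommGroup carrier]
  [mod : Module k carrier]
  [fd : FiniteDimensional k carrier]
  act : (Gam 𝔄)ᵐᵒᵖ →ₐ[k] Module.End k carrier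

attribute [instance] RepB.grp RepB.mod RepB.fd

variable {𝔄}

lemma Om2.hom_ext {N : Type*} [AddCommGroup N] [Module k N] {f g : Om2 𝔄 →ₗ[k] N}
    (h : ∀ x y, f (Om2.tens 𝔄 x y) = g (Om2.tens 𝔄 x y)) (w : Om2 𝔄) : f w = g w := by
  obtain ⟨z, rfl⟩ := (om2Rel 𝔄).mkQ_surjective w
  have : (f ∘ₗ (Om2.proj 𝔄).restrictScalars k : Om 𝔄 ⊗[k] Om 𝔄 →ₗ[k] N) =
      (g ∘ₗ (Om2.proj 𝔄).restrictScalars k : Om 𝔄 ⊗[k] Om 𝔄 →ₗ[k] N) :=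
    TensorProduct.ext' h
  exact DFunLike.congr_fun this z

lemma Om.ε_ω : Om.ε 𝔄 (Om.ω 𝔄) = 1 := Om.lift_ω 𝔄 ..
lemma Om.ε_v (j : Fin 𝔄.m) : Om.ε 𝔄 (Om.v 𝔄 j) = 0 := Om.lift_v 𝔄 ..
lemma Om.μ_ω : Om.μ 𝔄 (Om.ω 𝔄) = Om2.tens 𝔄 (Om.ω 𝔄) (Om.ω 𝔄) := Om.lift_ω 𝔄 ..
lemma Om.μ_v (j : Fin 𝔄.m) : Om.μ 𝔄 (Om.v 𝔄 j) = muv 𝔄 j := Om.lift_v 𝔄 ..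

namespace RepB

/-- `p ↦ p g`, `g ∈ Γ`. -/
noncomputable def mul (P : RepB 𝔄) (g : Gam 𝔄) : P.carrier →ₗ[k] P.carrier := P.act (op g)

lemma mul_mul (P : RepB 𝔄) (g h : Gam 𝔄) (p : P.carrier) :
    P.mul (g * h) p = P.mul h (P.mul g p) := by
  rw [mul, op_mul, map_mul]; rfl

lemma mul_one' (P : RepB 𝔄) (p : P.carrier) : P.mul 1 p = p := by
  rw [mul, op_one, map_one]; rfl

/-- Morphisms `P → Q` of `R(𝔅)`: right `Γ`-linear maps `P ⊗_Γ Ω → Q`, given as `Γ`-balanced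
`k`-bilinear maps `F : P × Ω → Q` with `F(p, x g) = F(p, x) g`. -/
noncomputable def homs (P Q : RepB 𝔄) : Submodule k (P.carrier →ₗ[k] Om 𝔄 →ₗ[k] Q.carrier) where
  carrier := {F | (∀ p g x, F (P.mul g p) x = F p (lmul 𝔄 (Om 𝔄) g x)) ∧
    ∀ p x g, F p (rmul 𝔄 (Om 𝔄) x g) = Q.mul g (F p x)}
  add_mem' := by
    rintro F G ⟨h1, h2⟩ ⟨h1', h2'⟩
    exact ⟨fun p g x => by simp [h1, h1'], fun p x g => by simp [h2, h2']⟩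
  zero_mem' := ⟨fun p g x => by simp, fun p x g => by simp⟩
  smul_mem' := by
    rintro c F ⟨h1, h2⟩
    exact ⟨fun p g x => by simp [h1], fun p x g => by simp [h2]⟩

/-- The identity `p ⊗ x ↦ p ε(x)`. -/
noncomputable def idB (P : RepB 𝔄) : P.carrier →ₗ[k] Om 𝔄 →ₗ[k] P.carrier :=
  (P.act.toLinearMap ∘ₗ (opLinearEquiv k : Gam 𝔄 ≃ₗ[k] _).toLinearMap ∘ₗ
    (Om.ε 𝔄).restrictScalars k).flip

lemma idB_apply (P : RepB 𝔄) (p : P.carrier) (x : Om 𝔄) : P.idB p x = P.mul (Om.ε 𝔄 x) p := rfl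

lemma idB_mem (P : RepB 𝔄) : P.idB ∈ homs P P := by
  refine ⟨fun p g x => ?_, fun p x g => ?_⟩
  · rw [idB_apply, idB_apply, map_lmul, lmul_apply, Gam.tmul_smul, mul_one, mul_mul]
  · rw [idB_apply, idB_apply, map_rmul, rmul_apply, Gam.tmul_smul, one_mul, mul_mul]

section Comp

variable {P Q S : RepB 𝔄} {F : P.carrier →ₗ[k] Om 𝔄 →ₗ[k] Q.carrier}
  {G : Q.carrier →ₗ[k] Om 𝔄 →ₗ[k] S.carrier}

lemma comp_bal (hF : F ∈ homs P Q) (hG : G ∈ homs Q S) (p : P.carrier) (x y : Om 𝔄) (g : Gam 𝔄) :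
    (G ∘ₗ F p) (rmul 𝔄 (Om 𝔄) x g) y = (G ∘ₗ F p) x (lmul 𝔄 (Om 𝔄) g y) := by
  simp only [LinearMap.comp_apply, hF.2, hG.1]

/-- The composite `P ⊗ Ω → P ⊗ Ω ⊗ Ω → Q ⊗ Ω → S` of `1 ⊗ μ`, `F ⊗ 1` and `G`. -/
noncomputable def compB (hF : F ∈ homs P Q) (hG : G ∈ homs Q S) :
    P.carrier →ₗ[k] Om 𝔄 →ₗ[k] S.carrier :=
  LinearMap.mk₂ k (fun p x => Om2.lift 𝔄 (G ∘ₗ F p) (comp_bal hF hG p) (Om.μ 𝔄 x))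
    (fun p p' x => Om2.hom_ext (f := Om2.lift 𝔄 (G ∘ₗ F (p + p')) (comp_bal hF hG _))
      (g := Om2.lift 𝔄 (G ∘ₗ F p) (comp_bal hF hG _) + Om2.lift 𝔄 (G ∘ₗ F p') (comp_bal hF hG _))
      (fun x y => by simp) _)
    (fun c p x => Om2.hom_ext (f := Om2.lift 𝔄 (G ∘ₗ F (c • p)) (comp_bal hF hG _))
      (g := c • Om2.lift 𝔄 (G ∘ₗ F p) (comp_bal hF hG _)) (fun x y => by simp) _)
    (fun p x y => by simp only [map_add])
    (fun c p x => by rw [map_kscal, map_smul])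

lemma compB_apply (hF : F ∈ homs P Q) (hG : G ∈ homs Q S) (p : P.carrier) (x : Om 𝔄) :
    compB hF hG p x = Om2.lift 𝔄 (G ∘ₗ F p) (comp_bal hF hG p) (Om.μ 𝔄 x) := rfl

lemma compB_mem (hF : F ∈ homs P Q) (hG : G ∈ homs Q S) : compB hF hG ∈ homs P S := by
  refine ⟨fun p g x => ?_, fun p x g => ?_⟩
  · rw [compB_apply, compB_apply, map_lmul]
    exact Om2.hom_ext (f := Om2.lift 𝔄 (G ∘ₗ F (P.mul g p)) (comp_bal hF hG _))
      (g := Om2.lift 𝔄 (G ∘ₗ F p) (comp_bal hF hG _) ∘ₗ lmul 𝔄 (Om2 𝔄) g)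
      (fun x y => by simp [Om2.lmul_tens, hF.1]) _
  · rw [compB_apply, compB_apply, map_rmul]
    exact Om2.hom_ext (f := Om2.lift 𝔄 (G ∘ₗ F p) (comp_bal hF hG _) ∘ₗ (rmul 𝔄 (Om2 𝔄)).flip g)
      (g := S.mul g ∘ₗ Om2.lift 𝔄 (G ∘ₗ F p) (comp_bal hF hG _))
      (fun x y => by simp [Om2.rmul_tens, hG.2]) _

end Comp

section Components

/-- The action of `R` on maps `P → Q`: `(r f s)(p) = f(p r) s`. -/
noncomputable def homL (P Q : RepB 𝔄) : 𝔄.R →ₐ[k] Module.End k (P.carrier →ₗ[k] Q.carrier) :=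
  AlgHom.ofLinearMap
    (LinearMap.mk₂ k (fun r f => f ∘ₗ P.act (op (Gam.inc 𝔄 r)))
      (by intros; ext; simp) (by intros; ext; simp) (by intros; ext; simp) (by intros; ext; simp))
    (by ext; simp)
    (by
      intro r s; ext f p
      change f (P.mul (Gam.inc 𝔄 (r * s)) p) =
        f (P.mul (Gam.inc 𝔄 s) (P.mul (Gam.inc 𝔄 r) p))
      rw [map_mul, mul_mul])
noncomputable def homR (P Q : RepB 𝔄) : 𝔄.R →ₐ[k] Module.End k (P.carrier →ₗ[k] Q.carrier) :=
  AlgHom.ofLinearMap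
    (LinearMap.mk₂ k (fun s f => Q.act (op (Gam.inc 𝔄 s)) ∘ₗ f)
      (by intros; ext; simp) (by intros; ext; simp) (by intros; ext; simp) (by intros; ext; simp))
    (by ext; simp)
    (by
      intro r s; ext f p
      change Q.mul (Gam.inc 𝔄 (r * s)) (f p) =
        Q.mul (Gam.inc 𝔄 r) (Q.mul (Gam.inc 𝔄 s) (f p))
      rw [mul_comm, map_mul, mul_mul])

lemma homL_homR (P Q : RepB 𝔄) (r s : 𝔄.R) : Commute (homL P Q r) (homR P Q s) := rfl

/-- The `R`-`R`-bimodule `Hom_k(P, Q)`. -/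
noncomputable def homBim (P Q : RepB 𝔄) : BiAct k 𝔄.R (P.carrier →ₗ[k] Q.carrier) :=
  Algebra.TensorProduct.lift (homL P Q) (homR P Q) (homL_homR P Q)

lemma homBim_tmul (P Q : RepB 𝔄) (r s : 𝔄.R) (f : P.carrier →ₗ[k] Q.carrier) (p : P.carrier) :
    homBim P Q (r ⊗ₜ s) f p = Q.mul (Gam.inc 𝔄 s) (f (P.mul (Gam.inc 𝔄 r) p)) := by
  rw [homBim, Algebra.TensorProduct.lift_tmul]; rfl

/-- `(f, g) ↦ g ∘ f`. -/
def homMul (P Q S : RepB 𝔄) : (P.carrier →ₗ[k] Q.carrier) →ₗ[k] (Q.carrier →ₗ[k] S.carrier) →ₗ[k]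
    (P.carrier →ₗ[k] S.carrier) :=
  LinearMap.mk₂ k (fun f g => g ∘ₗ f) (by intros; ext; simp) (by intros; ext; simp)
    (by intros; ext; simp) (by intros; ext; simp)

@[simp] lemma homMul_apply (P Q S : RepB 𝔄) (f : P.carrier →ₗ[k] Q.carrier)
    (g : Q.carrier →ₗ[k] S.carrier) : homMul P Q S f g = g ∘ₗ f := rfl

lemma homMul_pairing (P Q S : RepB 𝔄) :
    IsPairing (homBim P Q) (homBim Q S) (homBim P S) (homMul P Q S) where
  outer r t f g := by ext p; simp [homBim_tmul, mul_one']
  inner s f g := by ext p; simp [homBim_tmul, mul_one']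

variable {P Q S : RepB 𝔄} {F F' : P.carrier →ₗ[k] Om 𝔄 →ₗ[k] Q.carrier}
  {G : Q.carrier →ₗ[k] Om 𝔄 →ₗ[k] S.carrier}

lemma hom_t (hF : F ∈ homs P Q) (p : P.carrier) (a b : Gam 𝔄) (x : Om 𝔄) :
    F p (Ge.t 𝔄 a b • x) = Q.mul b (F (P.mul a p) x) := by
  rw [hF.1, ← hF.2, rmul_apply, lmul_apply, smul_smul, Ge.t_mul, one_mul, one_mul]

lemma hom_central (hF : F ∈ homs P Q) : Central (homBim P Q) (F.flip (Om.ω 𝔄)) := by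
  intro r
  ext p
  rw [homBim_tmul, homBim_tmul, map_one, mul_one', mul_one', LinearMap.flip_apply,
    LinearMap.flip_apply, hF.1, ← hF.2]
  have := Om.central 𝔄 r
  rw [bact_apply, bact_apply, jR_tmul, jR_tmul, map_one] at this
  rw [lmul_apply, rmul_apply, this]

lemma hom_ext (hF : F ∈ homs P Q) (hF' : F' ∈ homs P Q)
    (hω : F.flip (Om.ω 𝔄) = F'.flip (Om.ω 𝔄)) (hv : ∀ j, F.flip (Om.v 𝔄 j) = F'.flip (Om.v 𝔄 j)) :
    F = F' := by
  ext p x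
  induction x using Om.ind generalizing p with
  | h0 => simp
  | hadd x y h1 h2 => rw [map_add, map_add, h1, h2]
  | hω => exact DFunLike.congr_fun hω p
  | hv j => exact DFunLike.congr_fun (hv j) p
  | hs a b x h => rw [hom_t hF, hom_t hF', h]

lemma idB_ω (P : RepB 𝔄) : P.idB.flip (Om.ω 𝔄) = LinearMap.id := by
  ext p
  rw [LinearMap.flip_apply, idB_apply, Om.ε_ω, mul_one']; rfl

lemma idB_v (P : RepB 𝔄) (j : Fin 𝔄.m) : P.idB.flip (Om.v 𝔄 j) = 0 := by
  ext p
  rw [LinearMap.flip_apply, idB_apply, Om.ε_v, mul, op_zero, map_zero]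

lemma compB_ω (hF : F ∈ homs P Q) (hG : G ∈ homs Q S) : (compB hF hG).flip (Om.ω 𝔄) =
    homMul P Q S (F.flip (Om.ω 𝔄)) (G.flip (Om.ω 𝔄)) := by
  ext p
  rw [LinearMap.flip_apply, compB_apply, Om.μ_ω, Om2.lift_tens]; rfl

lemma compB_v (hF : F ∈ homs P Q) (hG : G ∈ homs Q S) (l : Fin 𝔄.m) :
    (compB hF hG).flip (Om.v 𝔄 l) = compv 𝔄 (homBim P Q) (homBim Q S) (homMul P Q S)
      (F.flip (Om.ω 𝔄)) (fun j => F.flip (Om.v 𝔄 j)) (G.flip (Om.ω 𝔄))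
      (fun j => G.flip (Om.v 𝔄 j)) l := by
  ext p
  have h : ∀ x y c, Om2.lift 𝔄 (G ∘ₗ F p) (comp_bal hF hG p)
      (ev3 (bact 𝔄 (Om 𝔄)) (bact 𝔄 (Om 𝔄)) (Om2.tens 𝔄) x y c) =
      ev3 (homBim P Q) (homBim Q S) (homMul P Q S) (F.flip x) (G.flip y) c p := by
    intro x y c
    induction c using T3.ind with
    | h0 => simp
    | ha _ _ h1 h2 => simp only [map_add, LinearMap.add_apply, h1, h2]
    | h a b c =>
      simp only [ev3_tmul, Om2.lift_tens, bact_apply, jR_tmul, homMul_apply, LinearMap.comp_apply,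
        homBim_tmul, hom_t hF, hom_t hG, map_one, mul_one', LinearMap.flip_apply]
  rw [LinearMap.flip_apply, compB_apply, Om.μ_v]
  simp only [muv, compv, map_add, map_sum, h, LinearMap.add_apply, LinearMap.sum_apply,
    Om2.lift_tens]
  rfl

end Components

/-- The representation category `R(𝔅)` of the bocs `𝔅 = (Γ, Ω)`. -/
noncomputable instance category : Category (RepB 𝔄) where
  Hom P Q := homs P Q
  id P := ⟨P.idB, P.idB_mem⟩
  comp f g := ⟨compB f.2 g.2, compB_mem f.2 g.2⟩
  id_comp {P Q} f := by
    apply Subtype.ext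
    refine hom_ext (compB_mem P.idB_mem f.2) f.2 ?_ fun l => ?_
    · rw [compB_ω, idB_ω]; rfl
    · rw [compB_v]
      simp only [idB_ω, idB_v, compv, ev3_zero_left, homMul_apply, LinearMap.comp_zero,
        Finset.sum_const_zero, add_zero, LinearMap.comp_id]
  comp_id {P Q} f := by
    apply Subtype.ext
    refine hom_ext (compB_mem f.2 Q.idB_mem) f.2 ?_ fun l => ?_
    · rw [compB_ω, idB_ω]; rfl
    · rw [compB_v]
      simp only [idB_ω, idB_v, compv, ev3_zero_right, homMul_apply, LinearMap.zero_comp,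
        Finset.sum_const_zero, add_zero, zero_add, LinearMap.id_comp]
  assoc {P Q S T} f g h := by
    apply Subtype.ext
    refine hom_ext (compB_mem (compB_mem f.2 g.2) h.2) (compB_mem f.2 (compB_mem g.2 h.2)) ?_
      fun l => ?_
    · simp only [compB_ω]; rfl
    · simp only [compB_v, compB_ω]
      exact compv_assoc 𝔄 (homMul_pairing P Q S) (homMul_pairing Q S T) (homMul_pairing P Q T)
        (fun _ _ _ => rfl) (hom_central f.2) (hom_central g.2) (hom_central h.2) _ _ _ l

noncomputable instance : Preadditive (RepB 𝔄) where
  homGroup P Q := inferInstanceAs (AddCommGroup (homs P Q))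
  add_comp P Q S f f' g := Subtype.ext <| LinearMap.ext₂ fun p x =>
    Om2.hom_ext (f := Om2.lift 𝔄 (g.1 ∘ₗ (f.1 + f'.1) p) (comp_bal ((homs P Q).add_mem f.2 f'.2) g.2 _))
      (g := Om2.lift 𝔄 (g.1 ∘ₗ f.1 p) (comp_bal f.2 g.2 _) +
        Om2.lift 𝔄 (g.1 ∘ₗ f'.1 p) (comp_bal f'.2 g.2 _)) (fun x y => by simp) _
  comp_add P Q S f g g' := Subtype.ext <| LinearMap.ext₂ fun p x =>
    Om2.hom_ext (f := Om2.lift 𝔄 ((g.1 + g'.1) ∘ₗ f.1 p) (comp_bal f.2 ((homs Q S).add_mem g.2 g'.2) _))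
      (g := Om2.lift 𝔄 (g.1 ∘ₗ f.1 p) (comp_bal f.2 g.2 _) +
        Om2.lift 𝔄 (g'.1 ∘ₗ f.1 p) (comp_bal f.2 g'.2 _)) (fun x y => by simp) _

noncomputable instance : Linear k (RepB 𝔄) where
  homModule P Q := inferInstanceAs (Module k (homs P Q))
  smul_comp P Q S c f g := Subtype.ext <| LinearMap.ext₂ fun p x =>
    Om2.hom_ext (f := Om2.lift 𝔄 (g.1 ∘ₗ (c • f.1) p) (comp_bal ((homs P Q).smul_mem c f.2) g.2 _))
      (g := c • Om2.lift 𝔄 (g.1 ∘ₗ f.1 p) (comp_bal f.2 g.2 _)) (fun x y => by simp) _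
  comp_smul P Q S f c g := Subtype.ext <| LinearMap.ext₂ fun p x =>
    Om2.hom_ext (f := Om2.lift 𝔄 ((c • g.1) ∘ₗ f.1 p) (comp_bal f.2 ((homs Q S).smul_mem c g.2) _))
      (g := c • Om2.lift 𝔄 (g.1 ∘ₗ f.1 p) (comp_bal f.2 g.2 _)) (fun x y => by simp) _

end RepB

end RepB

section FormalEquation

variable {k : Type u} [Field k] (𝔄 : MatrixBimoduleProblem k)

/-- The formal product `Θ = ∑_i a_i ∗ A_i` of `(ℳ₁, 𝒩₁)`, with `(p, q)`-entry
`∑_i A_i(p, q) ⊗_{R^{⊗2}} a_i`; then `Θ + H`, with `R` included in `Γ`. -/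
noncomputable def Theta : Matrix (Fin 𝔄.t) (Fin 𝔄.t) (Gam 𝔄) :=
  Matrix.of fun p q => ∑ i, bact 𝔄 (Gam 𝔄) (𝔄.A.mat i p q) (Gam.a 𝔄 i)
noncomputable def ThetaH : Matrix (Fin 𝔄.t) (Fin 𝔄.t) (Gam 𝔄) :=
  Theta 𝔄 + 𝔄.H.map (Gam.inc 𝔄)

variable {N : Type u} [AddCommGroup N] [Module k N] [Module (Ge 𝔄) N] [IsScalarTower k (Ge 𝔄) N]
  (w : N) (v : Fin 𝔄.m → N)

/-- The formal product `Υ = ∑_X e_X ∗ E_X` of `(𝒦₀, 𝒞₀)`: diagonal, with entry `e_X = 1_X ω` at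
the places `(p, p)`, `p ∈ X`. -/
noncomputable def Upsilon : Matrix (Fin 𝔄.t) (Fin 𝔄.t) N :=
  Matrix.diagonal fun p => lmul 𝔄 N (Gam.inc 𝔄 (𝔄.base.e (𝔄.cls p))) w

/-- The formal product `Π = ∑_j v_j ∗ V_j` of `(𝒦₁, 𝒞₁)`, with `(p, q)`-entry
`∑_j V_j(p, q) ⊗_{R^{⊗2}} v_j`. -/
noncomputable def Pi1 : Matrix (Fin 𝔄.t) (Fin 𝔄.t) N :=
  Matrix.of fun p q => ∑ j, bact 𝔄 N (𝔄.V.mat j p q) (v j)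

/-- The two sides `(Θ + H)(Υ + Π)` and `(Υ + Π)(Θ + H)` of the formal equation: products of a
matrix over `Γ` and a matrix over a `Γ`-`Γ`-bimodule. -/
noncomputable def formalL : Matrix (Fin 𝔄.t) (Fin 𝔄.t) N :=
  Matrix.of fun p q => ∑ r, lmul 𝔄 N (ThetaH 𝔄 p r) ((Upsilon 𝔄 w + Pi1 𝔄 v) r q)
noncomputable def formalR : Matrix (Fin 𝔄.t) (Fin 𝔄.t) N :=
  Matrix.of fun p q => ∑ r, rmul 𝔄 N ((Upsilon 𝔄 w + Pi1 𝔄 v) p r) (ThetaH 𝔄 r q)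

end FormalEquation

end MBP

namespace MBP

/-! ### The formal equation in an arbitrary `Γ`-`Γ`-bimodule -/

section FormalEquationProof

variable {k : Type u} [Field k] (𝔄 : MatrixBimoduleProblem k)

/-! Both parts rest on one identity. Let `N` be any `Γ`-`Γ`-bimodule with an element `w` that
commutes with `R` and elements `v_j`, and write the formal equation with `w` in place of `ω`. The
products `V A`, `A V` and the commutators `V H - H V` expand in the matrices `A_l` with exactly the
structure constants that define `ι₁₁`, `τ₁₁` and `∂₁`. Hence the difference of the two sides is `∑_l
A_l ⊗ kap(a_l)`, where `kap(a_l)` is the relation that defines `Ω` as a quotient of `Ξ`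
(`formalR_sub_formalL`). Since the `A_l` are normalized, the leading position of `A_l` sees
`kap(a_l)` alone, and so the formal equation holds in `N` if and only if every `kap(a_l)` vanishes
(`formalL_eq_formalR_iff`). The choices `N = Ξ` and `N = Ω` give part 1.

For part 2 take `N = Hom_k(P, Q)`. By adjunction a morphism `P → Q` of `R(𝔅)` is a bimodule map `Ω →
Hom_k(P, Q)`, that is, a choice of images of `ω` and the `v_j` that satisfies the relations of `Ξ`
and annihilates `kap`. If `P` and `Q` are modules of row vectors, this bimodule is a space of
matrices, and the formal equation evaluated in it is `P̄ f̄ = f̄ Q̄` (`bar_mul_barHom`,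
`barHom_mul_bar`). So a morphism of `R(𝔄)` and a morphism of `R(𝔅)` are the same data
(`bar_comm_iff_kap`). The two composition laws agree because both are the expression `compv` in the
constants `γ` (`toHom_compv`, `RepB.compB_v`). This makes `functorB` fully faithful and `k`-linear.

For essential surjectivity, a finite-dimensional `Γ`-module is the direct sum of its components `P
1_X`, and each is a module over `R_X`. As `k` is algebraically closed, it has a basis in which `R_X`
acts through a regular Weyr matrix (`exists_regular_basis`): the structure theorem over `k[X]` gives
Jordan chains, and grouping the chain vectors by their position in the chain, rather than chain by
chain, gives the Weyr form. The matrices of the `a_l` in the combined basis complete the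
representation of `𝔄`. -/

lemma Gam.src_mul_a (l : Fin 𝔄.n) :
    Gam.inc 𝔄 (𝔄.base.e (𝔄.A.src l)) * Gam.a 𝔄 l = Gam.a 𝔄 l := by
  have := Gam.mk_rel (GamRel.src (𝔄 := 𝔄) l)
  rwa [map_mul] at this

lemma Gam.a_mul_tgt (l : Fin 𝔄.n) :
    Gam.a 𝔄 l * Gam.inc 𝔄 (𝔄.base.e (𝔄.A.tgt l)) = Gam.a 𝔄 l := by
  have := Gam.mk_rel (GamRel.tgt (𝔄 := 𝔄) l)
  rwa [map_mul] at this

lemma Gam.a_cut (l : Fin 𝔄.n) :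
    bact 𝔄 (Gam 𝔄) (𝔄.base.e2 (𝔄.A.src l) (𝔄.A.tgt l)) (Gam.a 𝔄 l) = Gam.a 𝔄 l := by
  rw [bact_apply, MinAlg.e2, jR_tmul, Gam.tmul_smul, Gam.src_mul_a, Gam.a_mul_tgt]

variable {N : Type u} [AddCommGroup N] [Module k N] [Module (Ge 𝔄) N] [IsScalarTower k (Ge 𝔄) N]
  {w : N} (v : Fin 𝔄.m → N)

lemma lmul_inc (r : 𝔄.R) (x : N) : lmul 𝔄 N (Gam.inc 𝔄 r) x = bact 𝔄 N (r ⊗ₜ 1) x := by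
  rw [lmul_apply, bact_apply, jR_tmul, map_one]

lemma rmul_inc (r : 𝔄.R) (x : N) : rmul 𝔄 N x (Gam.inc 𝔄 r) = bact 𝔄 N (1 ⊗ₜ r) x := by
  rw [rmul_apply, bact_apply, jR_tmul, map_one]

/-- The constants `η`, `σ`, `ζ` are cut to the end vertices of `A_l` by construction, and `ω a_l`,
`a_l ω` inherit these vertices from `a_l` because `w` commutes with `R`. Thus the idempotent that
stands at the leading position of `A_l` does not lose any part of the relation. -/
lemma kap_cut (hw : Central (bact 𝔄 N) w) (l : Fin 𝔄.n) :
    bact 𝔄 N (𝔄.base.e2 (𝔄.A.src l) (𝔄.A.tgt l)) (kap 𝔄 w v l) = kap 𝔄 w v l := by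
  have h1 : ∀ u : T2 k 𝔄.R, ∀ x, bact 𝔄 N u (bact 𝔄 N (𝔄.ζ x l) (v x)) =
      bact 𝔄 N (u * 𝔄.ζ x l) (v x) := fun u x => by
    rw [map_mul]; rfl
  simp only [kap, iota11, tau11, del1, map_add, map_sub, map_sum, h1, 𝔄.zeta_cut,
    ev3_outer (rmul_pairing 𝔄 (N := N)), ev3_outer (lmul_pairing 𝔄 (N := N)),
    MatrixBimoduleProblem.η, MatrixBimoduleProblem.σ, 𝔄.VA.coef_cut, 𝔄.AV.coef_cut,
    bi_central_left (rmul_pairing 𝔄 (N := N)) hw, bi_central_right (lmul_pairing 𝔄 (N := N)) _ hw,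
    Gam.a_cut]

/-- `e_X`, `X ∋ q`, acts trivially from the right on an entry in column `q`. -/
lemma mat_mul_e_right {N' : ℕ} (U : QBasis 𝔄.base 𝔄.cls N') (i : Fin N') (p q : Fin 𝔄.t) :
    (1 ⊗ₜ 𝔄.base.e (𝔄.cls q)) * U.mat i p q = U.mat i p q := by
  by_cases h : U.mat i p q = 0
  · rw [h, mul_zero]
  · rw [(U.supp i p q h).2]
    conv_lhs => rw [← U.comp i p q]
    rw [← mul_assoc, MinAlg.e2, Algebra.TensorProduct.tmul_mul_tmul, one_mul, MinAlg.e_mul_self]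
    exact U.comp i p q

lemma mat_mul_e_left {N' : ℕ} (U : QBasis 𝔄.base 𝔄.cls N') (i : Fin N') (p q : Fin 𝔄.t) :
    (𝔄.base.e (𝔄.cls p) ⊗ₜ 1) * U.mat i p q = U.mat i p q := by
  by_cases h : U.mat i p q = 0
  · rw [h, mul_zero]
  · rw [(U.supp i p q h).1]
    conv_lhs => rw [← U.comp i p q]
    rw [← mul_assoc, MinAlg.e2, Algebra.TensorProduct.tmul_mul_tmul, one_mul, MinAlg.e_mul_self]
    exact U.comp i p q

/-- `H` lives at places whose row and column belong to one class, so the cut by the class of the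
row, given for `H`, is also a cut by the class of the column. -/
lemma H_mul_e (p q : Fin 𝔄.t) : 𝔄.H p q * 𝔄.base.e (𝔄.cls q) = 𝔄.H p q := by
  by_cases h : 𝔄.cls p = 𝔄.cls q
  · rw [← h, mul_comm, 𝔄.H_comp]
  · rw [𝔄.H_supp p q h, zero_mul]

lemma Theta_mul_e (p q : Fin 𝔄.t) :
    Theta 𝔄 p q * Gam.inc 𝔄 (𝔄.base.e (𝔄.cls q)) = Theta 𝔄 p q := by
  rw [Theta, Matrix.of_apply, Finset.sum_mul]
  refine Finset.sum_congr rfl fun i _ => ?_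
  conv_rhs => rw [← mat_mul_e_right, map_mul]
  change _ = bact 𝔄 _ _ (bact 𝔄 _ _ _)
  rw [← rmul_inc, rmul_apply, Gam.tmul_smul, one_mul]

lemma e_mul_Theta (p q : Fin 𝔄.t) :
    Gam.inc 𝔄 (𝔄.base.e (𝔄.cls p)) * Theta 𝔄 p q = Theta 𝔄 p q := by
  rw [Theta, Matrix.of_apply, Finset.mul_sum]
  refine Finset.sum_congr rfl fun i _ => ?_
  conv_rhs => rw [← mat_mul_e_left, map_mul]
  change _ = bact 𝔄 _ _ (bact 𝔄 _ _ _)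
  rw [← lmul_inc, lmul_apply, Gam.tmul_smul, mul_one]

lemma ThetaH_mul_e (p q : Fin 𝔄.t) :
    ThetaH 𝔄 p q * Gam.inc 𝔄 (𝔄.base.e (𝔄.cls q)) = ThetaH 𝔄 p q := by
  rw [ThetaH, Matrix.add_apply, add_mul, Theta_mul_e, Matrix.map_apply, ← map_mul, H_mul_e]

lemma e_mul_ThetaH (p q : Fin 𝔄.t) :
    Gam.inc 𝔄 (𝔄.base.e (𝔄.cls p)) * ThetaH 𝔄 p q = ThetaH 𝔄 p q := by
  rw [ThetaH, Matrix.add_apply, mul_add, e_mul_Theta, Matrix.map_apply, ← map_mul, 𝔄.H_comp]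

/-- `Υ` is diagonal with entries `1_X w`, and the idempotent `1_X` is absorbed by the column of `Θ +
H` in front of it. So `Υ` multiplies like the scalar `w`. -/
lemma ThetaH_mul_Upsilon (p q : Fin 𝔄.t) :
    ∑ r, lmul 𝔄 N (ThetaH 𝔄 p r) (Upsilon 𝔄 w r q) = lmul 𝔄 N (ThetaH 𝔄 p q) w := by
  rw [Finset.sum_eq_single q]
  · rw [Upsilon, Matrix.diagonal_apply_eq, lmul_apply, lmul_apply, smul_smul, Ge.t_mul,
      ThetaH_mul_e, one_mul, lmul_apply]
  · intro r _ hr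
    rw [Upsilon, Matrix.diagonal_apply_ne _ hr, map_zero]
  · intro h; exact absurd (Finset.mem_univ _) h

/-- In this order the idempotent of `Υ` stands on the far side of `w`; centrality moves it across,
to where `Θ + H` absorbs it. -/
lemma Upsilon_mul_ThetaH (hw : Central (bact 𝔄 N) w) (p q : Fin 𝔄.t) :
    ∑ r, rmul 𝔄 N (Upsilon 𝔄 w p r) (ThetaH 𝔄 r q) = rmul 𝔄 N w (ThetaH 𝔄 p q) := by
  rw [Finset.sum_eq_single p]
  · rw [Upsilon, Matrix.diagonal_apply_eq, lmul_inc, hw, ← rmul_inc, rmul_apply, rmul_apply,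
      smul_smul, Ge.t_mul, e_mul_ThetaH, one_mul, rmul_apply]
  · intro r _ hr
    rw [Upsilon, Matrix.diagonal_apply_ne _ hr.symm, map_zero, LinearMap.zero_apply]
  · intro h; exact absurd (Finset.mem_univ _) h

/-- The right half of the coefficient `A_l(p, q)` sits between `a_l` and `w`; as `w` commutes with
`R`, it can pass to the outside. -/
lemma lmul_Theta (hw : Central (bact 𝔄 N) w) (p q : Fin 𝔄.t) :
    lmul 𝔄 N (Theta 𝔄 p q) w = ∑ l, bact 𝔄 N (𝔄.A.mat l p q) (lmul 𝔄 N (Gam.a 𝔄 l) w) := by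
  simp only [Theta, Matrix.of_apply, map_sum, LinearMap.sum_apply,
    bi_central_right (lmul_pairing 𝔄 (N := N)) _ hw]

lemma rmul_Theta (hw : Central (bact 𝔄 N) w) (p q : Fin 𝔄.t) :
    rmul 𝔄 N w (Theta 𝔄 p q) = ∑ l, bact 𝔄 N (𝔄.A.mat l p q) (rmul 𝔄 N w (Gam.a 𝔄 l)) := by
  simp only [Theta, Matrix.of_apply, map_sum,
    bi_central_left (rmul_pairing 𝔄 (N := N)) hw]

/-- A product of two formal products, expressed through structure constants. -/
lemma sum_ev3_coef {M₁ M₂ M : Type*} [AddCommGroup M₁] [Module k M₁] [AddCommGroup M₂]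
    [Module k M₂] [AddCommGroup M] [Module k M] {a₁ : BiAct k 𝔄.R M₁} {a₂ : BiAct k 𝔄.R M₂}
    {a : BiAct k 𝔄.R M} {β : M₁ →ₗ[k] M₂ →ₗ[k] M} (hβ : IsPairing a₁ a₂ a β) {N₁ N₂ N₃ : ℕ}
    {U : QBasis 𝔄.base 𝔄.cls N₁} {U' : QBasis 𝔄.base 𝔄.cls N₂} {U'' : QBasis 𝔄.base 𝔄.cls N₃}
    (h : MulClosed U U' U'') (x : Fin N₁ → M₁) (y : Fin N₂ → M₂) (p q : Fin 𝔄.t) :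
    ∑ r, β (∑ i, a₁ (U.mat i p r) (x i)) (∑ j, a₂ (U'.mat j r q) (y j)) =
      ∑ l, a (U''.mat l p q) (∑ i, ∑ j, ev3 a₁ a₂ β (x i) (y j) (h.coef i j l)) := by
  -- By bilinearity one pair of basis matrices suffices. Summing over `r` assembles the `(p,
  -- q)`-entry of the `R^{⊗3}`-valued matrix product, which `coef_spec` expands, and the outer
  -- action extracts the entries of `U''_l`.
  have key : ∀ i j, ∑ r, β (a₁ (U.mat i p r) (x i)) (a₂ (U'.mat j r q) (y j)) =
      ∑ l, a (U''.mat l p q) (ev3 a₁ a₂ β (x i) (y j) (h.coef i j l)) := by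
    intro i j
    have h2 := congrFun (congrFun (h.coef_spec i j) p) q
    rw [prod2, Matrix.mul_apply, Matrix.sum_apply] at h2
    simp only [Matrix.map_apply, Matrix.smul_apply, smul_eq_mul] at h2
    simp only [ev3_mul hβ]
    rw [← map_sum, h2, map_sum]
    refine Finset.sum_congr rfl fun l _ => ?_
    rw [ev3_outer hβ, mul_comm]
  have hl : ∀ r, β (∑ i, a₁ (U.mat i p r) (x i)) (∑ j, a₂ (U'.mat j r q) (y j)) =
      ∑ i, ∑ j, β (a₁ (U.mat i p r) (x i)) (a₂ (U'.mat j r q) (y j)) := fun r => by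
    rw [map_sum β, LinearMap.sum_apply]
    exact Finset.sum_congr rfl fun i _ => map_sum _ _ _
  have hr : ∀ l, a (U''.mat l p q) (∑ i, ∑ j, ev3 a₁ a₂ β (x i) (y j) (h.coef i j l)) =
      ∑ i, ∑ j, a (U''.mat l p q) (ev3 a₁ a₂ β (x i) (y j) (h.coef i j l)) := fun l => by
    rw [map_sum]
    exact Finset.sum_congr rfl fun i _ => map_sum _ _ _
  rw [Finset.sum_congr rfl fun r _ => hl r, Finset.sum_congr rfl fun l _ => hr l,
    Finset.sum_comm, Finset.sum_comm (s := Finset.univ (α := Fin N₃))]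
  refine Finset.sum_congr rfl fun i _ => ?_
  rw [Finset.sum_comm, Finset.sum_comm (s := Finset.univ (α := Fin N₃))]
  exact Finset.sum_congr rfl fun j _ => key i j

/-- The constants `σ` inside `τ₁₁` are those of the products `A_i V_j`, so the general product
formula applies as it stands. In the opposite order the constants `η` of `V_i A_j` produce `ι₁₁`. -/
lemma Theta_mul_Pi1 (p q : Fin 𝔄.t) :
    ∑ r, lmul 𝔄 N (Theta 𝔄 p r) (Pi1 𝔄 v r q) =
      ∑ l, bact 𝔄 N (𝔄.A.mat l p q) (tau11 𝔄 v l) :=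
  sum_ev3_coef 𝔄 (lmul_pairing 𝔄 (N := N)) 𝔄.AV (Gam.a 𝔄) v p q

lemma Pi1_mul_Theta (p q : Fin 𝔄.t) :
    ∑ r, rmul 𝔄 N (Pi1 𝔄 v p r) (Theta 𝔄 r q) =
      ∑ l, bact 𝔄 N (𝔄.A.mat l p q) (iota11 𝔄 v l) :=
  sum_ev3_coef 𝔄 (rmul_pairing 𝔄 (N := N)) 𝔄.VA v (Gam.a 𝔄) p q

/-- The coefficient of `v_j` in the commutator of `Π` with `H` is the entry of `V_j H - H V_j`, and
the `ζ` are by definition the coefficients of this matrix in the `A_l`. -/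
lemma Pi1_mul_H_sub (p q : Fin 𝔄.t) :
    ∑ r, rmul 𝔄 N (Pi1 𝔄 v p r) (Gam.inc 𝔄 (𝔄.H r q)) -
      ∑ r, lmul 𝔄 N (Gam.inc 𝔄 (𝔄.H p r)) (Pi1 𝔄 v r q) =
      ∑ l, bact 𝔄 N (𝔄.A.mat l p q) (del1 𝔄 v l) := by
  have h1 : ∀ (u u' : T2 k 𝔄.R) (x : N), bact 𝔄 N u (bact 𝔄 N u' x) = bact 𝔄 N (u * u') x :=
    fun u u' x => by rw [map_mul]; rfl
  have e : ∀ j, ∑ r, bact 𝔄 N (1 ⊗ₜ 𝔄.H r q * 𝔄.V.mat j p r) (v j) -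
      ∑ r, bact 𝔄 N (𝔄.H p r ⊗ₜ 1 * 𝔄.V.mat j r q) (v j) =
      ∑ l, bact 𝔄 N (𝔄.A.mat l p q * 𝔄.ζ j l) (v j) := by
    intro j
    have h2 := congrFun (congrFun (𝔄.zeta_spec j) p) q
    rw [MatrixBimoduleProblem.d, Matrix.sub_apply, Matrix.mul_apply, Matrix.mul_apply,
      Matrix.sum_apply] at h2
    simp only [Matrix.map_apply, Matrix.smul_apply, smul_eq_mul,
      Algebra.TensorProduct.includeRight_apply, Algebra.TensorProduct.includeLeft_apply] at h2
    simp only [← LinearMap.sum_apply, ← map_sum, ← LinearMap.sub_apply, ← map_sub]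
    rw [← Finset.sum_congr rfl fun l _ => mul_comm (𝔄.ζ j l) (𝔄.A.mat l p q), ← h2]
    simp only [mul_comm]
  have hP : ∀ u r s, bact 𝔄 N u (Pi1 𝔄 v r s) = ∑ j, bact 𝔄 N (u * 𝔄.V.mat j r s) (v j) :=
    fun u r s => by
      rw [Pi1, Matrix.of_apply, map_sum]
      exact Finset.sum_congr rfl fun j _ => h1 _ _ _
  simp only [rmul_inc, lmul_inc, hP, map_sum, h1, del1]
  rw [Finset.sum_comm,
    Finset.sum_comm (f := fun r j => bact 𝔄 N (𝔄.H p r ⊗ₜ 1 * 𝔄.V.mat j r q) (v j)),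
    ← Finset.sum_sub_distrib, Finset.sum_congr rfl fun j _ => e j, Finset.sum_comm]

/-- The formal equation is the combination of the `A_l` with the coefficients
`(κ₁ - κ₂ + κ₃)(a_l)`. -/
theorem formalR_sub_formalL (hw : Central (bact 𝔄 N) w) (p q : Fin 𝔄.t) :
    formalR 𝔄 w v p q - formalL 𝔄 w v p q =
      ∑ l, bact 𝔄 N (𝔄.A.mat l p q) (kap 𝔄 w v l) := by
  have hL : formalL 𝔄 w v p q = lmul 𝔄 N (ThetaH 𝔄 p q) w +
      (∑ r, lmul 𝔄 N (Theta 𝔄 p r) (Pi1 𝔄 v r q) +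
        ∑ r, lmul 𝔄 N (Gam.inc 𝔄 (𝔄.H p r)) (Pi1 𝔄 v r q)) := by
    rw [← ThetaH_mul_Upsilon, ← Finset.sum_add_distrib, ← Finset.sum_add_distrib]
    rw [formalL, Matrix.of_apply]
    refine Finset.sum_congr rfl fun r _ => ?_
    rw [← LinearMap.add_apply, ← map_add, Matrix.add_apply, map_add]; rfl
  have hR : formalR 𝔄 w v p q = rmul 𝔄 N w (ThetaH 𝔄 p q) +
      (∑ r, rmul 𝔄 N (Pi1 𝔄 v p r) (Theta 𝔄 r q) +
        ∑ r, rmul 𝔄 N (Pi1 𝔄 v p r) (Gam.inc 𝔄 (𝔄.H r q))) := by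
    rw [← Upsilon_mul_ThetaH 𝔄 hw, ← Finset.sum_add_distrib, ← Finset.sum_add_distrib]
    rw [formalR, Matrix.of_apply]
    refine Finset.sum_congr rfl fun r _ => ?_
    rw [← map_add, Matrix.add_apply, map_add]; rfl
  have h4 := Pi1_mul_H_sub 𝔄 v p q
  rw [sub_eq_iff_eq_add] at h4
  -- The terms `w H` and `H w` agree because `w` is central, so `H` contributes only through its
  -- commutator with `Π`.
  rw [hL, hR, h4, Theta_mul_Pi1, Pi1_mul_Theta, ThetaH, Matrix.add_apply, map_add, map_add,
    LinearMap.add_apply, lmul_Theta 𝔄 hw, rmul_Theta 𝔄 hw, Matrix.map_apply, lmul_inc, rmul_inc,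
    hw (𝔄.H p q)]
  simp only [kap, map_add, map_sub, Finset.sum_add_distrib, Finset.sum_sub_distrib]
  abel

/-- This is where normalization enters: at the leading position of `A_l` all other `A_j` vanish, and
`A_l` itself has the entry `1_X ⊗ 1_Y`. -/
lemma sum_bact_lead (x : Fin 𝔄.n → N) (l : Fin 𝔄.n) :
    ∑ j, bact 𝔄 N (𝔄.A.mat j (𝔄.lead l).1 (𝔄.lead l).2) (x j) =
      bact 𝔄 N (𝔄.base.e2 (𝔄.A.src l) (𝔄.A.tgt l)) (x l) := by
  rw [Finset.sum_eq_single l, 𝔄.lead_entry]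
  · intro j _ hj
    rw [𝔄.lead_other l j hj, map_zero, LinearMap.zero_apply]
  · intro h; exact absurd (Finset.mem_univ _) h

/-- Only the summand of `a_l` survives at its leading position, and the idempotent there fixes it.
The signs are reversed because `kap` expresses the right-hand side minus the left-hand side. -/
theorem formalL_sub_formalR_lead (hw : Central (bact 𝔄 N) w) (l : Fin 𝔄.n) :
    (formalL 𝔄 w v - formalR 𝔄 w v) (𝔄.lead l).1 (𝔄.lead l).2 =
      (lmul 𝔄 N (Gam.a 𝔄 l) w - rmul 𝔄 N w (Gam.a 𝔄 l)) -
        (iota11 𝔄 v l - tau11 𝔄 v l + del1 𝔄 v l) := by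
  rw [Matrix.sub_apply, ← neg_sub, formalR_sub_formalL 𝔄 v hw, sum_bact_lead, kap_cut 𝔄 v hw, kap]
  abel

/-- The formal equation holds if and only if all `(κ₁ - κ₂ + κ₃)(a_l)` vanish. -/
theorem formalL_eq_formalR_iff (hw : Central (bact 𝔄 N) w) :
    formalL 𝔄 w v = formalR 𝔄 w v ↔ ∀ l, kap 𝔄 w v l = 0 := by
  constructor
  · intro h l
    have := formalR_sub_formalL 𝔄 v hw (𝔄.lead l).1 (𝔄.lead l).2
    rwa [h, sub_self, sum_bact_lead, kap_cut 𝔄 v hw, eq_comm] at this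
  · intro h
    ext p q
    rw [eq_comm, ← sub_eq_zero, formalR_sub_formalL 𝔄 v hw]
    simp [h]

end FormalEquationProof

/-! ### Morphisms of `R(𝔅)` as bimodule maps `Ω → Hom_k(P, Q)` -/

section HomBimodule

variable {k : Type u} [Field k] {𝔄 : MatrixBimoduleProblem k}

open MulOpposite

namespace RepB

/-- `Hom_k(P, Q)` as a `Γ`-`Γ`-bimodule, `(a f b)(p) = f(p a) b`. -/
def HomBim (P Q : RepB 𝔄) : Type u := P.carrier →ₗ[k] Q.carrier

variable (P Q : RepB 𝔄)

noncomputable instance : AddCommGroup (HomBim P Q) :=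
  inferInstanceAs (AddCommGroup (P.carrier →ₗ[k] Q.carrier))
noncomputable instance : Module k (HomBim P Q) :=
  inferInstanceAs (Module k (P.carrier →ₗ[k] Q.carrier))

/-- The left and right actions of `Γ` on `Hom_k(P, Q)`. -/
noncomputable def gamL : Gam 𝔄 →ₐ[k] Module.End k (P.carrier →ₗ[k] Q.carrier) :=
  AlgHom.ofLinearMap
    (LinearMap.mk₂ k (fun g f => f ∘ₗ P.act (op g))
      (by intros; ext; simp) (by intros; ext; simp) (by intros; ext; simp) (by intros; ext; simp))
    (by ext; simp)
    (by
      intro g h; ext f p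
      change f (P.mul (g * h) p) = f (P.mul h (P.mul g p))
      rw [mul_mul])
noncomputable def gamR : (Gam 𝔄)ᵐᵒᵖ →ₐ[k] Module.End k (P.carrier →ₗ[k] Q.carrier) :=
  AlgHom.ofLinearMap
    (LinearMap.mk₂ k (fun g f => Q.act g ∘ₗ f)
      (by intros; ext; simp) (by intros; ext; simp) (by intros; ext; simp) (by intros; ext; simp))
    (by ext; simp)
    (by intro g h; ext f p; simp)

lemma gamL_gamR (g : Gam 𝔄) (h : (Gam 𝔄)ᵐᵒᵖ) : Commute (gamL P Q g) (gamR P Q h) := rfl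

/-- `Γ ⊗_k Γᵒᵖ → End_k Hom_k(P, Q)`. -/
noncomputable def onHom : Ge 𝔄 →ₐ[k] Module.End k (HomBim P Q) :=
  (Algebra.TensorProduct.lift (gamL P Q) (gamR P Q) (gamL_gamR P Q) :
    Gam 𝔄 ⊗[k] (Gam 𝔄)ᵐᵒᵖ →ₐ[k] Module.End k (P.carrier →ₗ[k] Q.carrier))

noncomputable instance : Module (Ge 𝔄) (HomBim P Q) :=
  Module.compHom (HomBim P Q) (onHom P Q).toRingHom

lemma HomBim.smul_def (z : Ge 𝔄) (f : HomBim P Q) : z • f = onHom P Q z f := rfl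

instance : IsScalarTower k (Ge 𝔄) (HomBim P Q) where
  smul_assoc c z x := by rw [HomBim.smul_def, HomBim.smul_def, map_smul]; rfl

variable {P Q}

/-- A linear map regarded as an element of the bimodule `Hom_k(P, Q)`, and back. -/
def HomBim.of (f : P.carrier →ₗ[k] Q.carrier) : HomBim P Q := f
def HomBim.fn (f : HomBim P Q) : P.carrier →ₗ[k] Q.carrier := f

lemma HomBim.t_smul (a b : Gam 𝔄) (f : HomBim P Q) (p : P.carrier) :
    HomBim.fn (Ge.t 𝔄 a b • f) p = Q.mul b (f.fn (P.mul a p)) := by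
  rw [HomBim.smul_def]
  exact DFunLike.congr_fun (DFunLike.congr_fun
    (Algebra.TensorProduct.lift_tmul (gamL P Q) (gamR P Q) (gamL_gamR P Q) a (op b)) f) p

/-- Two descriptions of one `R`-`R`-structure meet here: the relations of `Ω` use the restriction of
the `Γ`-`Γ`-action, while the composition formula of `R(𝔅)` uses `homBim`. -/
lemma bact_homBim (u : T2 k 𝔄.R) (f : HomBim P Q) :
    bact 𝔄 (HomBim P Q) u f = HomBim.of (homBim P Q u f.fn) := by
  induction u using TensorProduct.induction_on with
  | zero => rw [map_zero, map_zero]; rfl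
  | add u v hu hv => rw [map_add, map_add, LinearMap.add_apply, hu, hv]; rfl
  | tmul r s =>
    refine LinearMap.ext fun p => ?_
    rw [bact_apply, jR_tmul]
    exact (HomBim.t_smul _ _ f p).trans (homBim_tmul P Q r s f.fn p).symm

/-- A bimodule map `Ω → Hom_k(P, Q)` as a morphism of `R(𝔅)`. -/
noncomputable def ofBimHom (φ : Om 𝔄 →ₗ[Ge 𝔄] HomBim P Q) :
    P.carrier →ₗ[k] Om 𝔄 →ₗ[k] Q.carrier :=
  LinearMap.flip (φ.restrictScalars k : Om 𝔄 →ₗ[k] (P.carrier →ₗ[k] Q.carrier))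

lemma ofBimHom_apply (φ : Om 𝔄 →ₗ[Ge 𝔄] HomBim P Q) (p : P.carrier) (x : Om 𝔄) :
    ofBimHom φ p x = (φ x).fn p := rfl

/-- Linearity for the left action of `Γ` is balancedness over `Γ`, and linearity for the right
action is `Γ`-linearity of the map `P ⊗_Γ Ω → Q`. -/
lemma ofBimHom_mem (φ : Om 𝔄 →ₗ[Ge 𝔄] HomBim P Q) : ofBimHom φ ∈ homs P Q := by
  refine ⟨fun p g x => ?_, fun p x g => ?_⟩
  · rw [ofBimHom_apply, ofBimHom_apply, map_lmul, lmul_apply, HomBim.t_smul, mul_one']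
  · rw [ofBimHom_apply, ofBimHom_apply, map_rmul, rmul_apply, HomBim.t_smul, mul_one']

/-- A morphism of `R(𝔅)` as a bimodule map `Ω → Hom_k(P, Q)`. -/
noncomputable def toBimHom {F : P.carrier →ₗ[k] Om 𝔄 →ₗ[k] Q.carrier} (hF : F ∈ homs P Q) :
    Om 𝔄 →ₗ[Ge 𝔄] HomBim P Q where
  toFun x := HomBim.of (F.flip x)
  map_add' x y := map_add F.flip x y
  map_smul' z x := by
    rw [RingHom.id_apply]
    induction z using Ge.ind with
    | h0 => rw [zero_smul, zero_smul]; exact map_zero F.flip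
    | ha z z' h1 h2 => rw [add_smul, add_smul, ← h1, ← h2]; exact map_add F.flip _ _
    | h a b =>
      refine LinearMap.ext fun p => ?_
      exact (hom_t hF p a b x).trans (HomBim.t_smul a b (HomBim.of (F.flip x)) p).symm

lemma hom_bact_central {F : P.carrier →ₗ[k] Om 𝔄 →ₗ[k] Q.carrier} (hF : F ∈ homs P Q) :
    Central (bact 𝔄 (HomBim P Q)) (HomBim.of (F.flip (Om.ω 𝔄))) := by
  intro r
  rw [bact_homBim, bact_homBim]
  exact congrArg _ (hom_central hF r)

/-- A relation between the generators of `Ω` is carried by the bimodule map to the same relation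
between their images; the same argument applies to `kap`. Fullness uses these relations to recognize
matrices as a morphism of `R(𝔄)`. -/
lemma hom_v_cut {F : P.carrier →ₗ[k] Om 𝔄 →ₗ[k] Q.carrier} (hF : F ∈ homs P Q)
    (j : Fin 𝔄.m) :
    bact 𝔄 (HomBim P Q) (𝔄.base.e2 (𝔄.V.src j) (𝔄.V.tgt j)) (HomBim.of (F.flip (Om.v 𝔄 j))) =
      HomBim.of (F.flip (Om.v 𝔄 j)) :=
  (map_bact 𝔄 (toBimHom hF) _ _).symm.trans (congrArg (toBimHom hF) (Om.v_cut 𝔄 j))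

lemma hom_kap {F : P.carrier →ₗ[k] Om 𝔄 →ₗ[k] Q.carrier} (hF : F ∈ homs P Q)
    (l : Fin 𝔄.n) : kap 𝔄 (HomBim.of (F.flip (Om.ω 𝔄)))
    (fun j => HomBim.of (F.flip (Om.v 𝔄 j))) l = (0 : HomBim P Q) := by
  have := map_kap 𝔄 (Om.ω 𝔄) (Om.v 𝔄) (toBimHom hF) l
  rw [Om.kap_eq_zero, map_zero] at this
  exact this.symm

end RepB

end HomBimodule

/-! ### Matrices acting on row vectors -/

section RowAction

variable {k : Type*} [Field k] {I J L : Type*} [Fintype I] [DecidableEq I]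

/-- A matrix acting on row vectors from the right. -/
noncomputable def rowMap : Matrix I J k ≃ₗ[k] ((I → k) →ₗ[k] (J → k)) :=
  (Matrix.transposeLinearEquiv I J k k).trans Matrix.toLin'

lemma rowMap_apply (C : Matrix I J k) (p : I → k) : rowMap C p = Matrix.vecMul p C := by
  simp [rowMap, Matrix.mulVec_transpose]

/-- Row vectors stand to the left of the matrices, so the left factor acts before the right one.
This fits both right modules and the order in which composites of morphisms are written. -/
lemma rowMap_mul [Fintype J] [DecidableEq J] (C : Matrix I J k) (D : Matrix J L k) :
    rowMap (C * D) = rowMap D ∘ₗ rowMap C := by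
  refine LinearMap.ext fun p => ?_
  simp only [rowMap_apply, LinearMap.comp_apply, Matrix.vecMul_vecMul]

lemma rowMap_one : rowMap (1 : Matrix I I k) = LinearMap.id := by
  refine LinearMap.ext fun p => ?_
  simp [rowMap_apply]

end RowAction

/-! ### The fully faithful functor `R(𝔄) → R(𝔅)` -/

section Comparison

variable {k : Type u} [Field k] [IsAlgClosed k] {𝔄 : MatrixBimoduleProblem k}

open MulOpposite

namespace RepA

/-- The support condition on `P(a_l)`, put in the form of the relations `1_X a_l = a_l = a_l 1_Y` of
`Γ`, lets `P` define an action of `Γ`. -/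
lemma rho_e_mul_a (P : RepA 𝔄) (l : Fin 𝔄.n) : P.rho (𝔄.base.e (𝔄.A.src l)) * P.a l = P.a l := by
  ext x y
  rw [rho_e, Matrix.diagonal_mul]
  by_cases h : P.a l x y = 0
  · rw [h, mul_zero]
  · rw [if_pos (P.a_supp l x y h).1, one_mul]

lemma a_mul_rho_e (P : RepA 𝔄) (l : Fin 𝔄.n) : P.a l * P.rho (𝔄.base.e (𝔄.A.tgt l)) = P.a l := by
  ext x y
  rw [rho_e, Matrix.mul_diagonal]
  by_cases h : P.a l x y = 0
  · rw [h, zero_mul]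
  · rw [if_pos (P.a_supp l x y h).2, mul_one]

/-- The action of `Γ` on `⊕_X k^{m_X}`, by matrices multiplied from the right. -/
noncomputable def gam (P : RepA 𝔄) : Gam 𝔄 →ₐ[k] Matrix P.I P.I k :=
  RingQuot.liftAlgHom k ⟨FreeAlgebra.lift k (Sum.elim P.rho P.a), by
    intro x y h
    cases h with
    | add r s => simp
    | mul r s => simp
    | scalar c => simp [AlgHom.commutes]
    | src l => simpa using P.rho_e_mul_a l
    | tgt l => simpa using P.a_mul_rho_e l⟩

@[simp] lemma gam_inc (P : RepA 𝔄) (r : 𝔄.R) : P.gam (Gam.inc 𝔄 r) = P.rho r := by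
  refine (RingQuot.liftAlgHom_mkAlgHom_apply ..).trans ?_
  simp

@[simp] lemma gam_a (P : RepA 𝔄) (l : Fin 𝔄.n) : P.gam (Gam.a 𝔄 l) = P.a l := by
  refine (RingQuot.liftAlgHom_mkAlgHom_apply ..).trans ?_
  simp

/-- The `Γ`-module of row vectors attached to a representation of `𝔄`. -/
noncomputable def toB (P : RepA 𝔄) : RepB 𝔄 where
  carrier := P.I → k
  act := AlgHom.ofLinearMap
    ((rowMap (k := k)).toLinearMap ∘ₗ P.gam.toLinearMap ∘ₗ (opLinearEquiv k).symm.toLinearMap)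
    (by
      change rowMap (P.gam 1) = LinearMap.id
      rw [map_one, rowMap_one])
    -- Passing from `Γᵒᵖ` to `Γ` and letting matrices act on rows both reverse products, so the
    -- composite preserves them.
    (fun g h => by simp [rowMap_mul]; rfl)

lemma toB_mul (P : RepA 𝔄) (g : Gam 𝔄) : P.toB.mul g = rowMap (P.gam g) := rfl

variable {P Q S : RepA 𝔄}

/-- Matrices as elements of the bimodule `Hom_k(P, Q)`. -/
noncomputable def toHomBim (P Q : RepA 𝔄) : Matrix P.I Q.I k ≃ₗ[k] RepB.HomBim P.toB Q.toB :=
  rowMap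

/-- Acting by `a` before `C` and by `b` after it becomes, on row vectors, multiplication on the left
and on the right. Every computation in the bimodule `Hom_k(P, Q)` thereby becomes one with matrices.
-/
lemma t_smul_toHomBim (a b : Gam 𝔄) (C : Matrix P.I Q.I k) :
    Ge.t 𝔄 a b • toHomBim P Q C = toHomBim P Q (P.gam a * C * Q.gam b) := by
  refine LinearMap.ext fun p => (RepB.HomBim.t_smul a b _ p).trans ?_
  change rowMap (Q.gam b) (rowMap C (rowMap (P.gam a) p)) = rowMap (P.gam a * C * Q.gam b) p
  rw [rowMap_mul, rowMap_mul]; rfl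

lemma lmul_toHomBim (a : Gam 𝔄) (C : Matrix P.I Q.I k) :
    lmul 𝔄 _ a (toHomBim P Q C) = toHomBim P Q (P.gam a * C) := by
  rw [lmul_apply, t_smul_toHomBim, map_one, Matrix.mul_one]

lemma rmul_toHomBim (b : Gam 𝔄) (C : Matrix P.I Q.I k) :
    rmul 𝔄 _ (toHomBim P Q C) b = toHomBim P Q (C * Q.gam b) := by
  rw [rmul_apply, t_smul_toHomBim, map_one, Matrix.one_mul]

lemma bact_toHomBim (u : T2 k 𝔄.R) (C : Matrix P.I Q.I k) :
    bact 𝔄 _ u (toHomBim P Q C) = toHomBim P Q (bim P Q u C) := by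
  induction u using TensorProduct.induction_on with
  | zero => simp
  | add u v hu hv => rw [map_add, map_add, LinearMap.add_apply, hu, hv, LinearMap.add_apply, map_add]
  | tmul r s => rw [bact_apply, jR_tmul, t_smul_toHomBim, gam_inc, gam_inc, matBim_tmul]

lemma gam_bact (u : T2 k 𝔄.R) (g : Gam 𝔄) : P.gam (bact 𝔄 _ u g) = bim P P u (P.gam g) := by
  induction u using TensorProduct.induction_on with
  | zero => simp
  | add u v hu hv => rw [map_add, map_add, LinearMap.add_apply, map_add, hu, hv]; rfl
  | tmul r s => simp [bact_apply]

/-- `P̄` is `Θ + H` evaluated at `P`: the definition of `Θ` becomes that of `P(a_l) ∗ A_l` once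
`a_l` is replaced by `P(a_l)` and `R` acts through the Weyr matrices. -/
lemma bar_apply (x y : P.J) : P.bar x y = P.gam (ThetaH 𝔄 x.1 y.1) x.toI y.toI := by
  simp only [ThetaH, Theta, Matrix.add_apply, Matrix.of_apply, map_add, map_sum, gam_bact, gam_a,
    Matrix.map_apply, gam_inc, bar, starH, star, Matrix.sum_apply]
  rw [add_comm]

/-- The matrix `Υ + Π` of the formal equation, evaluated at a morphism. -/
lemma barHom_apply (f : Matrix P.I Q.I k × (Fin 𝔄.m → Matrix P.I Q.I k)) (x : P.J) (y : Q.J) :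
    barHom P Q f x y = (toHomBim P Q).symm
      ((Upsilon 𝔄 (toHomBim P Q f.1) + Pi1 𝔄 fun j => toHomBim P Q (f.2 j)) x.1 y.1)
        x.toI y.toI := by
  rw [Matrix.add_apply, map_add, Matrix.add_apply, barHom, Matrix.add_apply]
  congr 1
  · rw [starE, Matrix.of_apply, Upsilon]
    by_cases h : x.1 = y.1
    -- The entry `1_X w` of `Υ` carries an idempotent that the star product with `E_X` does not
    -- show. It acts as `1` here, since the row index belongs to `X`.
    · rw [if_pos h, h, Matrix.diagonal_apply_eq, lmul_toHomBim, LinearEquiv.symm_apply_apply,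
        gam_inc, rho_e, Matrix.diagonal_mul,
        if_pos (show x.toI.1 = 𝔄.cls y.1 from congrArg 𝔄.cls h), one_mul]
    · rw [if_neg h, Matrix.diagonal_apply_ne _ h, map_zero, Matrix.zero_apply]
  · simp only [Pi1, Matrix.of_apply, bact_toHomBim, map_sum, LinearEquiv.symm_apply_apply,
      Matrix.sum_apply, star]

/-- The `(p, q)`-entry of `Θ + H` absorbs the idempotent of the column `q`. Consequently a sum over
the single block of `q` loses nothing against a sum over all of `⊕_X k^{m_X}`. -/
lemma gam_ThetaH_col (p q : Fin 𝔄.t) (x y : P.I) (h : P.gam (ThetaH 𝔄 p q) x y ≠ 0) :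
    y.1 = 𝔄.cls q := by
  rw [← ThetaH_mul_e, map_mul, gam_inc, rho_e, Matrix.mul_diagonal] at h
  by_contra h1
  rw [if_neg h1, mul_zero] at h
  exact h rfl

lemma gam_ThetaH_row (p q : Fin 𝔄.t) (x y : P.I) (h : P.gam (ThetaH 𝔄 p q) x y ≠ 0) :
    x.1 = 𝔄.cls p := by
  rw [← e_mul_ThetaH, map_mul, gam_inc, rho_e, Matrix.diagonal_mul] at h
  by_contra h1
  rw [if_neg h1, zero_mul] at h
  exact h rfl

/-- A product of partitioned matrices sums over a block index `r` and over the places inside that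
block. The inner sum is the action of an entry of `Θ + H` on an element of `Hom_k(P, Q)`, and the
outer sum is the one in the formal product. -/
lemma bar_mul_barHom (f : Matrix P.I Q.I k × (Fin 𝔄.m → Matrix P.I Q.I k)) (x : P.J) (z : Q.J) :
    (P.bar * barHom P Q f) x z = (toHomBim P Q).symm
      (formalL 𝔄 (toHomBim P Q f.1) (fun j => toHomBim P Q (f.2 j)) x.1 z.1) x.toI z.toI := by
  rw [formalL, Matrix.of_apply, map_sum, Matrix.sum_apply, Matrix.mul_apply, Fintype.sum_sigma]
  refine Finset.sum_congr rfl fun r _ => ?_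
  simp only [bar_apply, barHom_apply]
  -- The shape of the entry of `Υ + Π` plays no role in the product; it is treated as an arbitrary
  -- matrix `C`.
  generalize (Upsilon 𝔄 (toHomBim P Q f.1) + Pi1 𝔄 fun j => toHomBim P Q (f.2 j)) r z.1 = n
  obtain ⟨C, rfl⟩ := (toHomBim P Q).surjective n
  rw [lmul_toHomBim, LinearEquiv.symm_apply_apply, LinearEquiv.symm_apply_apply, Matrix.mul_apply]
  exact sum_block P r (fun y => P.gam (ThetaH 𝔄 x.1 r) x.toI y * C y z.toI)
    fun y hy => gam_ThetaH_col _ _ _ _ (left_ne_zero_of_mul hy)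

lemma barHom_mul_bar (f : Matrix P.I Q.I k × (Fin 𝔄.m → Matrix P.I Q.I k)) (x : P.J) (z : Q.J) :
    (barHom P Q f * Q.bar) x z = (toHomBim P Q).symm
      (formalR 𝔄 (toHomBim P Q f.1) (fun j => toHomBim P Q (f.2 j)) x.1 z.1) x.toI z.toI := by
  rw [formalR, Matrix.of_apply, map_sum, Matrix.sum_apply, Matrix.mul_apply, Fintype.sum_sigma]
  refine Finset.sum_congr rfl fun r _ => ?_
  simp only [bar_apply, barHom_apply]
  generalize (Upsilon 𝔄 (toHomBim P Q f.1) + Pi1 𝔄 fun j => toHomBim P Q (f.2 j)) x.1 r = n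
  obtain ⟨C, rfl⟩ := (toHomBim P Q).surjective n
  rw [rmul_toHomBim, LinearEquiv.symm_apply_apply, LinearEquiv.symm_apply_apply, Matrix.mul_apply]
  exact sum_block Q r (fun y => C x.toI y * Q.gam (ThetaH 𝔄 r z.1) y z.toI)
    fun y hy => gam_ThetaH_row _ _ _ _ (right_ne_zero_of_mul hy)

/-- This and the next statement translate the conditions on the components `f_X` and `f(v_j)` of a
family into the two kinds of relations that present `Ξ`. -/
lemma central_toHomBim_iff (C : Matrix P.I Q.I k) :
    Central (bact 𝔄 _) (toHomBim P Q C) ↔ ∀ r, P.rho r * C = C * Q.rho r := by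
  simp only [Central, bact_toHomBim, (toHomBim P Q).injective.eq_iff, matBim_tmul, map_one,
    Matrix.one_mul, Matrix.mul_one]

lemma cut_toHomBim_iff (X Y : 𝔄.Vert) (C : Matrix P.I Q.I k) :
    bact 𝔄 _ (𝔄.base.e2 X Y) (toHomBim P Q C) = toHomBim P Q C ↔
      ∀ x y, C x y ≠ 0 → x.1 = X ∧ y.1 = Y := by
  rw [supp_iff, bact_toHomBim, (toHomBim P Q).injective.eq_iff]

/-- The equation `P̄ f̄ = f̄ Q̄` says that `f` annihilates the relations of `Ω`. -/
lemma bar_comm_iff_kap (f : Matrix P.I Q.I k × (Fin 𝔄.m → Matrix P.I Q.I k))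
    (hf : ∀ r, P.rho r * f.1 = f.1 * Q.rho r) :
    P.bar * barHom P Q f = barHom P Q f * Q.bar ↔
      ∀ l, kap 𝔄 (toHomBim P Q f.1) (fun j => toHomBim P Q (f.2 j)) l = 0 := by
  have hw := (central_toHomBim_iff f.1).2 hf
  constructor
  · intro h l
    have hk := formalR_sub_formalL 𝔄 (fun j => toHomBim P Q (f.2 j)) hw (𝔄.lead l).1 (𝔄.lead l).2
    have hc := kap_cut 𝔄 (fun j => toHomBim P Q (f.2 j)) hw l
    rw [sum_bact_lead, hc] at hk
    obtain ⟨C, hC⟩ := (toHomBim P Q).surjective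
      (kap 𝔄 (toHomBim P Q f.1) (fun j => toHomBim P Q (f.2 j)) l)
    rw [← hC] at hc hk ⊢
    rw [cut_toHomBim_iff] at hc
    -- By `hk`, the matrix `C` is the value of the formal difference at the leading position, so the
    -- block of `P̄ f̄ - f̄ Q̄` at that position displays part of `C`. It remains to see that this
    -- block contains all places where `C` can be non-zero.
    have hC0 : ∀ (x : P.J) (y : Q.J), x.1 = (𝔄.lead l).1 → y.1 = (𝔄.lead l).2 →
        C x.toI y.toI = 0 := by
      intro x y hx hy
      rw [← (toHomBim P Q).symm_apply_apply C, ← hk, map_sub, Matrix.sub_apply, ← hx, ← hy,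
        ← bar_mul_barHom, ← barHom_mul_bar, h, sub_self]
    rw [show C = 0 from ?_, map_zero]
    ext ⟨X, a⟩ ⟨Y, b⟩
    by_contra hne
    obtain ⟨h1, h2⟩ := hc _ _ hne
    -- The classes of the leading position can be read off only if the entry there is non-zero. That
    -- entry is `1_X ⊗ 1_Y`, which acts as the identity on `C`; were it zero, `C` would vanish.
    have he : 𝔄.A.mat l (𝔄.lead l).1 (𝔄.lead l).2 ≠ 0 := by
      intro h0
      apply hne
      have := (supp_iff P Q (𝔄.A.src l) (𝔄.A.tgt l) C).1 hc
      rw [← this, ← 𝔄.lead_entry, h0, map_zero]; rfl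
    obtain ⟨h3, h4⟩ := 𝔄.A.supp l _ _ he
    simp only at h1 h2
    obtain rfl : X = 𝔄.cls (𝔄.lead l).1 := h1.trans h3.symm
    obtain rfl : Y = 𝔄.cls (𝔄.lead l).2 := h2.trans h4.symm
    exact hne (hC0 ⟨_, a⟩ ⟨_, b⟩ rfl rfl)
  · intro h
    have := (formalL_eq_formalR_iff 𝔄 _ hw).2 h
    ext x z
    rw [bar_mul_barHom, barHom_mul_bar, this]

/-- The morphism of `R(𝔅)` with given components. -/
noncomputable def toBHom (f : homs P Q) : P.toB.carrier →ₗ[k] Om 𝔄 →ₗ[k] Q.toB.carrier :=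
  RepB.ofBimHom (Om.lift 𝔄 (toHomBim P Q f.1.1) (fun j => toHomBim P Q (f.1.2 j))
    ((central_toHomBim_iff _).2 f.2.1) (fun j => (cut_toHomBim_iff _ _ _).2 (f.2.2.1 j))
    ((bar_comm_iff_kap f.1 f.2.1).1 f.2.2.2))

lemma toBHom_mem (f : homs P Q) : toBHom f ∈ RepB.homs P.toB Q.toB := RepB.ofBimHom_mem _

/-- Matrices as linear maps on row vectors. -/
noncomputable def toHom (P Q : RepA 𝔄) :
    Matrix P.I Q.I k ≃ₗ[k] (P.toB.carrier →ₗ[k] Q.toB.carrier) :=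
  rowMap

lemma toHom_mul (C : Matrix P.I Q.I k) (D : Matrix Q.I S.I k) :
    toHom P S (C * D) = RepB.homMul P.toB Q.toB S.toB (toHom P Q C) (toHom Q S D) := rowMap_mul C D

lemma toHom_one : toHom P P 1 = LinearMap.id := rowMap_one

lemma toBHom_ω (f : homs P Q) : (toBHom f).flip (Om.ω 𝔄) = toHom P Q f.1.1 :=
  Om.lift_ω 𝔄 (N := RepB.HomBim P.toB Q.toB) (hk := (bar_comm_iff_kap f.1 f.2.1).1 f.2.2.2) ..

lemma toBHom_v (f : homs P Q) (j : Fin 𝔄.m) : (toBHom f).flip (Om.v 𝔄 j) = toHom P Q (f.1.2 j) :=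
  Om.lift_v 𝔄 (N := RepB.HomBim P.toB Q.toB) (hk := (bar_comm_iff_kap f.1 f.2.1).1 f.2.2.2) ..

/-- `toHom` and `toHomBim` are the same map with two targets, the plain space of linear maps and the
same space as a `Γ`-`Γ`-bimodule. Composites are formed in the former and relations in the latter.
-/
lemma toHom_bim (u : T2 k 𝔄.R) (C : Matrix P.I Q.I k) :
    toHom P Q (bim P Q u C) = RepB.homBim P.toB Q.toB u (toHom P Q C) :=
  (bact_toHomBim u C).symm.trans (RepB.bact_homBim u (toHomBim P Q C))

lemma toHom_ev3 (C : Matrix P.I Q.I k) (D : Matrix Q.I S.I k) (c : T3 k 𝔄.R) :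
    toHom P S (ev3 (bim P Q) (bim Q S) matMul C D c) =
      ev3 (RepB.homBim P.toB Q.toB) (RepB.homBim Q.toB S.toB) (RepB.homMul P.toB Q.toB S.toB)
        (toHom P Q C) (toHom Q S D) c := by
  induction c using T3.ind with
  | h0 => simp
  | ha _ _ h1 h2 => simp only [map_add, h1, h2]
  | h r s t => rw [ev3_tmul, ev3_tmul, matMul_apply, toHom_mul, toHom_bim, toHom_bim]

/-- Both categories compose by the same expression in the constants `γ`, which involves only sums,
products and the `R`-`R`-action; the passage to row maps preserves all three. -/
lemma toHom_compv (f : homs P Q) (g : homs Q S) (l : Fin 𝔄.m) :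
    toHom P S (compv 𝔄 (bim P Q) (bim Q S) matMul f.1.1 f.1.2 g.1.1 g.1.2 l) =
      compv 𝔄 (RepB.homBim P.toB Q.toB) (RepB.homBim Q.toB S.toB)
        (RepB.homMul P.toB Q.toB S.toB) (toHom P Q f.1.1) (fun j => toHom P Q (f.1.2 j))
        (toHom Q S g.1.1) (fun j => toHom Q S (g.1.2 j)) l := by
  simp only [compv, map_add, map_sum, toHom_ev3, matMul_apply, toHom_mul]

variable (𝔄) in
/-- The functor `R(𝔄) → R(𝔅)`. -/
noncomputable def functorB : RepA 𝔄 ⥤ RepB 𝔄 where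
  obj P := P.toB
  map f := ⟨toBHom f, toBHom_mem f⟩
  -- Since `ω` and the `v_j` generate `Ω` as a bimodule, identities and composites need be compared
  -- only on these elements.
  map_id P := Subtype.ext <| RepB.hom_ext (toBHom_mem _) P.toB.idB_mem
    ((toBHom_ω _).trans (toHom_one.trans P.toB.idB_ω.symm))
    fun j => (toBHom_v _ j).trans ((map_zero _).trans (P.toB.idB_v j).symm)
  map_comp {P Q S} f g := Subtype.ext <| RepB.hom_ext (toBHom_mem _)
    (RepB.compB_mem (toBHom_mem f) (toBHom_mem g))
    (by
      refine (toBHom_ω _).trans ((toHom_mul _ _).trans ?_)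
      rw [← toBHom_ω, ← toBHom_ω]
      exact (RepB.compB_ω (toBHom_mem f) (toBHom_mem g)).symm)
    fun l => by
      refine (toBHom_v _ l).trans ((toHom_compv f g l).trans ?_)
      simp only [← toBHom_ω, ← toBHom_v]
      exact (RepB.compB_v (toBHom_mem f) (toBHom_mem g) l).symm

lemma functorB_map_ω (f : P ⟶ Q) :
    ((functorB 𝔄).map f).1.flip (Om.ω 𝔄) = toHom P Q (Subtype.val f).1 := toBHom_ω f

lemma functorB_map_v (f : P ⟶ Q) (j : Fin 𝔄.m) :
    ((functorB 𝔄).map f).1.flip (Om.v 𝔄 j) = toHom P Q ((Subtype.val f).2 j) := toBHom_v f j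

/-- The values of the image at `ω` and the `v_j` are the components of the family, up to the
injective passage from matrices to linear maps. -/
instance : (functorB 𝔄).Faithful where
  map_injective {P Q f g} h := by
    refine Subtype.ext (Prod.ext ?_ (funext fun j => ?_))
    · apply (toHom P Q).injective
      rw [← functorB_map_ω, ← functorB_map_ω, h]
    · apply (toHom P Q).injective
      rw [← functorB_map_v, ← functorB_map_v, h]

/-- The candidate preimage consists of the matrices of the values at `ω` and the `v_j`. Centrality
of `ω`, the cut of `v_j` and the vanishing of `kap` supply, in this order, the three conditions that
define a morphism of `R(𝔄)`. -/
instance : (functorB 𝔄).Full where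
  map_surjective {P Q} F := by
    have hF : F.1 ∈ RepB.homs P.toB Q.toB := F.2
    let f0 : Matrix P.I Q.I k := (toHomBim P Q).symm (RepB.HomBim.of (F.1.flip (Om.ω 𝔄)))
    let f1 : Fin 𝔄.m → Matrix P.I Q.I k :=
      fun j => (toHomBim P Q).symm (RepB.HomBim.of (F.1.flip (Om.v 𝔄 j)))
    have e0 : toHomBim P Q f0 = RepB.HomBim.of (F.1.flip (Om.ω 𝔄)) :=
      LinearEquiv.apply_symm_apply _ _
    have e1 : ∀ j, toHomBim P Q (f1 j) = RepB.HomBim.of (F.1.flip (Om.v 𝔄 j)) :=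
      fun j => LinearEquiv.apply_symm_apply _ _
    have h0 : ∀ r, P.rho r * f0 = f0 * Q.rho r := by
      rw [← central_toHomBim_iff, e0]; exact RepB.hom_bact_central hF
    have hf : (f0, f1) ∈ homs P Q := by
      refine ⟨h0, fun j => ?_, (bar_comm_iff_kap (f0, f1) h0).2 fun l => ?_⟩
      · refine (cut_toHomBim_iff _ _ _).1 ?_
        dsimp only
        rw [e1]; exact RepB.hom_v_cut hF j
      · simp only [e0, e1]
        exact RepB.hom_kap hF l
    refine ⟨⟨(f0, f1), hf⟩, Subtype.ext (RepB.hom_ext (toBHom_mem _) hF ?_ fun j => ?_)⟩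
    · exact (toBHom_ω _).trans e0
    · exact (toBHom_v _ j).trans (e1 j)

instance : (functorB 𝔄).Additive where
  map_add {P Q f g} := Subtype.ext <| RepB.hom_ext (toBHom_mem _)
    ((RepB.homs P.toB Q.toB).add_mem (toBHom_mem f) (toBHom_mem g))
    ((functorB_map_ω _).trans ((map_add _ _ _).trans
      (congrArg₂ (· + ·) (functorB_map_ω f).symm (functorB_map_ω g).symm)))
    fun j => (functorB_map_v _ j).trans ((map_add _ _ _).trans
      (congrArg₂ (· + ·) (functorB_map_v f j).symm (functorB_map_v g j).symm))

instance : (functorB 𝔄).Linear k where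
  map_smul {P Q} f c := Subtype.ext <| RepB.hom_ext (toBHom_mem _)
    ((RepB.homs P.toB Q.toB).smul_mem c (toBHom_mem f))
    ((functorB_map_ω _).trans ((map_smul _ _ _).trans
      (congrArg (c • ·) (functorB_map_ω f).symm)))
    fun j => (functorB_map_v _ j).trans ((map_smul _ _ _).trans
      (congrArg (c • ·) (functorB_map_v f j).symm))

end RepA

end Comparison

/-! ### Bases of Jordan chains -/

section ChainBasis

open Polynomial

variable {k : Type u} [Field k]

/-- The substitution `X ↦ X + c` turns a combination that vanishes modulo `(X - c)^e` into a
combination of the powers below `X^e` that is divisible by `X^e`, and comparing coefficients shows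
that it is trivial. -/
lemma linearIndependent_X_sub_C_pow_quotient (c : k) (e : ℕ) :
    LinearIndependent k fun j : Fin e =>
      (Submodule.Quotient.mk ((X - C c) ^ (j : ℕ)) : k[X] ⧸ k[X] ∙ (X - C c) ^ e) := by
  rw [Fintype.linearIndependent_iff]
  intro g hg
  have h1 : (∑ j : Fin e, g j • (X - C c) ^ (j : ℕ)) ∈ k[X] ∙ (X - C c) ^ e := by
    rw [← Submodule.Quotient.mk_eq_zero, ← hg, ← Submodule.mkQ_apply, map_sum]
    refine Finset.sum_congr rfl fun j _ => ?_
    exact map_smul ((k[X] ∙ (X - C c) ^ e).mkQ.restrictScalars k) _ _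
  rw [Submodule.mem_span_singleton] at h1
  obtain ⟨q, hq⟩ := h1
  have h2 : X ^ e ∣ ∑ j : Fin e, g j • (X : k[X]) ^ (j : ℕ) := by
    refine ⟨q.comp (X + C c), ?_⟩
    have := congrArg (fun p => p.comp (X + C c)) hq
    simp only [smul_eq_mul, mul_comp, pow_comp, sub_comp, X_comp, C_comp, add_sub_cancel_right] at this
    rw [mul_comm, this, Polynomial.sum_comp]
    refine Finset.sum_congr rfl fun j _ => ?_
    simp [smul_comp]
  intro i
  rw [X_pow_dvd_iff] at h2
  have h3 := h2 i i.2
  rw [finsetSum_coeff, Finset.sum_eq_single i] at h3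
  · simpa using h3
  · intro j _ hj
    rw [coeff_smul, coeff_X_pow, if_neg (fun h => hj (Fin.ext h.symm)), smul_zero]
  · intro h; exact absurd (Finset.mem_univ _) h

/-- The basis `(X - c)^j` of `k[X] / (X - c)^e`. -/
noncomputable def quotientBasis (c : k) (e : ℕ) :
    Module.Basis (Fin e) k (k[X] ⧸ k[X] ∙ (X - C c) ^ e) :=
  Module.Basis.mk (linearIndependent_X_sub_C_pow_quotient c e) (by
    have : Module.Finite k (k[X] ⧸ k[X] ∙ (X - C c) ^ e) :=
      ((monic_X_sub_C c).pow e).finite_quotient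
    rw [LinearIndependent.span_eq_top_of_card_eq_finrank'
      (linearIndependent_X_sub_C_pow_quotient c e)]
    refine (Fintype.card_fin e).trans ?_
    refine Eq.trans ?_ (finrank_quotient_span_eq_natDegree (f := (X - C c) ^ e)).symm
    rw [natDegree_pow, natDegree_X_sub_C, mul_one])

lemma quotientBasis_apply (c : k) (e : ℕ) (j : Fin e) :
    quotientBasis c e j = Submodule.Quotient.mk ((X - C c) ^ (j : ℕ)) := by
  simp [quotientBasis]

/-- Write `X = c + (X - c)`: multiplication by `X - c` shifts the basis, and the chain stops at its
last vector because `(X - c)^e` is zero in the quotient. -/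
lemma X_smul_quotientBasis (c : k) (e : ℕ) (j : Fin e) :
    (X : k[X]) • quotientBasis c e j = c • quotientBasis c e j +
      if h : (j : ℕ) + 1 < e then quotientBasis c e ⟨j + 1, h⟩ else 0 := by
  have h0 : (X : k[X]) • quotientBasis c e j = c • quotientBasis c e j +
      Submodule.Quotient.mk ((X - C c) ^ ((j : ℕ) + 1)) := by
    rw [quotientBasis_apply, ← Submodule.Quotient.mk_smul, ← Submodule.Quotient.mk_smul,
      ← Submodule.Quotient.mk_add]
    congr 1
    rw [smul_eq_mul, smul_eq_C_mul]
    ring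
  rw [h0]
  congr 1
  split_ifs with h
  · rw [quotientBasis_apply]
  · rw [Submodule.Quotient.mk_eq_zero, show (j : ℕ) + 1 = e by have := j.2; omega]
    exact Submodule.mem_span_singleton_self _

/-- Jordan's theorem: over an algebraically closed field, an endomorphism of a finite-dimensional
space has a basis that consists of Jordan chains. -/
theorem exists_chain_basis [IsAlgClosed k] {V : Type*} [AddCommGroup V] [Module k V]
    [FiniteDimensional k V] (T : Module.End k V) :
    ∃ (ι : Type u) (_ : Fintype ι) (c : ι → k) (e : ι → ℕ)
      (b : Module.Basis (Σ i, Fin (e i)) k V), ∀ i (j : Fin (e i)),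
        T (b ⟨i, j⟩) = c i • b ⟨i, j⟩ +
          if h : (j : ℕ) + 1 < e i then b ⟨i, ⟨j + 1, h⟩⟩ else 0 := by
  classical
  -- Let `X` act on `V` as `T`. The resulting `k[X]`-module is torsion because `V` is
  -- finite-dimensional, and the structure theorem over a principal ideal domain splits it into
  -- cyclic modules of prime power order.
  obtain ⟨ι, hι, p, hp, e, ⟨E⟩⟩ := Module.equiv_directSum_of_isTorsion
    (Module.AEval.isTorsion_of_finiteDimensional k V T)
  -- Over an algebraically closed field an irreducible polynomial is linear, hence associated to `X
  -- - c` for its root `c`; the ideals of their powers then agree.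
  have hc : ∀ i, ∃ c : k, k[X] ∙ p i ^ e i = k[X] ∙ (X - C c) ^ e i := by
    intro i
    obtain ⟨c, hc⟩ := exists_root_of_degree_eq_one
      (IsAlgClosed.degree_eq_one_of_irreducible k (hp i))
    refine ⟨c, ?_⟩
    have h1 : Associated (p i) (X - C c) :=
      ((irreducible_X_sub_C c).associated_of_dvd (hp i) (dvd_iff_isRoot.2 hc)).symm
    exact Ideal.span_singleton_eq_span_singleton.2 h1.pow_pow
  choose c hc using hc
  let E' : Module.AEval' T ≃ₗ[k[X]] Π₀ i, k[X] ⧸ k[X] ∙ (X - C (c i)) ^ e i :=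
    E.trans (DFinsupp.mapRange.linearEquiv fun i => Submodule.quotEquivOfEq _ _ (hc i))
  let B := DFinsupp.basis fun i => quotientBasis (c i) (e i)
  let F : V ≃ₗ[k] Π₀ i, k[X] ⧸ k[X] ∙ (X - C (c i)) ^ e i :=
    (Module.AEval'.of T).trans (E'.restrictScalars k)
  have hF : ∀ v, F (T v) = (X : k[X]) • F v := by
    intro v
    change E' (Module.AEval'.of T (T v)) = X • E' (Module.AEval'.of T v)
    rw [← Module.AEval'.X_smul_of, map_smul]
  have hB : ∀ i j, B ⟨i, j⟩ = DFinsupp.single i (quotientBasis (c i) (e i) j) := by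
    intro i j
    simp [B, DFinsupp.basis]
  have hBX : ∀ i (j : Fin (e i)), (X : k[X]) • B ⟨i, j⟩ = c i • B ⟨i, j⟩ +
      if h : (j : ℕ) + 1 < e i then B ⟨i, ⟨j + 1, h⟩⟩ else 0 := by
    intro i j
    rw [hB, ← DFinsupp.single_smul, X_smul_quotientBasis, DFinsupp.single_add,
      DFinsupp.single_smul]
    congr 1
    split_ifs with h
    · rw [hB]
    · exact DFinsupp.single_zero _
  refine ⟨ι, hι, c, e, B.map F.symm, fun i j => F.injective ?_⟩
  rw [hF, map_add, map_smul, Module.Basis.map_apply, LinearEquiv.apply_symm_apply, hBX]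
  congr 1
  split_ifs with h
  · rw [Module.Basis.map_apply, LinearEquiv.apply_symm_apply]
  · rw [map_zero]

/-- The matrix of an endomorphism in a basis of Jordan chains. -/
lemma repr_chain_basis {V ι : Type*} [AddCommGroup V] [Module k V] [DecidableEq ι]
    (T : Module.End k V) (c : ι → k) (e : ι → ℕ) (b : Module.Basis (Σ i, Fin (e i)) k V)
    (hb : ∀ i (j : Fin (e i)), T (b ⟨i, j⟩) = c i • b ⟨i, j⟩ +
      if h : (j : ℕ) + 1 < e i then b ⟨i, ⟨j + 1, h⟩⟩ else 0)
    (i i' : ι) (j : Fin (e i)) (j' : Fin (e i')) :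
    b.repr (T (b ⟨i, j⟩)) ⟨i', j'⟩ = if i = i' ∧ (j : ℕ) = j' then c i
      else if i = i' ∧ (j : ℕ) + 1 = j' then 1 else 0 := by
  have key : ∀ l : Fin (e i), b.repr (b ⟨i, l⟩) ⟨i', j'⟩ =
      if i = i' ∧ (l : ℕ) = j' then 1 else 0 := by
    intro l
    rw [Module.Basis.repr_self, Finsupp.single_apply]
    congr 1
    by_cases h : i = i'
    · subst h; simp [Fin.ext_iff]
    · simp [h]
  rw [hb, map_add, map_smul, Finsupp.add_apply, Finsupp.smul_apply, key]
  have h2 : b.repr (if h : (j : ℕ) + 1 < e i then b ⟨i, ⟨j + 1, h⟩⟩ else 0) ⟨i', j'⟩ =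
      if i = i' ∧ (j : ℕ) + 1 = j' then 1 else 0 := by
    split_ifs with h h' h'
    · rw [key, if_pos h']
    · rw [key, if_neg h']
    · exfalso
      obtain ⟨rfl, h3⟩ := h'
      have := j'.2
      omega
    · simp
  rw [h2]
  -- The diagonal condition `j = j'` and the superdiagonal condition `j + 1 = j'` exclude each
  -- other, so the sum of two indicators becomes a nested case distinction.
  by_cases h : i = i' ∧ (j : ℕ) = j'
  · rw [if_pos h, if_pos h, if_neg (by omega)]; simp
  · rw [if_neg h, if_neg h]; simp

end ChainBasis

/-! ### From Jordan chains to the Weyr form -/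

section WeyrForm

/-- For antitone `g` the set where `j < g` is an initial segment, so a place lies in it exactly when
it is smaller than the number of its elements. With `g` the lengths of sorted chains, this
identifies the places in block `j` with the chains that reach position `j`. -/
lemma antitone_lt_card_iff {n : ℕ} {g : Fin n → ℕ} (hg : Antitone g) (j : ℕ) (a : Fin n) :
    (a : ℕ) < (Finset.univ.filter fun x => j < g x).card ↔ j < g a := by
  constructor
  · intro h
    by_contra h1
    have : (Finset.univ.filter fun x => j < g x) ⊆ Finset.Iio a := by
      intro x hx
      rw [Finset.mem_filter] at hx
      rw [Finset.mem_Iio]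
      by_contra h2
      exact h1 (hx.2.trans_le (hg (not_lt.1 h2)))
    have := Finset.card_le_card this
    rw [Fin.card_Iio] at this
    omega
  · intro h
    have : Finset.Iic a ⊆ (Finset.univ.filter fun x => j < g x) := by
      intro x hx
      rw [Finset.mem_Iic] at hx
      exact Finset.mem_filter.2 ⟨Finset.mem_univ _, h.trans_le (hg hx)⟩
    have := Finset.card_le_card this
    rw [Fin.card_Iic] at this
    omega

lemma exists_antitone_enum {α : Type*} [Fintype α] (e : α → ℕ) :
    ∃ ε : Fin (Fintype.card α) ≃ α, Antitone fun a => e (ε a) := by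
  let ε₀ := (Fintype.equivFin α).symm
  let f : Fin (Fintype.card α) → ℕᵒᵈ := fun a => OrderDual.toDual (e (ε₀ a))
  exact ⟨(Tuple.sort f).trans ε₀, fun a b h => Tuple.monotone_sort f h⟩

variable {k : Type u} [Field k]

/-- The Weyr canonical form: over an algebraically closed field, every endomorphism of a
finite-dimensional space has a Weyr matrix, for the action on row vectors. -/
theorem exists_weyr_basis [IsAlgClosed k] {V : Type*} [AddCommGroup V] [Module k V]
    [FiniteDimensional k V] (T : Module.End k V) :
    ∃ (d : ℕ) (B : Module.Basis (Fin d) k V), IsWeyr (LinearMap.toMatrix B B T).transpose := by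
  classical
  obtain ⟨ι, _, c, e, b, hb⟩ := exists_chain_basis T
  -- Different chains may share an eigenvalue, whereas the Weyr form asks for distinct ones; hence
  -- the image of `c` is enumerated, without repetition.
  let lam := (Finset.univ.image c).equivFin.symm
  have hlam : ∀ x, ∃ i, (lam i : k) = c x := fun x =>
    ⟨lam.symm ⟨c x, Finset.mem_image_of_mem c (Finset.mem_univ x)⟩, by simp⟩
  have hinj : Function.Injective fun i => (lam i : k) :=
    Subtype.val_injective.comp lam.injective
  -- For each eigenvalue, its chains are listed by non-increasing length.
  choose ε hε using fun i => exists_antitone_enum fun x : {x : ι // c x = (lam i : k)} => e x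
  -- Every eigenvalue receives the same number of blocks, the maximal length of a chain. Blocks
  -- beyond the chains of a given eigenvalue have size zero, which the definition of a Weyr matrix
  -- permits.
  let D := Finset.univ.sup e
  -- The size of block `j` is the number of chains longer than `j`, so the Weyr block sizes form the
  -- partition conjugate to the Jordan chain lengths.
  let β : (i : Fin (Finset.univ.image c).card) → Fin D → ℕ :=
    fun i j => (Finset.univ.filter fun a => (j : ℕ) < e (ε i a)).card
  have hβ : ∀ i (j : Fin D) (a : Fin (β i j)), (a : ℕ) <
      Fintype.card {x : ι // c x = (lam i : k)} := fun i j a =>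
    a.2.trans_le ((Finset.card_le_univ _).trans (Fintype.card_fin _).le)
  have hβ' : ∀ i (j : Fin D) (a : Fin (β i j)), (j : ℕ) < e (ε i ⟨a, hβ i j a⟩) :=
    fun i j a => (antitone_lt_card_iff (hε i) j ⟨a, hβ i j a⟩).1 a.2
  -- Place `a` of block `j` is the vector number `j` of the chain number `a`. The lexicographic
  -- order on the left thus puts the position in the chain before the number of the chain.
  let φ : (Σₗ (i : Fin (Finset.univ.image c).card), Σₗ (j : Fin D), Fin (β i j)) →
      Σ x : ι, Fin (e x) := fun z =>
    ⟨ε (ofLex z).1 ⟨(ofLex (ofLex z).2).2, hβ _ _ _⟩, ⟨(ofLex (ofLex z).2).1, hβ' _ _ _⟩⟩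
  -- A chain determines its eigenvalue, hence `i` since the listed eigenvalues are distinct, and
  -- then its number in the sorted list.
  have hx : ∀ (i i') (j j' : Fin D) (a : Fin (β i j)) (a' : Fin (β i' j')),
      (ε i ⟨a, hβ i j a⟩ : ι) = ε i' ⟨a', hβ i' j' a'⟩ ↔ i = i' ∧ (a : ℕ) = a' := by
    intro i i' j j' a a'
    constructor
    · intro h
      have h1 : i = i' := hinj (by
        change (lam i : k) = lam i'
        rw [← (ε i ⟨a, hβ i j a⟩).2, ← (ε i' ⟨a', hβ i' j' a'⟩).2, h])
      subst h1
      refine ⟨rfl, ?_⟩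
      have := (ε i).injective (Subtype.ext h)
      exact congrArg Fin.val this
    · rintro ⟨rfl, h⟩
      congr 2
      exact Fin.ext h
  have hφ : Function.Bijective φ := by
    constructor
    · intro z z' h
      have h1 := congrArg Sigma.fst h
      have h2 : ((φ z).2 : ℕ) = (φ z').2 := by rw [h]
      obtain ⟨i, j, a⟩ := z
      obtain ⟨i', j', a'⟩ := z'
      obtain ⟨rfl, h3⟩ := (hx i i' j j' a a').1 h1
      obtain rfl : j = j' := Fin.ext h2
      obtain rfl : a = a' := Fin.ext h3
      rfl
    · rintro ⟨x, j⟩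
      obtain ⟨i, hi⟩ := hlam x
      let a := (ε i).symm ⟨x, hi.symm⟩
      have ha : ε i a = ⟨x, hi.symm⟩ := Equiv.apply_symm_apply _ _
      have hj : (j : ℕ) < D := j.2.trans_le (Finset.le_sup (Finset.mem_univ x))
      have hab : (a : ℕ) < β i ⟨j, hj⟩ := by
        refine (antitone_lt_card_iff (hε i) j a).2 ?_
        rw [ha]; exact j.2
      refine ⟨toLex ⟨i, toLex ⟨⟨j, hj⟩, ⟨a, hab⟩⟩⟩, ?_⟩
      have h1 : ((ε i ⟨a, hβ i ⟨j, hj⟩ ⟨a, hab⟩⟩ : {x // c x = (lam i : k)}) : ι) = x :=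
        congrArg Subtype.val ha
      change (⟨(ε i ⟨a, _⟩ : {x // c x = (lam i : k)}), ⟨j, _⟩⟩ : Σ x : ι, Fin (e x)) = ⟨x, j⟩
      refine Sigma.ext h1 ?_
      refine (Fin.heq_ext_iff (congrArg e h1)).2 rfl
  let d := Fintype.card (Σₗ (i : Fin (Finset.univ.image c).card), Σₗ (j : Fin D), Fin (β i j))
  -- The Weyr form prescribes the order of rows and columns, so the places are numbered along the
  -- lexicographic order.
  let o := (Fintype.orderIsoFinOfCardEq
    (Σₗ (i : Fin (Finset.univ.image c).card), Σₗ (j : Fin D), Fin (β i j)) (k := d) rfl).symm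
  let B := b.reindex ((Equiv.ofBijective φ hφ).symm.trans o.toEquiv)
  have hB : ∀ z, B (o z) = b (φ z) := fun z => by simp [B]
  refine ⟨d, B, _, fun i => lam i, fun _ => D, β, o, hinj, fun i j j' h => ?_, ?_⟩
  · refine Finset.card_le_card fun a ha => ?_
    rw [Finset.mem_filter] at ha ⊢
    exact ⟨ha.1, lt_of_le_of_lt h ha.2⟩
  · intro i i' j j' a a'
    -- In the row convention the row of a chain vector lists the coordinates of its image. Since `T`
    -- moves each vector to the next one in its chain, the ones appear on the superdiagonal.
    rw [Matrix.transpose_apply, LinearMap.toMatrix_apply, hB]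
    have hr : ∀ v z, B.repr v (o z) = b.repr v (φ z) := fun v z => by
      rw [Module.Basis.repr_reindex_apply]; simp
    rw [hr]
    refine (repr_chain_basis T c e b hb _ _ _ _).trans ?_
    have h1 := hx i i' j j' a a'
    have h2 : c (ε i ⟨a, hβ i j a⟩) = lam i := (ε i ⟨a, hβ i j a⟩).2
    refine Eq.trans (b := if (ε i ⟨a, hβ i j a⟩ : ι) = ε i' ⟨a', hβ i' j' a'⟩ ∧ (j : ℕ) = j'
      then c (ε i ⟨a, hβ i j a⟩) else if (ε i ⟨a, hβ i j a⟩ : ι) = ε i' ⟨a', hβ i' j' a'⟩ ∧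
      (j : ℕ) + 1 = j' then 1 else 0) rfl ?_
    rw [h2]
    simp only [h1, and_assoc, and_comm (a := (a : ℕ) = a')]

end WeyrForm

/-! ### Regular Weyr matrices for modules over `R_X` -/

section RegularBasis

variable {k : Type u} [Field k]

/-- The matrices of a commutative algebra of endomorphisms, acting on row vectors. -/
noncomputable def rowMatrixHom {R V ι : Type*} [CommRing R] [Algebra k R] [AddCommGroup V]
    [Module k V] [Fintype ι] [DecidableEq ι] (B : Module.Basis ι k V)
    (θ : R →ₐ[k] Module.End k V) : R →ₐ[k] Matrix ι ι k :=
  AlgHom.ofLinearMap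
    ((Matrix.transposeLinearEquiv ι ι k k).toLinearMap ∘ₗ (LinearMap.toMatrix B B).toLinearMap ∘ₗ
      θ.toLinearMap)
    (by simp [LinearMap.toMatrix_one])
    (fun r s => by
      simp only [LinearMap.comp_apply, AlgHom.toLinearMap_apply, LinearEquiv.coe_coe]
      -- Transposition reverses products, and commutativity of `R` makes the reversal harmless.
      rw [mul_comm, map_mul, LinearMap.toMatrix_mul]
      simp [Matrix.transpose_mul])

lemma rowMatrixHom_apply {R V ι : Type*} [CommRing R] [Algebra k R] [AddCommGroup V]
    [Module k V] [Fintype ι] [DecidableEq ι] (B : Module.Basis ι k V)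
    (θ : R →ₐ[k] Module.End k V) (r : R) :
    rowMatrixHom B θ r = (LinearMap.toMatrix B B (θ r)).transpose := rfl

/-- The inclusion of `k[x]` in `k[x, φ(x)⁻¹]`. -/
noncomputable def LocAlg.ofPoly (p : {p : k[X] // p ≠ 0}) : k[X] →ₐ[k] LocAlg k (some p) :=
  Algebra.algHom k k[X] (Localization.Away p.1)

/-- The value at `x` fixes a homomorphism on `k[x]`, and every element of the localization is a
fraction whose denominator is sent to a unit, which can be cancelled. -/
lemma LocAlg.algHom_ext {p : {p : k[X] // p ≠ 0}} {S : Type*} [Ring S] [Algebra k S]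
    {f g : LocAlg k (some p) →ₐ[k] S}
    (h : f (LocAlg.ofPoly p Polynomial.X) = g (LocAlg.ofPoly p Polynomial.X)) : f = g := by
  have h1 : f.comp (LocAlg.ofPoly p) = g.comp (LocAlg.ofPoly p) := Polynomial.algHom_ext h
  ext z
  obtain ⟨⟨x, s⟩, hz⟩ := IsLocalization.surj (M := Submonoid.powers p.1)
    (S := Localization.Away p.1) z
  have hz' : z * LocAlg.ofPoly p s.1 = LocAlg.ofPoly p x := hz
  have hu : IsUnit (LocAlg.ofPoly p s.1) :=
    IsLocalization.map_units (M := Submonoid.powers p.1) (Localization.Away p.1) s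
  have hf : f z * f (LocAlg.ofPoly p s.1) = f (LocAlg.ofPoly p x) := by rw [← map_mul, hz']
  have hg : g z * g (LocAlg.ofPoly p s.1) = g (LocAlg.ofPoly p x) := by rw [← map_mul, hz']
  have e : ∀ y, f (LocAlg.ofPoly p y) = g (LocAlg.ofPoly p y) := fun y => DFunLike.congr_fun h1 y
  rw [e, e, ← hg] at hf
  exact (hu.map g).mul_left_injective hf

variable [IsAlgClosed k]

lemma evalLoc_X (p : {p : k[X] // p ≠ 0}) {d : ℕ} (W : Matrix (Fin d) (Fin d) k)
    (hW : IsRegularWeyr (some p) W) :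
    evalLoc (some p) W hW (LocAlg.ofPoly p Polynomial.X) = W := by
  refine (OreLocalization.universalHom_commutes _ _ _).trans ?_
  simp

/-- A finite-dimensional module over `k` or `k[x, φ(x)⁻¹]` has a basis in which the action on row
vectors is given by an `R_X`-regular Weyr matrix. -/
theorem exists_regular_basis (o : Option {p : k[X] // p ≠ 0}) {V : Type*} [AddCommGroup V]
    [Module k V] [FiniteDimensional k V] (θ : LocAlg k o →ₐ[k] Module.End k V) :
    ∃ (d : ℕ) (B : Module.Basis (Fin d) k V) (W : Matrix (Fin d) (Fin d) k)
      (hW : IsRegularWeyr o W), rowMatrixHom B θ = evalLoc o W hW := by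
  cases o with
  | none =>
    -- At a trivial vertex the algebra is `k`, which acts by scalars in every basis; any basis will
    -- do, with the identity as `W`.
    refine ⟨_, Module.finBasis k V, 1, rfl, AlgHom.ext fun r => ?_⟩
    exact ((rowMatrixHom (Module.finBasis k V) θ).commutes r).trans
      ((evalLoc none (1 : Matrix (Fin _) (Fin _) k) rfl).commutes r).symm
  | some p =>
    obtain ⟨d, B, hB⟩ := exists_weyr_basis (θ (LocAlg.ofPoly p Polynomial.X))
    let W := rowMatrixHom B θ (LocAlg.ofPoly p Polynomial.X)
    have hW : IsRegularWeyr (some p) W := by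
      -- An eigenvalue `c` with `φ(c) = 0` would put `0` into the spectrum of `φ(W)`. But `φ` is
      -- invertible in the localization, which acts on the module, so `φ(W)` is invertible.
      refine ⟨hB, fun c hc hp => ?_⟩
      have h1 : (rowMatrixHom B θ).comp (LocAlg.ofPoly p) = Polynomial.aeval W :=
        Polynomial.algHom_ext (by simp [W])
      have h2 : IsUnit (Polynomial.aeval W p.1) := by
        rw [← h1]
        exact (IsLocalization.Away.algebraMap_isUnit (S := Localization.Away p.1) p.1).map
          (rowMatrixHom B θ)
      have h3 := spectrum.subset_polynomial_aeval W p.1 ⟨c, hc, rfl⟩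
      simp only [hp] at h3
      exact (spectrum.zero_mem_iff k).1 h3 h2
    exact ⟨d, B, W, hW, LocAlg.algHom_ext (evalLoc_X p W hW).symm⟩

end RegularBasis

/-! ### Decomposition of a `Γ`-module over the vertices -/

section VertexDecomposition

variable {k : Type u} [Field k]

namespace MinAlg

/-- The element of `R` with a given component at `X` and `0` elsewhere. -/
noncomputable def single (B : MinAlg k) (X : B.Vert) (r : LocAlg k (B.loc X)) : B.R :=
  (Pi.single X r : ∀ X : B.Vert, LocAlg k (B.loc X))

variable (B : MinAlg k) (X Y : B.Vert)

lemma single_one : B.single X 1 = B.e X := rfl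

lemma single_add (r s : LocAlg k (B.loc X)) :
    B.single X (r + s) = B.single X r + B.single X s :=
  Pi.single_add (f := fun X => LocAlg k (B.loc X)) X r s

lemma single_smul (c : k) (r : LocAlg k (B.loc X)) : B.single X (c • r) = c • B.single X r :=
  Pi.single_smul (f := fun X => LocAlg k (B.loc X)) X c r

lemma single_mul (r s : LocAlg k (B.loc X)) :
    B.single X (r * s) = B.single X r * B.single X s :=
  Pi.single_mul (α := fun X => LocAlg k (B.loc X)) X r s

lemma e_mul_single (r : LocAlg k (B.loc X)) : B.e X * B.single X r = B.single X r := by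
  rw [← single_one, ← single_mul, one_mul]

lemma mul_e (r : B.R) : r * B.e X = B.single X (r X) := by
  refine funext fun Y => ?_
  change r Y * (Pi.single X 1 : ∀ X : B.Vert, LocAlg k (B.loc X)) Y =
    (Pi.single X (r X) : ∀ X : B.Vert, LocAlg k (B.loc X)) Y
  by_cases h : Y = X
  · subst h; rw [Pi.single_eq_same, Pi.single_eq_same, mul_one]
  · rw [Pi.single_eq_of_ne h, Pi.single_eq_of_ne h, mul_zero]

variable {X Y} in
lemma e_mul_e_of_ne (h : X ≠ Y) : B.e X * B.e Y = 0 := by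
  rw [mul_e]
  have : B.e X Y = 0 := Pi.single_eq_of_ne h.symm _
  rw [this]
  exact Pi.single_zero (M := fun X => LocAlg k (B.loc X)) Y

lemma sum_e : ∑ X, B.e X = 1 :=
  Finset.univ_sum_single (M := fun X => LocAlg k (B.loc X)) 1

end MinAlg

variable {𝔄 : MatrixBimoduleProblem k}

namespace RepB

variable (P : RepB 𝔄)

open MulOpposite

/-- The component `P 1_X` of `P` at a vertex. -/
noncomputable def comp (X : 𝔄.Vert) : Submodule k P.carrier :=
  LinearMap.range (P.mul (Gam.inc 𝔄 (𝔄.base.e X)))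

lemma mul_single_mem_comp (X : 𝔄.Vert) (r : LocAlg k (𝔄.base.loc X)) (p : P.carrier) :
    P.mul (Gam.inc 𝔄 (𝔄.base.single X r)) p ∈ P.comp X :=
  ⟨_, by rw [← mul_mul, ← map_mul, mul_comm, 𝔄.base.e_mul_single]⟩

lemma mul_e_comp {X : 𝔄.Vert} (p : P.comp X) : P.mul (Gam.inc 𝔄 (𝔄.base.e X)) p = p := by
  obtain ⟨_, q, rfl⟩ := p
  rw [← mul_mul, ← map_mul, MinAlg.e_mul_self]

lemma mul_e_comp_of_ne {X Y : 𝔄.Vert} (h : X ≠ Y) (p : P.comp X) :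
    P.mul (Gam.inc 𝔄 (𝔄.base.e Y)) p = 0 := by
  rw [← mul_e_comp, ← mul_mul, ← map_mul, 𝔄.base.e_mul_e_of_ne h, map_zero, mul, op_zero, map_zero]
  rfl

lemma mul_add' (g h : Gam 𝔄) : P.mul (g + h) = P.mul g + P.mul h := by
  simp [mul]

lemma mul_smul' (c : k) (g : Gam 𝔄) : P.mul (c • g) = c • P.mul g := by
  simp [mul]

lemma mul_sum' {ι : Type*} (s : Finset ι) (g : ι → Gam 𝔄) :
    P.mul (∑ i ∈ s, g i) = ∑ i ∈ s, P.mul (g i) := by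
  simp [mul]

/-- The action of `R_X` on `P 1_X`. -/
noncomputable def compAct (X : 𝔄.Vert) : LocAlg k (𝔄.base.loc X) →ₐ[k] Module.End k (P.comp X) :=
  AlgHom.ofLinearMap
    { toFun := fun r => (P.mul (Gam.inc 𝔄 (𝔄.base.single X r))).restrict
        fun p _ => P.mul_single_mem_comp X r p
      map_add' := fun r s => LinearMap.ext fun p => Subtype.ext <| by
        change P.mul (Gam.inc 𝔄 (𝔄.base.single X (r + s))) p =
          P.mul (Gam.inc 𝔄 (𝔄.base.single X r)) p + P.mul (Gam.inc 𝔄 (𝔄.base.single X s)) p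
        rw [MinAlg.single_add, map_add, mul_add', LinearMap.add_apply]
      map_smul' := fun c r => LinearMap.ext fun p => Subtype.ext <| by
        change P.mul (Gam.inc 𝔄 (𝔄.base.single X (c • r))) p =
          c • P.mul (Gam.inc 𝔄 (𝔄.base.single X r)) p
        rw [MinAlg.single_smul, map_smul, mul_smul', LinearMap.smul_apply] }
    (LinearMap.ext fun p => Subtype.ext (P.mul_e_comp p))
    (fun r s => LinearMap.ext fun p => Subtype.ext <| by
      change P.mul (Gam.inc 𝔄 (𝔄.base.single X (r * s))) p =
        P.mul (Gam.inc 𝔄 (𝔄.base.single X r)) (P.mul (Gam.inc 𝔄 (𝔄.base.single X s)) p)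
      rw [mul_comm, MinAlg.single_mul, map_mul, mul_mul])

/-- Vectors of `P 1_X` are fixed by `1_X`, so of an element of `R` they feel only its component at
`X`. -/
lemma compAct_apply (X : 𝔄.Vert) (r : 𝔄.R) (p : P.comp X) :
    (P.compAct X (r X) p : P.carrier) = P.mul (Gam.inc 𝔄 r) p := by
  change P.mul (Gam.inc 𝔄 (𝔄.base.single X (r X))) p = _
  rw [← MinAlg.mul_e, mul_comm, map_mul, mul_mul, mul_e_comp]

/-- The decomposition `P = ⊕_X P 1_X`. -/
noncomputable def decomp : P.carrier ≃ₗ[k] ∀ X, P.comp X :=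
  LinearEquiv.ofLinearMap
    (LinearMap.pi fun X => (P.mul (Gam.inc 𝔄 (𝔄.base.e X))).rangeRestrict)
    (∑ X, (P.comp X).subtype ∘ₗ LinearMap.proj X)
    (by
      refine LinearMap.pi_ext fun X p => funext fun Y => Subtype.ext ?_
      simp only [LinearMap.comp_apply, LinearMap.sum_apply, LinearMap.proj_apply,
        Submodule.subtype_apply, LinearMap.id_apply]
      change P.mul (Gam.inc 𝔄 (𝔄.base.e Y)) _ = _
      rw [map_sum, Finset.sum_eq_single Y]
      · exact P.mul_e_comp _
      · intro Z _ hZ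
        exact P.mul_e_comp_of_ne hZ _
      · intro h; exact absurd (Finset.mem_univ _) h)
    (by
      ext p
      simp only [LinearMap.comp_apply, LinearMap.sum_apply, LinearMap.proj_apply,
        Submodule.subtype_apply, LinearMap.id_apply]
      change ∑ X, P.mul (Gam.inc 𝔄 (𝔄.base.e X)) p = p
      rw [← LinearMap.sum_apply, ← mul_sum', ← map_sum, MinAlg.sum_e, map_one, mul_one'])

lemma decomp_apply (p : P.carrier) (X : 𝔄.Vert) :
    (P.decomp p X : P.carrier) = P.mul (Gam.inc 𝔄 (𝔄.base.e X)) p := rfl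

lemma decomp_comp {X : 𝔄.Vert} (p : P.comp X) : P.decomp p = Pi.single X p := by
  refine funext fun Y => Subtype.ext ?_
  rw [decomp_apply]
  by_cases h : X = Y
  · subst h; rw [mul_e_comp, Pi.single_eq_same]
  · rw [mul_e_comp_of_ne P h, Pi.single_eq_of_ne (Ne.symm h)]; rfl

/-- A basis of `P` made of bases of the components `P 1_X`. -/
noncomputable def totalBasis {d : 𝔄.Vert → ℕ} (B : ∀ X, Module.Basis (Fin (d X)) k (P.comp X)) :
    Module.Basis (Σ X, Fin (d X)) k P.carrier :=
  (Pi.basis B).map P.decomp.symm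

section

variable {d : 𝔄.Vert → ℕ} (B : ∀ X, Module.Basis (Fin (d X)) k (P.comp X))

lemma totalBasis_apply (X : 𝔄.Vert) (a : Fin (d X)) :
    P.totalBasis B ⟨X, a⟩ = (B X a : P.carrier) := by
  rw [totalBasis, Module.Basis.map_apply, LinearEquiv.symm_apply_eq, decomp_comp, Pi.basis_apply]

lemma totalBasis_repr (p : P.carrier) (X : 𝔄.Vert) (a : Fin (d X)) :
    (P.totalBasis B).repr p ⟨X, a⟩ = (B X).repr (P.decomp p X) a := by
  rw [totalBasis, Module.Basis.map_repr]
  exact Pi.basis_repr B (P.decomp p) ⟨X, a⟩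

end

/-- A `Γ`-linear map as a morphism of `R(𝔅)`. -/
lemma idB_compr_mem {P Q : RepB 𝔄} (E : P.carrier →ₗ[k] Q.carrier)
    (h : ∀ g p, E (P.mul g p) = Q.mul g (E p)) : P.idB.compr₂ E ∈ homs P Q := by
  refine ⟨fun p g x => ?_, fun p x g => ?_⟩
  · exact congrArg E (P.idB_mem.1 p g x)
  · exact (congrArg E (P.idB_mem.2 p x g)).trans (h _ _)

lemma idB_compr_ω {P Q : RepB 𝔄} (E : P.carrier →ₗ[k] Q.carrier) :
    (P.idB.compr₂ E).flip (Om.ω 𝔄) = E := by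
  ext p
  exact congrArg E (DFunLike.congr_fun P.idB_ω p)

lemma idB_compr_v {P Q : RepB 𝔄} (E : P.carrier →ₗ[k] Q.carrier) (j : Fin 𝔄.m) :
    (P.idB.compr₂ E).flip (Om.v 𝔄 j) = 0 := by
  ext p
  exact (congrArg E (DFunLike.congr_fun (P.idB_v j) p)).trans (map_zero E)

/-- A `Γ`-linear map, regarded as a morphism through the counit, vanishes on all `v_j`. In the
composite only the `ω`-component remains, and it is the ordinary composite of linear maps. -/
lemma compB_idB_compr {P Q : RepB 𝔄} {E : P.carrier →ₗ[k] Q.carrier}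
    {E' : Q.carrier →ₗ[k] P.carrier} (h : ∀ g p, E (P.mul g p) = Q.mul g (E p))
    (h' : ∀ g p, E' (Q.mul g p) = P.mul g (E' p)) (hE : E' ∘ₗ E = LinearMap.id) :
    compB (idB_compr_mem E h) (idB_compr_mem E' h') = P.idB := by
  refine hom_ext (compB_mem _ _) P.idB_mem ?_ fun l => ?_
  · rw [compB_ω, idB_compr_ω, idB_compr_ω, homMul_apply, hE, idB_ω]
  · rw [compB_v]
    simp only [idB_compr_v, idB_v, compv, ev3_zero_left, homMul_apply, LinearMap.comp_zero,
      LinearMap.zero_comp, Finset.sum_const_zero, add_zero]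

/-- Isomorphic `Γ`-modules are isomorphic in `R(𝔅)`. -/
noncomputable def isoOfLinearEquiv {P Q : RepB 𝔄} (E : P.carrier ≃ₗ[k] Q.carrier)
    (h : ∀ g p, E (P.mul g p) = Q.mul g (E p)) : P ≅ Q :=
  have h' : ∀ g q, E.symm (Q.mul g q) = P.mul g (E.symm q) :=
    fun g q => E.injective (by simp [h])
  { hom := ⟨P.idB.compr₂ E.toLinearMap, idB_compr_mem _ h⟩
    inv := ⟨Q.idB.compr₂ E.symm.toLinearMap, idB_compr_mem _ h'⟩
    hom_inv_id := Subtype.ext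
      (compB_idB_compr (E := E.toLinearMap) (E' := E.symm.toLinearMap) h h' (by ext; simp))
    inv_hom_id := Subtype.ext
      (compB_idB_compr (E := E.symm.toLinearMap) (E' := E.toLinearMap) h' h (by ext; simp)) }

end RepB

end VertexDecomposition

/-! ### Essential surjectivity and the equivalence -/

section EssSurj

variable {k : Type u} [Field k] {𝔄 : MatrixBimoduleProblem k}

open MulOpposite

lemma Gam.algHom_ext {S : Type*} [Ring S] [Algebra k S] {f g : Gam 𝔄 →ₐ[k] S}
    (hi : ∀ r, f (Gam.inc 𝔄 r) = g (Gam.inc 𝔄 r)) (ha : ∀ l, f (Gam.a 𝔄 l) = g (Gam.a 𝔄 l)) :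
    f = g := by
  refine RingQuot.ringQuot_ext' k f g (FreeAlgebra.hom_ext (funext ?_))
  rintro (r | l)
  · exact hi r
  · exact ha l

/-- The matrices of the action of `Γ` on row vectors, in a basis. -/
noncomputable def RepB.matrixHom (P : RepB 𝔄) {ι : Type*} [Fintype ι] [DecidableEq ι]
    (B : Module.Basis ι k P.carrier) : Gam 𝔄 →ₐ[k] Matrix ι ι k :=
  AlgHom.ofLinearMap
    ((Matrix.transposeLinearEquiv ι ι k k).toLinearMap ∘ₗ (LinearMap.toMatrix B B).toLinearMap ∘ₗ
      P.act.toLinearMap ∘ₗ (opLinearEquiv k : Gam 𝔄 ≃ₗ[k] _).toLinearMap)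
    (by simp [LinearMap.toMatrix_one])
    -- The right action of `Γ` reverses products when written as endomorphisms; transposing the
    -- matrices restores their order.
    (fun g h => by simp [LinearMap.toMatrix_mul, Matrix.transpose_mul])

lemma RepB.matrixHom_apply (P : RepB 𝔄) {ι : Type*} [Fintype ι] [DecidableEq ι]
    (B : Module.Basis ι k P.carrier) (g : Gam 𝔄) (x y : ι) :
    P.matrixHom B g x y = B.repr (P.mul g (B x)) y :=
  LinearMap.toMatrix_apply B B (P.mul g) y x

lemma RepB.matrixHom_vecMul (P : RepB 𝔄) {ι : Type*} [Fintype ι] [DecidableEq ι]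
    (B : Module.Basis ι k P.carrier) (g : Gam 𝔄) (p : P.carrier) :
    B.equivFun (P.mul g p) = Matrix.vecMul (B.equivFun p) (P.matrixHom B g) := by
  have h := LinearMap.toMatrix_mulVec_repr B B (P.mul g) p
  refine h.symm.trans ?_
  rw [← Matrix.vecMul_transpose]
  rfl

variable [IsAlgClosed k]

/-- Every finite-dimensional `Γ`-module comes from a representation of `𝔄`. -/
theorem RepA.exists_iso_toB (P : RepB 𝔄) : ∃ Q : RepA 𝔄, Nonempty (Q.toB ≅ P) := by
  -- At each vertex a basis of `P 1_X` is chosen in which `R_X` acts through a regular Weyr matrix;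
  -- together these bases form a basis of `P`.
  choose d B W hW hB using fun X => exists_regular_basis (𝔄.base.loc X) (P.compAct X)
  let T := P.totalBasis B
  have ha : ∀ l x y, P.matrixHom T (Gam.a 𝔄 l) x y ≠ 0 → x.1 = 𝔄.A.src l ∧ y.1 = 𝔄.A.tgt l := by
    rintro l ⟨X, a⟩ ⟨Y, b⟩ h
    rw [RepB.matrixHom_apply] at h
    constructor
    · by_contra hX
      rw [← Gam.src_mul_a, RepB.mul_mul, RepB.totalBasis_apply, RepB.mul_e_comp_of_ne P hX,
        map_zero, map_zero] at h
      exact h rfl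
    · by_contra hY
      rw [RepB.totalBasis_repr] at h
      apply h
      -- Since `a_l = a_l 1_Z` for the target `Z`, its image has component `1_Z 1_Y = 0` at every
      -- other vertex `Y`.
      have : P.decomp (P.mul (Gam.a 𝔄 l) (T ⟨X, a⟩)) Y = 0 := by
        apply Subtype.ext
        rw [RepB.decomp_apply, ← Gam.a_mul_tgt, RepB.mul_mul, ← RepB.mul_mul P (Gam.inc 𝔄 _),
          ← map_mul, 𝔄.base.e_mul_e_of_ne (Ne.symm hY), map_zero, RepB.mul, op_zero, map_zero]
        rfl
      rw [this, map_zero]; rfl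
  let Q : RepA 𝔄 := ⟨d, W, hW, fun l => P.matrixHom T (Gam.a 𝔄 l), ha⟩
  -- `Γ` is generated by `R` and the `a_l`. The `a_l` agree by the choice of `Q`, and `R` acts by
  -- the block diagonal matrices of the chosen Weyr forms.
  have hQ : Q.gam = P.matrixHom T := by
    refine Gam.algHom_ext (fun r => ?_) fun l => gam_a Q l
    rw [gam_inc]
    ext ⟨X, a⟩ ⟨Y, b⟩
    rw [RepB.matrixHom_apply, RepB.totalBasis_apply, ← RepB.compAct_apply, RepB.totalBasis_repr,
      RepB.decomp_comp]
    change Matrix.blockDiagonal'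
      (fun X => evalLoc (𝔄.base.loc X) (W X) (hW X) (r X)) ⟨X, a⟩ ⟨Y, b⟩ = _
    by_cases h : X = Y
    · subst h
      rw [Matrix.blockDiagonal'_apply_eq, Pi.single_eq_same]
      rw [← hB, rowMatrixHom_apply, Matrix.transpose_apply, LinearMap.toMatrix_apply]
    · rw [Matrix.blockDiagonal'_apply_ne _ _ _ h, Pi.single_eq_of_ne (Ne.symm h), map_zero]
      rfl
  refine ⟨Q, ⟨(RepB.isoOfLinearEquiv (P := P) (Q := Q.toB) T.equivFun fun g p => ?_).symm⟩⟩
  rw [toB_mul, hQ]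
  exact (RepB.matrixHom_vecMul P T g p).trans (rowMap_apply _ _).symm

instance : (RepA.functorB 𝔄).EssSurj where
  mem_essImage P := RepA.exists_iso_toB P

instance : (RepA.functorB 𝔄).IsEquivalence where

end EssSurj

end MBP

theorem corollary1p4p3 {k : Type u} [Field k] [IsAlgClosed k] (𝔄 : MBP.MatrixBimoduleProblem k) :
    (∀ l : Fin 𝔄.n,
      (MBP.formalL 𝔄 (MBP.Xi.ω 𝔄) (MBP.Xi.v 𝔄) - MBP.formalR 𝔄 (MBP.Xi.ω 𝔄) (MBP.Xi.v 𝔄))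
          (𝔄.lead l).1 (𝔄.lead l).2 =
        (MBP.lmul 𝔄 (MBP.Xi 𝔄) (MBP.Gam.a 𝔄 l) (MBP.Xi.ω 𝔄) -
            MBP.rmul 𝔄 (MBP.Xi 𝔄) (MBP.Xi.ω 𝔄) (MBP.Gam.a 𝔄 l)) -
          (MBP.iota11 𝔄 (MBP.Xi.v 𝔄) l - MBP.tau11 𝔄 (MBP.Xi.v 𝔄) l +
            MBP.del1 𝔄 (MBP.Xi.v 𝔄) l)) ∧
    MBP.formalL 𝔄 (MBP.Om.ω 𝔄) (MBP.Om.v 𝔄) = MBP.formalR 𝔄 (MBP.Om.ω 𝔄) (MBP.Om.v 𝔄) ∧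
    (∀ l : Fin 𝔄.n, MBP.Om.δ 𝔄 (MBP.Gam.a 𝔄 l) =
      MBP.iota11 𝔄 (MBP.Om.v 𝔄) l - MBP.tau11 𝔄 (MBP.Om.v 𝔄) l + MBP.del1 𝔄 (MBP.Om.v 𝔄) l) ∧
    ∃ e : MBP.RepA 𝔄 ≌ MBP.RepB 𝔄, e.functor.Additive ∧ e.functor.Linear k := by
  -- The leading entry is computed in `Ξ`, where `ω` is already central. The formal equation itself
  -- needs the relations `kap = 0`, which hold after passage to `Ω`.
  refine ⟨fun l => MBP.formalL_sub_formalR_lead 𝔄 _ (MBP.Xi.central 𝔄) l,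
    (MBP.formalL_eq_formalR_iff 𝔄 _ (MBP.Om.central 𝔄)).2 (MBP.Om.kap_eq_zero 𝔄), fun l => ?_,
    (MBP.RepA.functorB 𝔄).asEquivalence, ?_, ?_⟩
  -- The formula for `δ(a_l)` is the defining relation of `Ω`, solved for `a_l ω - ω a_l`.
  · change MBP.lmul 𝔄 _ (MBP.Gam.a 𝔄 l) (MBP.Om.ω 𝔄) -
      MBP.rmul 𝔄 _ (MBP.Om.ω 𝔄) (MBP.Gam.a 𝔄 l) = _
    rw [MBP.omega_a]
    abel
  · exact inferInstanceAs (MBP.RepA.functorB 𝔄).Additive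
  · exact inferInstanceAs ((MBP.RepA.functorB 𝔄).Linear k)
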